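/- **Model.** Let $p$ be the number of communities, $a_k,b_k>0$ ($1\le k\le p$), $\sigma<1$, $\tau>0$, $\eta\ge 0$, $\delta\ge 0$. Let $\rho_0(dw)=\frac{1}{\Gamma(1-\sigma)}w^{-1-\sigma}e^{-\tau w}\,dw$ on $(0,\infty)$, and let $F_k$ be the Gamma distribution with shape $a_k$ and rate $b_k$. In the Hawkes–CCRM model, the pairs (base weight, label) $(w_{i0},\theta_i)_{i\ge1}$ are the points of a Poisson process on $(0,\infty)\times\mathbb R_+$ with mean measure $\rho_0(dw)\,d\theta$; independently of these, the scores $\beta_{ik}\sim F_k$ are independent of each other; and $w_{ik}=w_{i0}\beta_{ik}$. For nodes $i\ne j$, $N_{ij}(t)$ denotes the number of interactions from $i$ to $j$ in $[0,t]$. Given the nodes (their weights and labels), the processes of different unordered pairs $\{i,j\}$ are independent, and $N_{ij},N_{ji}$ are mutually exciting Hawkes processes, almost surely without simultaneous events, with conditional intensities $$\lambda_{ij}(t)=\sum_{k=1}^p w_{ik}w_{jk}+\int_{[0,t)}\eta e^{-\delta(t-u)}\,dN_{ji}(u),\qquad \lambda_{ji}(t)=\sum_{k=1}^p w_{ik}w_{jk}+\int_{[0,t)}\eta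 e^{-\delta(t-u)}\,dN_{ij}(u).$$ Let $\rho$ be the multivariate Lévy measure on $\mathbb R_+^p$, that is, the image of $\rho_0\otimes F_1\otimes\cdots\otimes F_p$ under $(w_0,\beta_1,\dots,\beta_p)\mapsto(w_0\beta_1,\dots,w_0\beta_p)$, and let $$\psi(t_1,\dots,t_p)=\int_{\mathbb R_+^p}\bigl(1-e^{-\sum_k t_kw_k}\bigr)\rho(dw),\qquad \mu_w=\int_{\mathbb R_+^p} w\,\rho(dw).$$ For $\alpha,T\ge0$ let $$I_{\alpha,T}=\sum_{i\ne j}N_{ij}(T)1_{\theta_i\le\alpha}1_{\theta_j\le\alpha},\qquad E_{\alpha,T}=\sum_{i<j}1_{N_{ij}(T)+N_{ji}(T)>0}1_{\theta_i\le\alpha}1_{\theta_j\le\alpha},$$ $$V_{\alpha,T}=\sum_i 1_{\theta_i\le\alpha}1_{\sum_{j\ne i}(N_{ij}(T)+N_{ji}(T))1_{\theta_j\le\alpha}>0}$$ be the numbers of interactions, of edges (unordered pairs that interacted) and of active nodes (nodes that took part, as sender or receiver, in at least one interaction) among the nodes with label at most $\alpha$, until time $T$. **Theorem.** All integrals below,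 and those defining $\psi$ on $\mathbb R_+^p$ and $\mu_w$, converge, and $$\mathbb E[I_{\alpha,T}]=\alpha^2\mu_w^{T}\mu_w\left(\frac{\delta}{\delta-\eta}T-\frac{\eta}{(\delta-\eta)^2}\bigl(1-e^{-T(\delta-\eta)}\bigr)\right)\quad\text{if }\delta\ne\eta,$$ $$\mathbb E[E_{\alpha,T}]=\frac{\alpha^2}{2}\int_{\mathbb R_+^p}\psi(2Tw_1,\dots,2Tw_p)\,\rho(dw),$$ $$\mathbb E[V_{\alpha,T}]=\alpha\int_{\mathbb R_+^p}\bigl(1-e^{-\alpha\psi(2Tw_1,\dots,2Tw_p)}\bigr)\rho(dw).$$ -/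

import Mathlib

open MeasureTheory ProbabilityTheory
open scoped ENNReal NNReal

noncomputable section

namespace HawkesCCRM

/-! ### Poisson point processes -/

/-- The number of points of the random sequence `X` that lie in `B`. -/
def count {Ω E : Type*} (X : ℕ → Ω → E) (B : Set E) (ω : Ω) : ℝ≥0∞ :=
  ∑' i, B.indicator (fun _ => 1) (X i ω)

/-- The points `X 0, X 1, …` form a Poisson point process with mean measure `m`: the number of
points in a measurable set of finite mean measure is Poisson distributed with that mean, and the
numbers of points in disjoint measurable sets are independent. -/
structure IsPoissonProcess {Ω E : Type*} [MeasurableSpace Ω] [MeasurableSpace E]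
    (X : ℕ → Ω → E) (m : Measure E) (P : Measure Ω) : Prop where
  measurable : ∀ i, Measurable (X i)
  law : ∀ B : Set E, MeasurableSet B → m B < ⊤ →
    HasLaw (count X B) ((poissonMeasure (m B).toNNReal).map (fun n : ℕ => (n : ℝ≥0∞))) P
  indep : ∀ (n : ℕ) (B : Fin n → Set E), (∀ k, MeasurableSet (B k)) →
    Pairwise (fun k l => Disjoint (B k) (B l)) → iIndepFun (fun k => count X (B k)) P

/-! ### The compound completely random measure -/

/-- The Lévy measure of the generalized gamma process, on `(0, ∞)`:
`ρ₀(dw) = w ^ (-1 - σ) * exp (-τ w) / Γ(1 - σ) dw`. -/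
def ggpLevy (σ τ : ℝ) : Measure ℝ :=
  (volume.restrict (Set.Ioi 0)).withDensity
    (fun w => ENNReal.ofReal (w ^ (-1 - σ) * Real.exp (-(τ * w)) / Real.Gamma (1 - σ)))

/-- The multivariate Lévy measure of the compound CRM, where `F k` is the gamma distribution with
shape `a k` and rate `b k`: the image of `ρ₀ ⊗ F 1 ⊗ ⋯ ⊗ F p` under
`(w₀, β) ↦ (w₀ β 1, …, w₀ β p)`; that is, `ρ(A)` is the integral over `w₀` with respect to `ρ₀`
of the probability that `w₀ β ∈ A`. -/
def levy {p : ℕ} (a b : Fin p → ℝ) (σ τ : ℝ) : Measure (Fin p → ℝ) :=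
  ((ggpLevy σ τ).prod (Measure.pi fun k => gammaMeasure (a k) (b k))).map (fun x => x.1 • x.2)

/-- The multivariate Laplace exponent `ψ` of a measure `ρ` on `ℝᵖ`. -/
def laplaceExponent {p : ℕ} (ρ : Measure (Fin p → ℝ)) (t : Fin p → ℝ) : ℝ :=
  ∫ w, (1 - Real.exp (-∑ k, t k * w k)) ∂ρ

/-- The mean vector `μ_w` of a measure `ρ` on `ℝᵖ`. -/
def meanWeight {p : ℕ} (ρ : Measure (Fin p → ℝ)) (k : Fin p) : ℝ :=
  ∫ w, w k ∂ρ

/-! ### Temporal networks: nodes with weights and labels, and interaction times -/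

/-- The random elements of the model. Node `i` has base weight `w₀ i`, label `θ i` and scores
`β i k`; `time i j n` is the time of the interaction number `n` from node `i` to node `j`, and is
`⊤` if there are at most `n` such interactions. The diagonal `time i i` plays no role. -/
structure Network (Ω : Type*) [MeasurableSpace Ω] (p : ℕ) where
  w₀ : ℕ → Ω → ℝ
  θ : ℕ → Ω → ℝ
  β : ℕ → Fin p → Ω → ℝ
  time : ℕ → ℕ → ℕ → Ω → ℝ≥0∞
  measurable_w₀ : ∀ i, Measurable (w₀ i)
  measurable_θ : ∀ i, Measurable (θ i)
  measurable_β : ∀ i k, Measurable (β i k)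
  measurable_time : ∀ i j n, Measurable (time i j n)

namespace Network

variable {Ω : Type*} [mΩ : MeasurableSpace Ω] {p : ℕ} (X : Network Ω p)

/-- The affiliation `w i k = w₀ i * β i k` of node `i` to community `k`. -/
def weight (i : ℕ) (k : Fin p) (ω : Ω) : ℝ := X.w₀ i ω * X.β i k ω

/-- `N i j t` is the number of interactions from `i` to `j` in the time interval `[0, t]`. -/
def N (i j : ℕ) (t : ℝ≥0) (ω : Ω) : ℝ≥0∞ := count (X.time i j) (Set.Iic (t : ℝ≥0∞)) ω

theorem measurable_N (i j : ℕ) (t : ℝ≥0) : Measurable (X.N i j t) :=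
  Measurable.tsum fun n =>
    (measurable_const.indicator measurableSet_Iic).comp (X.measurable_time i j n)

/-- The intensity of the interactions from `i` to `j`,
`λ i j t = ∑ k, w i k * w j k + ∑ η * exp (-δ (t - u))`, where the last sum is over the times
`u < t` of the interactions from `j` to `i`. -/
def intensity (η δ : ℝ) (i j : ℕ) (t : ℝ≥0) (ω : Ω) : ℝ≥0∞ :=
  ENNReal.ofReal (∑ k, X.weight i k ω * X.weight j k ω) +
    ∑' n, (Set.Iio (t : ℝ≥0∞)).indicator
      (fun u => ENNReal.ofReal (η * Real.exp (-(δ * (t - u.toReal))))) (X.time j i n ω)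

/-- The history at time `t`: everything about the nodes, and all interactions in `[0, t]`. -/
def history : Filtration ℝ≥0 mΩ where
  seq t := (⨆ i, MeasurableSpace.comap (X.w₀ i) inferInstance) ⊔
    (⨆ i, MeasurableSpace.comap (X.θ i) inferInstance) ⊔
    (⨆ i, ⨆ k, MeasurableSpace.comap (X.β i k) inferInstance) ⊔
    (⨆ i, ⨆ j, ⨆ _ : i ≠ j, ⨆ s, ⨆ _ : s ≤ t, MeasurableSpace.comap (X.N i j s) inferInstance)
  mono' := by
    intro s t hst
    refine sup_le_sup_left ?_ _
    refine iSup_mono fun i => iSup_mono fun j => iSup_mono fun _ => iSup_mono fun r => ?_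
    exact iSup_le fun h => le_iSup_of_le (h.trans hst) le_rfl
  le' t := sup_le (sup_le (sup_le (iSup_le fun i => (X.measurable_w₀ i).comap_le)
    (iSup_le fun i => (X.measurable_θ i).comap_le))
    (iSup_le fun i => iSup_le fun k => (X.measurable_β i k).comap_le))
    (iSup_le fun i => iSup_le fun j => iSup_le fun _ => iSup_le fun s => iSup_le fun _ =>
      (X.measurable_N i j s).comap_le)

/-- The number `I` of interactions until time `T` between nodes with label at most `α`. -/
def interactions (α T : ℝ≥0) (ω : Ω) : ℝ≥0∞ :=
  open Classical in
  ∑' i, ∑' j, if i ≠ j ∧ X.θ i ω ≤ α ∧ X.θ j ω ≤ α then X.N i j T ω else 0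

/-- The number `E` of unordered pairs of nodes with label at most `α` that interacted, in at least
one direction, until time `T`. -/
def edges (α T : ℝ≥0) (ω : Ω) : ℝ≥0∞ :=
  open Classical in
  ∑' i, ∑' j,
    if i < j ∧ X.θ i ω ≤ α ∧ X.θ j ω ≤ α ∧ 0 < X.N i j T ω + X.N j i T ω then 1 else 0

/-- The number `V` of nodes with label at most `α` that took part, as sender or as receiver, in at
least one interaction with a node with label at most `α` until time `T`. -/
def activeNodes (α T : ℝ≥0) (ω : Ω) : ℝ≥0∞ :=
  open Classical in
  ∑' i, if X.θ i ω ≤ α ∧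
    0 < ∑' j, (if j ≠ i ∧ X.θ j ω ≤ α then X.N i j T ω + X.N j i T ω else 0) then 1 else 0

end Network

/-! ### The Hawkes–CCRM model -/

/-- The point process with event times `t 0, t 1, …` (`⊤` means: no such event) has the
`F`-intensity `lam`: for each nonnegative `F`-predictable process `C`, the expectations of
`∫ C dN = ∑ n, C (t n)` and of `∫ C s * lam s ds` agree. -/
def HasIntensity {Ω : Type*} {mΩ : MeasurableSpace Ω} (F : Filtration ℝ≥0 mΩ)
    (t : ℕ → Ω → ℝ≥0∞) (lam : ℝ≥0 → Ω → ℝ≥0∞) (P : Measure Ω) : Prop :=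
  ∀ C : ℝ≥0 × Ω → ℝ≥0∞, Measurable[F.predictable] C →
    ∫⁻ ω, ∑' n, (Set.Iio ⊤).indicator (fun u : ℝ≥0∞ => C (u.toNNReal, ω)) (t n ω) ∂P =
      ∫⁻ ω, (∫⁻ s in Set.Ioi (0 : ℝ), C (s.toNNReal, ω) * lam s.toNNReal ω) ∂P

/-- The Hawkes–CCRM model. The pairs (base weight, label) are the points of a Poisson process with
mean measure `ρ₀(dw) dθ`. The scores are independent of them and of each other, and gamma
distributed. The interactions form a multivariate simple point process (locally finite, without
simultaneous interactions) in which `i → j` has the conditional intensity `λ i j` given the history;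
so, given the nodes, different pairs `{i, j}` evolve independently of each other, each as a pair of
mutually exciting Hawkes processes. -/
structure IsHawkesCCRM {Ω : Type*} [MeasurableSpace Ω] {p : ℕ} (X : Network Ω p) (P : Measure Ω)
    (a b : Fin p → ℝ) (σ τ η δ : ℝ) : Prop where
  poisson : IsPoissonProcess (fun i ω => (X.w₀ i ω, X.θ i ω))
    ((ggpLevy σ τ).prod (volume.restrict (Set.Ici 0))) P
  score_law : ∀ i k, HasLaw (X.β i k) (gammaMeasure (a k) (b k)) P
  score_indep : iIndepFun (fun q : ℕ × Fin p => X.β q.1 q.2) P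
  indep : IndepFun (fun ω i => (X.w₀ i ω, X.θ i ω)) (fun ω i k => X.β i k ω) P
  time_pos : ∀ i j, i ≠ j → ∀ᵐ ω ∂P, 0 < X.time i j 0 ω
  time_mono : ∀ i j, i ≠ j → ∀ᵐ ω ∂P, Monotone (fun n => X.time i j n ω)
  time_lt : ∀ i j, i ≠ j → ∀ᵐ ω ∂P, ∀ n, X.time i j n ω < ⊤ →
    X.time i j n ω < X.time i j (n + 1) ω
  time_tendsto : ∀ i j, i ≠ j → ∀ᵐ ω ∂P,
    Filter.Tendsto (fun n => X.time i j n ω) Filter.atTop (nhds ⊤)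
  time_ne : ∀ i j k l, i ≠ j → k ≠ l → (i, j) ≠ (k, l) → ∀ᵐ ω ∂P, ∀ m n,
    X.time i j m ω < ⊤ → X.time i j m ω ≠ X.time k l n ω
  intensity : ∀ i j, i ≠ j →
    HasIntensity X.history (X.time i j) (X.intensity η δ i j) P

end HawkesCCRM

end

-- The expectations are computed in two stages: given the nodes, and then over the Poisson process
-- of nodes. Almost everything is done in `ℝ≥0∞` with `expNeg x = exp (-x)` and `expNeg ⊤ = 0`, so
-- that infinite sums and infinite Lévy measures need no integrability. Finiteness matters only
-- where something is subtracted, cancelled or turned into a real integral.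
--
-- Nodes. The law of the counts gives the Laplace functional `E exp (-∑ g (Y i)) = exp (-∫ (1 - exp
-- (-g)) dm)`: for simple `g` by independence and the Poisson generating function, in general by
-- monotone limits. Independent scores can be attached as marks (`HasPoissonLaplace.marking`), so
-- base weights, labels and scores together form one Poisson process. Differentiating the functional
-- in `g` gives Campbell's formula and Mecke-type formulas for sums over a point and its partners:
-- `HasPoissonLaplace.lintegral_tsum_tsum` (pairs) and
-- `HasPoissonLaplace.lintegral_tsum_one_sub_expNeg` (points with a partner).
--
-- Absence of events. The dynamics enter through the intensity identity, tested against predictable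
-- processes. Let `L` be the total base rate of a finite set of directed pairs closed under
-- reversal. Up to and including the first event nothing has been excited, so the total intensity is
-- `L`. Testing against `exp (-L (T - s))`, switched off after the first event, shows that no event
-- occurs until `T` with conditional probability `exp (-L T)` (`IsHawkesCCRM.lintegral_no_event`).
-- The two directions of a pair share a base rate, whence the argument `2 T w` of `ψ`, and `η`, `δ`
-- do not enter the formulas for edges and active nodes.
--
-- Mean number of events. The two directions of a pair excite each other in the same way, so the
-- mean `y` of their summed intensity solves a scalar Volterra equation `y = c + k * y` with `k r =
-- η exp (-δ r)`. If `f` solves the adjoint equation `f u = 1 + ∫ s in u..T, f s * k (s - u)`, then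
-- integrating `f y` over `[0, T]` in two ways gives `∫ y = c ∫ f`, and `∫ f` is the bracket in the
-- formula for the interactions. The cancellation needs `∫ y` finite, which is obtained by stopping
-- when many events have occurred.
--
-- Assembly. The labels are known at time 0, so the conditional formulas hold on label events. Base
-- rates are inner products of weights, and integrating out a label in `[0, α]` turns the mean
-- measure of the points into `α` times the multivariate Lévy measure.

noncomputable section

namespace HawkesCCRM

open Filter Topology

-- The exponential on `ℝ≥0∞` and its difference quotients.

/-- The function `x ↦ exp (-x)` on the extended nonnegative reals. -/
def expNeg (x : ℝ≥0∞) : ℝ≥0∞ := EReal.exp (-(x : EReal))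

theorem expNeg_zero : expNeg 0 = 1 := by simp [expNeg]

theorem expNeg_top : expNeg ⊤ = 0 := by simp [expNeg]

theorem continuous_expNeg : Continuous expNeg :=
  ENNReal.continuous_exp.comp (continuous_neg.comp continuous_coe_ennreal_ereal)

@[fun_prop]
theorem measurable_expNeg : Measurable expNeg := continuous_expNeg.measurable

@[fun_prop]
theorem _root_.Measurable.expNeg {α : Type*} [MeasurableSpace α] {f : α → ℝ≥0∞}
    (hf : Measurable f) : Measurable fun x => expNeg (f x) := measurable_expNeg.comp hf

theorem antitone_expNeg : Antitone expNeg := fun _ _ h =>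
  EReal.exp_monotone (EReal.neg_le_neg_iff.2 (EReal.coe_ennreal_le_coe_ennreal_iff.2 h))

theorem expNeg_le_one (x : ℝ≥0∞) : expNeg x ≤ 1 := by
  rw [← expNeg_zero]; exact antitone_expNeg bot_le

theorem expNeg_ne_top (x : ℝ≥0∞) : expNeg x ≠ ⊤ :=
  ((expNeg_le_one x).trans_lt ENNReal.one_lt_top).ne

theorem expNeg_ofReal {x : ℝ} (hx : 0 ≤ x) :
    expNeg (ENNReal.ofReal x) = ENNReal.ofReal (Real.exp (-x)) := by
  rw [expNeg, EReal.coe_ennreal_ofReal, max_eq_left hx, ← EReal.coe_neg, EReal.exp_coe]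

theorem expNeg_add (x y : ℝ≥0∞) : expNeg (x + y) = expNeg x * expNeg y := by
  induction x with
  | top => simp [expNeg_top]
  | coe x =>
    induction y with
    | top => simp [expNeg_top]
    | coe y =>
      rw [← ENNReal.coe_add, ← ENNReal.ofReal_coe_nnreal, ← ENNReal.ofReal_coe_nnreal,
        ← ENNReal.ofReal_coe_nnreal, expNeg_ofReal (by positivity), expNeg_ofReal (by positivity),
        expNeg_ofReal (by positivity), ← ENNReal.ofReal_mul (by positivity), ← Real.exp_add]
      congr 2
      push_cast
      ring

theorem expNeg_sum {ι : Type*} (s : Finset ι) (f : ι → ℝ≥0∞) :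
    expNeg (∑ i ∈ s, f i) = ∏ i ∈ s, expNeg (f i) := by
  classical
  induction s using Finset.induction_on with
  | empty => simp [expNeg_zero]
  | insert i s hi ih => rw [Finset.sum_insert hi, Finset.prod_insert hi, expNeg_add, ih]

theorem expNeg_ne_zero {x : ℝ≥0∞} (hx : x ≠ ⊤) : expNeg x ≠ 0 := by
  lift x to ℝ≥0 using hx
  rw [← ENNReal.ofReal_coe_nnreal, expNeg_ofReal (by positivity)]
  simp [Real.exp_pos]

theorem expNeg_tsum {f : ℕ → ℝ≥0∞} :
    Filter.Tendsto (fun n => ∏ i ∈ Finset.range n, expNeg (f i)) Filter.atTop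
      (nhds (expNeg (∑' i, f i))) := by
  simp_rw [← expNeg_sum]
  exact (continuous_expNeg.tendsto _).comp ENNReal.summable.hasSum.tendsto_sum_nat

/-- The inverse of `expNeg` on `[0, 1]`. -/
def negLog (y : ℝ≥0∞) : ℝ≥0∞ := (-(ENNReal.log y)).toENNReal

@[fun_prop]
theorem measurable_negLog : Measurable negLog := by
  unfold negLog
  fun_prop

theorem expNeg_negLog {y : ℝ≥0∞} (hy : y ≤ 1) : expNeg (negLog y) = y := by
  rw [expNeg, negLog, EReal.coe_toENNReal, neg_neg, ENNReal.exp_log]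
  rw [← EReal.neg_le_neg_iff, neg_neg, neg_zero]
  exact ENNReal.log_le_zero_iff.2 hy

/-- The difference quotients of `1 - exp (-x)`, which increase to `x`. -/
def expQuot (n : ℕ) (x : ℝ≥0∞) : ℝ≥0∞ := 2 ^ n * (1 - expNeg (x / 2 ^ n))

theorem one_sub_expNeg_add (x y : ℝ≥0∞) :
    1 - expNeg (x + y) = (1 - expNeg x) + expNeg x * (1 - expNeg y) := by
  rw [expNeg_add, ENNReal.mul_sub (fun _ _ => expNeg_ne_top x), mul_one]
  exact (tsub_add_tsub_cancel (expNeg_le_one x)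
    (mul_le_of_le_one_right' (expNeg_le_one y))).symm

theorem one_sub_expNeg_mono : Monotone fun x => 1 - expNeg x :=
  fun _ _ h => tsub_le_tsub_left (antitone_expNeg h) 1

theorem one_sub_expNeg_le_one_sub {x y : ℝ≥0∞} (h : x ≤ y) : 1 - expNeg x ≤ 1 - expNeg y :=
  one_sub_expNeg_mono h

theorem continuous_one_sub_expNeg : Continuous fun x => 1 - expNeg x :=
  (ENNReal.continuous_sub_left ENNReal.one_ne_top).comp continuous_expNeg

theorem one_sub_expNeg_le (x : ℝ≥0∞) : 1 - expNeg x ≤ x := by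
  induction x with
  | top => simp
  | coe x =>
    rw [← ENNReal.ofReal_coe_nnreal, expNeg_ofReal (by positivity), ← ENNReal.ofReal_one,
      ← ENNReal.ofReal_sub _ (by positivity)]
    apply ENNReal.ofReal_le_ofReal
    linarith [Real.add_one_le_exp (-(x : ℝ))]

/-- Halving the step: `1 - exp (-2z) = (1 - exp (-z)) (1 + exp (-z)) ≤ 2 (1 - exp (-z))`.
Monotonicity in `n` is what lets derivatives of Laplace functionals be taken by monotone
convergence, without domination. -/
theorem expQuot_monotone_left (x : ℝ≥0∞) : Monotone fun n => expQuot n x := by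
  refine monotone_nat_of_le_succ fun n => ?_
  have h : x / 2 ^ n = x / 2 ^ (n + 1) + x / 2 ^ (n + 1) := by
    have h' : x / 2 ^ (n + 1) = x / 2 ^ n / 2 := by
      rw [pow_succ, div_eq_mul_inv, div_eq_mul_inv, div_eq_mul_inv,
        ENNReal.mul_inv (by simp) (by simp), mul_assoc]
    rw [h', ENNReal.add_halves]
  rw [expQuot, expQuot, h, one_sub_expNeg_add, pow_succ, mul_assoc, two_mul]
  gcongr
  exact mul_le_of_le_one_left' (expNeg_le_one _)

theorem expQuot_le_expQuot {n k : ℕ} (h : n ≤ k) (x : ℝ≥0∞) : expQuot n x ≤ expQuot k x :=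
  expQuot_monotone_left x h

theorem expQuot_monotone_right (n : ℕ) : Monotone (expQuot n) := fun _ _ h =>
  mul_le_mul_right (one_sub_expNeg_mono (ENNReal.div_le_div_right h _)) _

theorem continuous_expQuot (n : ℕ) : Continuous (expQuot n) := by
  unfold expQuot
  refine ENNReal.continuous_const_mul (by simp) |>.comp
    (continuous_one_sub_expNeg.comp (ENNReal.continuous_div_const _ (by simp)))

@[fun_prop]
theorem measurable_expQuot (n : ℕ) : Measurable (expQuot n) := (continuous_expQuot n).measurable

theorem expQuot_le (n : ℕ) (x : ℝ≥0∞) : expQuot n x ≤ x := by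
  refine (mul_le_mul_right (one_sub_expNeg_le _) _).trans ?_
  rw [ENNReal.mul_div_cancel (by simp) (by simp)]

theorem expQuot_iSup (x : ℝ≥0∞) : ⨆ n, expQuot n x = x := by
  refine le_antisymm (iSup_le fun n => expQuot_le n x) ?_
  induction x with
  | top =>
    have : ∀ n, expQuot n ⊤ = 2 ^ n := fun n => by
      simp [expQuot, ENNReal.top_div_of_ne_top, expNeg_top]
    simp_rw [this]
    refine le_of_tendsto_of_tendsto'
      (ENNReal.tendsto_pow_atTop_nhds_top_iff.2 (by norm_num : (1 : ℝ≥0∞) < 2))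
      tendsto_const_nhds (fun n => le_iSup (fun n => (2 : ℝ≥0∞) ^ n) n)
  | coe x =>
    -- From `1 - exp (-y) ≥ y - y ^ 2` at `y = x / 2 ^ n`, multiplied by `2 ^ n`; the error `x ^ 2 /
    -- 2 ^ n` vanishes in the limit.
    have key : ∀ n, ENNReal.ofReal (x - x ^ 2 / 2 ^ n) ≤ expQuot n x := by
      intro n
      have h2 : (2 : ℝ≥0∞) ^ n = ENNReal.ofReal (2 ^ n) := by
        rw [ENNReal.ofReal_pow (by norm_num)]; simp
      rw [expQuot, h2, ← ENNReal.ofReal_coe_nnreal, ← ENNReal.ofReal_div_of_pos (by positivity),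
        expNeg_ofReal (by positivity), ← ENNReal.ofReal_one,
        ← ENNReal.ofReal_sub _ (by positivity), ← ENNReal.ofReal_mul (by positivity)]
      apply ENNReal.ofReal_le_ofReal
      have hy : 0 ≤ (x : ℝ) / 2 ^ n := by positivity
      set y : ℝ := (x : ℝ) / 2 ^ n with hy'
      have hx : (x : ℝ) = 2 ^ n * y := by rw [hy']; field_simp
      have h1 : y - y ^ 2 ≤ 1 - Real.exp (-y) := by
        have h3 : Real.exp (-y) ≤ (1 + y)⁻¹ := by
          rw [Real.exp_neg]
          exact inv_anti₀ (by positivity) (by linarith [Real.add_one_le_exp y])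
        have h4 : (1 + y)⁻¹ ≤ 1 - y + y ^ 2 := by
          rw [inv_le_iff_one_le_mul₀ (by positivity)]
          nlinarith [pow_nonneg hy 3]
        linarith
      have : (x : ℝ) - x ^ 2 / 2 ^ n = 2 ^ n * (y - y ^ 2) := by
        rw [hx]; field_simp
      rw [this]
      gcongr
    have ht : Filter.Tendsto (fun n : ℕ => ENNReal.ofReal ((x : ℝ) - x ^ 2 / 2 ^ n)) Filter.atTop
        (nhds (ENNReal.ofReal ((x : ℝ) - 0))) := by
      refine ENNReal.tendsto_ofReal (tendsto_const_nhds.sub ?_)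
      have := (tendsto_pow_atTop_nhds_zero_of_lt_one (r := (1 / 2 : ℝ)) (by norm_num)
        (by norm_num)).const_mul ((x : ℝ) ^ 2)
      simpa [div_eq_mul_inv] using this
    rw [sub_zero, ENNReal.ofReal_coe_nnreal] at ht
    exact le_of_tendsto' ht fun n => (key n).trans (le_iSup (fun n => expQuot n x) n)

/-- A diagonal argument: both indices act monotonically, so the joint supremum is an iterated one.
It is needed because differentiating a Laplace functional puts one quotient inside the integral and
another, with the same `n`, outside. -/
theorem iSup_expQuot_of_monotone {e : ℕ → ℝ≥0∞} (he : Monotone e) :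
    ⨆ n, expQuot n (e n) = ⨆ n, e n := by
  refine le_antisymm (iSup_mono fun n => expQuot_le n _) ?_
  conv_lhs => rw [← expQuot_iSup (⨆ n, e n)]
  refine iSup_le fun m => ?_
  have h : expQuot m (⨆ n, e n) = ⨆ n, expQuot m (e n) :=
    (expQuot_monotone_right m).map_iSup_of_continuousAt (continuous_expQuot m).continuousAt
      (by simp [expQuot, expNeg_zero])
  rw [h]
  refine iSup_le fun n => ?_
  refine le_trans ?_ (le_iSup _ (max m n))
  exact (expQuot_monotone_left (e n) (le_max_left m n)).trans
    (expQuot_monotone_right _ (he (le_max_right m n)))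

/-- A measurable function is the increasing limit of simple functions with finite values and
finite integral. -/
theorem exists_simpleFunc_iSup {E : Type*} [MeasurableSpace E] (m : Measure E) [SigmaFinite m]
    {g : E → ℝ≥0∞} (hg : Measurable g) :
    ∃ s : ℕ → SimpleFunc E ℝ≥0∞, Monotone (fun n y => s n y) ∧ (∀ y, ⨆ n, s n y = g y) ∧
      (∀ n y, s n y ≠ ⊤) ∧ ∀ n, m {y | s n y ≠ 0} < ⊤ := by
  -- `eapprox` has finite values; cutting it off outside the `n`-th spanning set also makes the
  -- support of finite measure.
  have hs : ∀ n y, (SimpleFunc.eapprox g n).restrict (spanningSets m n) y =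
      (spanningSets m n).indicator (SimpleFunc.eapprox g n) y := fun n y =>
    SimpleFunc.restrict_apply _ (measurableSet_spanningSets m n) y
  have hmono : Monotone (fun n y => (SimpleFunc.eapprox g n).restrict (spanningSets m n) y) := by
    intro n k hnk y
    simp only [hs]
    exact (Set.indicator_le_indicator (SimpleFunc.monotone_eapprox g hnk y)).trans
      (Set.indicator_le_indicator_of_subset (monotone_spanningSets m hnk) (fun _ => bot_le) y)
  refine ⟨fun n => (SimpleFunc.eapprox g n).restrict (spanningSets m n), hmono, fun y => ?_,
    fun n y => ?_, fun n => ?_⟩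
  · refine le_antisymm (iSup_le fun n => ?_) ?_
    · rw [hs]
      refine (Set.indicator_le_self _ _ _).trans ?_
      rw [← SimpleFunc.iSup_eapprox_apply hg y]
      exact le_iSup (fun n => SimpleFunc.eapprox g n y) n
    · rw [← SimpleFunc.iSup_eapprox_apply hg y]
      refine iSup_le fun n => ?_
      have hy : y ∈ ⋃ n, spanningSets m n := by simp [iUnion_spanningSets]
      obtain ⟨k, hk⟩ := Set.mem_iUnion.1 hy
      refine le_trans ?_ (le_iSup _ (max n k))
      rw [hs, Set.indicator_of_mem (monotone_spanningSets m (le_max_right n k) hk)]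
      exact SimpleFunc.monotone_eapprox g (le_max_left n k) y
  · rw [hs]
    exact ((Set.indicator_le_self _ _ _).trans_lt (SimpleFunc.eapprox_lt_top g n y)).ne
  · refine (measure_mono ?_).trans_lt (measure_spanningSets_lt_top m n)
    intro y hy
    by_contra h
    exact hy (by simp [h, hs])

theorem tsum_iSup_of_monotone {f : ℕ → ℕ → ℝ≥0∞} (hf : Monotone f) :
    ∑' i, ⨆ n, f n i = ⨆ n, ∑' i, f n i := by
  simp_rw [← lintegral_count]
  exact lintegral_iSup (fun n => measurable_of_countable _) hf

-- The Laplace functional of a Poisson process, and independent marking.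

/-- A random sequence of points has the Laplace functional of a Poisson process with mean
measure `m`. -/
def HasPoissonLaplace {Ω E : Type*} [MeasurableSpace Ω] [MeasurableSpace E]
    (Y : ℕ → Ω → E) (m : Measure E) (P : Measure Ω) : Prop :=
  ∀ g : E → ℝ≥0∞, Measurable g →
    ∫⁻ ω, expNeg (∑' i, g (Y i ω)) ∂P = expNeg (∫⁻ y, (1 - expNeg (g y)) ∂m)

/-- The generating function `E v ^ N = exp (-(1 - v) r)` at `v = exp (-c)`. The case `c = ⊤` is
included: then `v = 0`, and `⊤ * 0 = 0` agrees with `0 ^ 0 = 1`. -/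
theorem lintegral_expNeg_poisson (c : ℝ≥0∞) (r : ℝ≥0) :
    ∫⁻ n : ℕ, expNeg (c * n) ∂(poissonMeasure r) = expNeg ((1 - expNeg c) * r) := by
  have hpow : ∀ n : ℕ, expNeg (c * n) = expNeg c ^ n := fun n => by
    rw [mul_comm, ← nsmul_eq_mul, ← Finset.card_range n, ← Finset.sum_const, expNeg_sum,
      Finset.prod_const, Finset.card_range]
  obtain ⟨v, hv0, hv1, hv⟩ : ∃ v : ℝ, 0 ≤ v ∧ v ≤ 1 ∧ expNeg c = ENNReal.ofReal v := by
    refine ⟨(expNeg c).toReal, ENNReal.toReal_nonneg, ?_,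
      (ENNReal.ofReal_toReal (expNeg_ne_top c)).symm⟩
    exact ENNReal.toReal_le_of_le_ofReal zero_le_one (by simpa using expNeg_le_one c)
  simp_rw [hpow, hv]
  rw [poissonMeasure, lintegral_sum_measure]
  simp_rw [lintegral_smul_measure, lintegral_dirac, smul_eq_mul]
  have hterm : ∀ n : ℕ, ENNReal.ofReal (Real.exp (-r) * r ^ n / n.factorial) *
      ENNReal.ofReal v ^ n =
      ENNReal.ofReal (Real.exp (-r) * ((r * v) ^ n / n.factorial)) := fun n => by
    rw [← ENNReal.ofReal_pow hv0, ← ENNReal.ofReal_mul (by positivity)]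
    congr 1
    rw [mul_pow]; ring
  simp_rw [hterm]
  have hs : HasSum (fun n : ℕ => Real.exp (-r) * ((r * v) ^ n / n.factorial))
      (Real.exp (-r) * Real.exp (r * v)) := by
    rw [Real.exp_eq_exp_ℝ]
    exact (NormedSpace.expSeries_div_hasSum_exp (r * v : ℝ)).mul_left _
  rw [← ENNReal.ofReal_tsum_of_nonneg (fun n => by positivity) hs.summable, hs.tsum_eq,
    ← Real.exp_add, ← ENNReal.ofReal_one, ← ENNReal.ofReal_sub _ hv0,
    ← ENNReal.ofReal_coe_nnreal, ← ENNReal.ofReal_mul (by linarith),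
    expNeg_ofReal (mul_nonneg (sub_nonneg.2 hv1) (NNReal.coe_nonneg r))]
  congr 2
  ring

section Laplace

variable {Ω E : Type*} [MeasurableSpace Ω] [MeasurableSpace E] {P : Measure Ω}
  {m : Measure E} {Y : ℕ → Ω → E}

theorem tendsto_lintegral_expNeg_tsum [IsProbabilityMeasure P] (hY : ∀ i, Measurable (Y i))
    {s : ℕ → E → ℝ≥0∞} {g : E → ℝ≥0∞} (hs : ∀ n, Measurable (s n)) (hmono : Monotone s)
    (hsup : ∀ y, ⨆ n, s n y = g y) :
    Tendsto (fun n => ∫⁻ ω, expNeg (∑' i, s n (Y i ω)) ∂P) atTop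
      (𝓝 (∫⁻ ω, expNeg (∑' i, g (Y i ω)) ∂P)) := by
  refine tendsto_lintegral_of_dominated_convergence (fun _ => 1) (fun n => ?_) (fun n => ?_)
    (by simp) ?_
  · exact measurable_expNeg.comp (Measurable.tsum fun i => (hs n).comp (hY i))
  · exact ae_of_all _ fun ω => expNeg_le_one _
  · refine ae_of_all _ fun ω => (continuous_expNeg.tendsto _).comp ?_
    simp_rw [← hsup]
    rw [tsum_iSup_of_monotone (f := fun n i => s n (Y i ω)) (fun n k h i => hmono h _)]
    exact tendsto_atTop_iSup fun n k h => ENNReal.tsum_le_tsum fun i => hmono h _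

/-- Since `m` may be infinite, monotone convergence takes the place of the domination by `1` that is
available under `P`. -/
theorem tendsto_lintegral_one_sub_expNeg {s : ℕ → E → ℝ≥0∞} {g : E → ℝ≥0∞}
    (hs : ∀ n, Measurable (s n)) (hmono : Monotone s) (hsup : ∀ y, ⨆ n, s n y = g y) :
    Tendsto (fun n => ∫⁻ y, (1 - expNeg (s n y)) ∂m) atTop
      (𝓝 (∫⁻ y, (1 - expNeg (g y)) ∂m)) := by
  refine lintegral_tendsto_of_tendsto_of_monotone
    (fun n => ((measurable_expNeg.comp (hs n)).const_sub 1).aemeasurable)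
    (ae_of_all _ fun y n k h => one_sub_expNeg_mono (hmono h y)) (ae_of_all _ fun y => ?_)
  refine (continuous_one_sub_expNeg.tendsto _).comp ?_
  rw [← hsup]
  exact tendsto_atTop_iSup fun n k h => hmono h y

/-- The sum over the points is a combination of the counts in the level sets of `s`, which are
independent Poisson variables, so the expectation is a product of generating functions. -/
theorem IsPoissonProcess.lintegral_simpleFunc (hY : IsPoissonProcess Y m P)
    (s : SimpleFunc E ℝ≥0∞) (hs : m {y | s y ≠ 0} < ⊤) :
    ∫⁻ ω, expNeg (∑' i, s (Y i ω)) ∂P = expNeg (∫⁻ y, (1 - expNeg (s y)) ∂m) := by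
  classical
  -- The value `0` is left out because its level set may have infinite measure.
  set R : Finset ℝ≥0∞ := s.range.filter (· ≠ 0) with hR
  set e := R.equivFin with he
  set c : Fin R.card → ℝ≥0∞ := fun k => (e.symm k : ℝ≥0∞) with hc
  set B : Fin R.card → Set E := fun k => s ⁻¹' {c k} with hB
  have hc0 : ∀ k, c k ≠ 0 := fun k => (Finset.mem_filter.1 (e.symm k).2).2
  have hcinj : Function.Injective c := Subtype.val_injective.comp e.symm.injective
  have hBm : ∀ k, MeasurableSet (B k) := fun k => s.measurableSet_preimage _
  have hBfin : ∀ k, m (B k) < ⊤ := fun k => (measure_mono (fun y hy => by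
    simp only [hB, Set.mem_preimage, Set.mem_singleton_iff] at hy
    simpa [hy] using hc0 k)).trans_lt hs
  -- Used twice: with the identity for the sum over the points, and with `1 - expNeg` for the
  -- exponent.
  have hdecomp : ∀ (φ : ℝ≥0∞ → ℝ≥0∞), φ 0 = 0 → ∀ y,
      φ (s y) = ∑ k, φ (c k) * (B k).indicator (fun _ => 1) y := by
    intro φ hφ y
    by_cases h0 : s y = 0
    · rw [h0, hφ, Finset.sum_eq_zero]
      intro k _
      rw [Set.indicator_of_notMem, mul_zero]
      simpa [hB, h0] using (hc0 k).symm
    · have hmem : s y ∈ R := Finset.mem_filter.2 ⟨s.mem_range_self y, h0⟩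
      have hk : c (e ⟨s y, hmem⟩) = s y := by simp [hc]
      rw [Finset.sum_eq_single (e ⟨s y, hmem⟩)]
      · rw [Set.indicator_of_mem (by simp only [hB, Set.mem_preimage, hk]; rfl), hk, mul_one]
      · intro k _ hne
        rw [Set.indicator_of_notMem, mul_zero]
        intro hy
        simp only [hB, Set.mem_preimage, Set.mem_singleton_iff] at hy
        exact hne (hcinj (hy.symm.trans hk.symm))
      · simp
  have hsum : ∀ ω, expNeg (∑' i, s (Y i ω)) = ∏ k, expNeg (c k * count Y (B k) ω) := by
    intro ω
    rw [← expNeg_sum]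
    congr 1
    simp_rw [count, ← ENNReal.tsum_mul_left]
    rw [← Summable.tsum_finsetSum fun _ _ => ENNReal.summable]
    exact tsum_congr fun i => hdecomp id rfl (Y i ω)
  have hcount : ∀ k, Measurable (count Y (B k)) := fun k => Measurable.tsum fun i =>
    (measurable_const.indicator (hBm k)).comp (hY.measurable i)
  have hind : iIndepFun (fun k => count Y (B k)) P := hY.indep _ B hBm fun k l hkl => by
    refine Set.disjoint_left.2 fun y hk hl => hkl (hcinj ?_)
    exact (show s y = c k from hk).symm.trans (show s y = c l from hl)
  have hone : ∀ k, ∫⁻ ω, expNeg (c k * count Y (B k) ω) ∂P =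
      expNeg ((1 - expNeg (c k)) * m (B k)) := by
    intro k
    have hm : Measurable fun x : ℝ≥0∞ => expNeg (c k * x) := by fun_prop
    have := (hY.law (B k) (hBm k) (hBfin k)).lintegral_comp (f := fun x => expNeg (c k * x))
      hm.aemeasurable
    rw [this, lintegral_map hm (by fun_prop), lintegral_expNeg_poisson,
      ENNReal.coe_toNNReal (hBfin k).ne]
  simp_rw [hsum]
  rw [lintegral_prod_eq_prod_lintegral_of_indepFun Finset.univ
    (fun k ω => expNeg (c k * count Y (B k) ω))
    (hind.comp (fun k x => expNeg (c k * x)) fun k => by fun_prop)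
    (fun k => by have := hcount k; fun_prop)]
  simp_rw [hone]
  rw [← expNeg_sum]
  congr 1
  simp_rw [hdecomp (fun x => 1 - expNeg x) (by simp [expNeg_zero])]
  rw [lintegral_finsetSum _ fun k _ => (measurable_const.indicator (hBm k)).const_mul _]
  refine Finset.sum_congr rfl fun k _ => ?_
  rw [lintegral_const_mul _ (measurable_const.indicator (hBm k)),
    lintegral_indicator_const (hBm k), one_mul]

theorem IsPoissonProcess.hasPoissonLaplace [IsProbabilityMeasure P] [SigmaFinite m]
    (hY : IsPoissonProcess Y m P) : HasPoissonLaplace Y m P := by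
  intro g hg
  obtain ⟨s, hmono, hsup, -, hfin⟩ := exists_simpleFunc_iSup m hg
  refine tendsto_nhds_unique (tendsto_lintegral_expNeg_tsum hY.measurable
    (fun n => (s n).measurable) hmono hsup) ?_
  simp_rw [fun n => hY.lintegral_simpleFunc (s n) (hfin n)]
  exact (continuous_expNeg.tendsto _).comp
    (tendsto_lintegral_one_sub_expNeg (fun n => (s n).measurable) hmono hsup)

/-- Attaching independent marks to a Poisson process gives a Poisson process. -/
theorem HasPoissonLaplace.marking [IsProbabilityMeasure P] {M : Type*} [MeasurableSpace M]
    {F : Measure M} [IsProbabilityMeasure F] [SFinite m] (hL : HasPoissonLaplace Y m P)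
    (hYm : ∀ i, Measurable (Y i)) {B : ℕ → Ω → M} (hBm : ∀ i, Measurable (B i))
    (hB : P.map (fun ω i => B i ω) = Measure.infinitePi fun _ => F)
    (hYB : IndepFun (fun ω i => Y i ω) (fun ω i => B i ω) P) :
    HasPoissonLaplace (fun i ω => (Y i ω, B i ω)) (m.prod F) P := by
  intro g hg
  have hYm' : Measurable fun ω i => Y i ω := measurable_pi_lambda _ hYm
  have hBm' : Measurable fun ω i => B i ω := measurable_pi_lambda _ hBm
  set gb : E → ℝ≥0∞ := fun y => ∫⁻ b, expNeg (g (y, b)) ∂F with hgb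
  have hgm : Measurable gb := Measurable.lintegral_prod_right' (f := fun z => expNeg (g z))
    (by fun_prop)
  have hg1 : ∀ y, gb y ≤ 1 := fun y => (lintegral_mono fun b => expNeg_le_one _).trans (by simp)
  -- Given the points the marks are i.i.d., so integrating out the first `n` of them replaces each
  -- factor by its mean `gb`. Writing `gb` as `expNeg (negLog gb)` brings it into the form to which
  -- the Laplace functional of the unmarked points applies.
  have hprod : ∀ n, ∫⁻ ω, ∏ i ∈ Finset.range n, expNeg (g (Y i ω, B i ω)) ∂P =
      ∫⁻ ω, ∏ i ∈ Finset.range n, expNeg (negLog (gb (Y i ω))) ∂P := by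
    intro n
    have hm1 : Measurable fun z : (ℕ → E) × (ℕ → M) =>
        ∏ i ∈ Finset.range n, expNeg (g (z.1 i, z.2 i)) :=
      Finset.measurable_prod _ fun i _ => by fun_prop
    have h1 := lintegral_map (μ := P) hm1 (hYm'.prodMk hBm')
    rw [(indepFun_iff_map_prod_eq_prod_map_map hYm'.aemeasurable hBm'.aemeasurable).1 hYB, hB,
      lintegral_prod _ hm1.aemeasurable] at h1
    rw [← h1]
    have hm2 : Measurable fun y : ℕ → E => ∏ i ∈ Finset.range n, expNeg (negLog (gb (y i))) :=
      Finset.measurable_prod _ fun i _ => by fun_prop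
    rw [← lintegral_map (f := fun y : ℕ → E => ∏ i ∈ Finset.range n, expNeg (negLog (gb (y i))))
      hm2 hYm']
    refine lintegral_congr fun y => ?_
    have hmg : ∀ i, Measurable fun b : M => expNeg (g (y i, b)) := fun i => by fun_prop
    rw [lintegral_prod_eq_prod_lintegral_of_indepFun (Finset.range n)
      (fun i (b : ℕ → M) => expNeg (g (y i, b i)))
      (iIndepFun_infinitePi (P := fun _ : ℕ => F) (X := fun i b => expNeg (g (y i, b))) hmg)
      (fun i => (hmg i).comp (measurable_pi_apply i))]
    refine Finset.prod_congr rfl fun i _ => ?_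
    rw [expNeg_negLog (hg1 _), hgb]
    have := lintegral_map (μ := Measure.infinitePi fun _ : ℕ => F) (hmg i) (measurable_pi_apply i)
    rw [← this, Measure.infinitePi_map_eval]
  have hlim : ∀ f : ℕ → Ω → ℝ≥0∞, (∀ i, Measurable (f i)) →
      Tendsto (fun n => ∫⁻ ω, ∏ i ∈ Finset.range n, expNeg (f i ω) ∂P) atTop
        (𝓝 (∫⁻ ω, expNeg (∑' i, f i ω) ∂P)) := by
    intro f hf
    refine tendsto_lintegral_of_dominated_convergence (fun _ => 1) (fun n => ?_) (fun n => ?_)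
      (by simp) (ae_of_all _ fun ω => expNeg_tsum)
    · exact Finset.measurable_prod _ fun i _ => (hf i).expNeg
    · exact ae_of_all _ fun ω => Finset.prod_le_one' fun i _ => expNeg_le_one _
  have h2 := hlim (fun i ω => g (Y i ω, B i ω)) fun i => hg.comp ((hYm i).prodMk (hBm i))
  simp_rw [hprod] at h2
  rw [tendsto_nhds_unique h2 (hlim (fun i ω => negLog (gb (Y i ω))) fun i => by
    have := hYm i; fun_prop), hL (fun y => negLog (gb y)) (by fun_prop)]
  congr 1
  rw [lintegral_prod _ (by fun_prop)]
  refine lintegral_congr fun y => ?_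
  rw [expNeg_negLog (hg1 _), hgb, lintegral_sub (by fun_prop) _
    (ae_of_all _ fun b => expNeg_le_one _)]
  · simp
  · exact ((hg1 y).trans_lt ENNReal.one_lt_top).ne

end Laplace

-- Campbell and Mecke formulas from the Laplace functional.

section Mecke

variable {Ω E : Type*} [MeasurableSpace Ω] [MeasurableSpace E] {P : Measure Ω}
  {m : Measure E} {Y : ℕ → Ω → E}

/-- The derivative of the Laplace functional at `g` in the direction `u`: the values at `g` and at
`g + u / 2 ^ n` are subtracted, multiplied by `2 ^ n`, and `n` tends to infinity monotonically. -/
theorem HasPoissonLaplace.lintegral_tsum_mul [IsProbabilityMeasure P]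
    (hL : HasPoissonLaplace Y m P) (hY : ∀ i, Measurable (Y i)) {u g : E → ℝ≥0∞}
    (hu : Measurable u) (hg : Measurable g) :
    ∫⁻ ω, expNeg (∑' i, g (Y i ω)) * ∑' i, u (Y i ω) ∂P =
      expNeg (∫⁻ y, (1 - expNeg (g y)) ∂m) * ∫⁻ y, expNeg (g y) * u y ∂m := by
  have hgY : Measurable fun ω => ∑' i, g (Y i ω) := Measurable.tsum fun i => hg.comp (hY i)
  have huY : Measurable fun ω => ∑' i, u (Y i ω) := Measurable.tsum fun i => hu.comp (hY i)
  have hstep : ∀ n : ℕ, ∫⁻ ω, expNeg (∑' i, g (Y i ω)) * expQuot n (∑' i, u (Y i ω)) ∂P =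
      expNeg (∫⁻ y, (1 - expNeg (g y)) ∂m) *
        expQuot n (∫⁻ y, expNeg (g y) * expQuot n (u y) ∂m) := by
    intro n
    have h2 : (2 : ℝ≥0∞) ^ n ≠ 0 := by simp
    have h2' : (2 : ℝ≥0∞) ^ n ≠ ⊤ := by simp
    have hsum : ∀ ω, ∑' i, (g (Y i ω) + u (Y i ω) / 2 ^ n) =
        ∑' i, g (Y i ω) + (∑' i, u (Y i ω)) / 2 ^ n := fun ω => by
      simp_rw [div_eq_mul_inv, ENNReal.tsum_add, ENNReal.tsum_mul_right]
    have hd : ∫⁻ y, (1 - expNeg (g y + u y / 2 ^ n)) ∂m = ∫⁻ y, (1 - expNeg (g y)) ∂m +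
        (∫⁻ y, expNeg (g y) * expQuot n (u y) ∂m) / 2 ^ n := by
      simp_rw [one_sub_expNeg_add]
      rw [lintegral_add_left (by fun_prop), div_eq_mul_inv, ← lintegral_mul_const _ (by fun_prop)]
      congr 1
      refine lintegral_congr fun y => ?_
      rw [expQuot, mul_left_comm, mul_comm (2 ^ n), mul_assoc, ENNReal.mul_inv_cancel h2 h2',
        mul_one]
    have hmul : ∀ ω, expNeg (∑' i, g (Y i ω)) * expQuot n (∑' i, u (Y i ω)) =
        2 ^ n * (expNeg (∑' i, g (Y i ω)) - expNeg (∑' i, (g (Y i ω) + u (Y i ω) / 2 ^ n))) := by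
      intro ω
      rw [hsum, expNeg_add, expQuot, mul_left_comm, ENNReal.mul_sub (fun _ _ => expNeg_ne_top _),
        mul_one]
    simp_rw [hmul]
    have hmsum : Measurable fun ω => ∑' i, (g (Y i ω) + u (Y i ω) / 2 ^ n) :=
      Measurable.tsum fun i => (hg.add (hu.div_const _)).comp (hY i)
    rw [lintegral_const_mul _ (by fun_prop), lintegral_sub hmsum.expNeg,
      hL g hg, hL (fun y => g y + u y / 2 ^ n) (by fun_prop), hd, expNeg_add, expQuot,
      mul_left_comm, ENNReal.mul_sub (fun _ _ => expNeg_ne_top _), mul_one]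
    · rw [hL (fun y => g y + u y / 2 ^ n) (by fun_prop)]; exact expNeg_ne_top _
    · refine ae_of_all _ fun ω => antitone_expNeg ?_
      exact ENNReal.tsum_le_tsum fun i => le_self_add
  have hl : ∫⁻ ω, expNeg (∑' i, g (Y i ω)) * ∑' i, u (Y i ω) ∂P =
      ⨆ n, ∫⁻ ω, expNeg (∑' i, g (Y i ω)) * expQuot n (∑' i, u (Y i ω)) ∂P := by
    rw [← lintegral_iSup (f := fun n ω => expNeg (∑' i, g (Y i ω)) * expQuot n (∑' i, u (Y i ω)))
      (fun n => by fun_prop) (fun n k h ω => mul_le_mul_right (expQuot_le_expQuot h _) _)]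
    simp_rw [← ENNReal.mul_iSup, expQuot_iSup]
  have hr : ∫⁻ y, expNeg (g y) * u y ∂m = ⨆ n, ∫⁻ y, expNeg (g y) * expQuot n (u y) ∂m := by
    rw [← lintegral_iSup (f := fun n y => expNeg (g y) * expQuot n (u y))
      (fun n => by fun_prop) (fun n k h ω => mul_le_mul_right (expQuot_le_expQuot h _) _)]
    simp_rw [← ENNReal.mul_iSup, expQuot_iSup]
  rw [hl, hr]
  simp_rw [hstep]
  -- The right-hand side carries a quotient both inside and outside the integral, with the same `n`.
  rw [← ENNReal.mul_iSup, iSup_expQuot_of_monotone]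
  exact fun n k h => lintegral_mono fun y => mul_le_mul_right (expQuot_le_expQuot h _) _

/-- Campbell's formula. -/
theorem HasPoissonLaplace.lintegral_tsum [IsProbabilityMeasure P]
    (hL : HasPoissonLaplace Y m P) (hY : ∀ i, Measurable (Y i)) {u : E → ℝ≥0∞}
    (hu : Measurable u) : ∫⁻ ω, ∑' i, u (Y i ω) ∂P = ∫⁻ y, u y ∂m := by
  simpa [expNeg_zero] using hL.lintegral_tsum_mul hY hu (measurable_const (a := 0))

/-- The reduced Mecke formula for exponential functionals. -/
theorem HasPoissonLaplace.lintegral_tsum_mul_expNeg [IsProbabilityMeasure P]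
    (hL : HasPoissonLaplace Y m P) (hY : ∀ i, Measurable (Y i)) {u g : E → ℝ≥0∞}
    (hu : Measurable u) (hg : Measurable g) (hgt : ∀ y, g y ≠ ⊤) :
    ∫⁻ ω, ∑' i, u (Y i ω) * expNeg (∑' j, if j = i then 0 else g (Y j ω)) ∂P =
      (∫⁻ y, u y ∂m) * expNeg (∫⁻ y, (1 - expNeg (g y)) ∂m) := by
  -- The extra factor `exp (g (Y i))` removes the term `j = i` from the exponent. It can be inverted
  -- because `g` is finite.
  have h := hL.lintegral_tsum_mul hY (u := fun y => u y * (expNeg (g y))⁻¹) (by fun_prop) hg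
  have hc : ∀ y, expNeg (g y) * (u y * (expNeg (g y))⁻¹) = u y := fun y => by
    rw [mul_left_comm, ENNReal.mul_inv_cancel (expNeg_ne_zero (hgt y)) (expNeg_ne_top _), mul_one]
  simp_rw [hc] at h
  rw [mul_comm (∫⁻ y, u y ∂m), ← h]
  refine lintegral_congr fun ω => ?_
  rw [← ENNReal.tsum_mul_left]
  refine tsum_congr fun i => ?_
  rw [ENNReal.tsum_eq_add_tsum_ite (f := fun j => g (Y j ω)) i, expNeg_add, mul_right_comm,
    hc]
  congr!

theorem measurable_tsum_ite (hY : ∀ i, Measurable (Y i)) {f : E → E → ℝ≥0∞}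
    (hf : Measurable (Function.uncurry f)) (i : ℕ) :
    Measurable fun ω => ∑' j, if j = i then 0 else f (Y i ω) (Y j ω) := by
  refine Measurable.tsum fun j => ?_
  split_ifs
  · exact measurable_const
  · exact hf.comp ((hY i).prodMk (hY j))

/-- Campbell's formula minus the reduced Mecke formula. The subtraction is legitimate only when `∫
u` is finite, so it is done for simple functions of finite integral increasing to `u`. -/
theorem HasPoissonLaplace.lintegral_tsum_one_sub_expNeg_const [IsProbabilityMeasure P]
    [SigmaFinite m] (hL : HasPoissonLaplace Y m P) (hY : ∀ i, Measurable (Y i))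
    {u g : E → ℝ≥0∞} (hu : Measurable u) (hg : Measurable g) (hgt : ∀ y, g y ≠ ⊤) :
    ∫⁻ ω, ∑' i, u (Y i ω) * (1 - expNeg (∑' j, if j = i then 0 else g (Y j ω))) ∂P =
      (∫⁻ y, u y ∂m) * (1 - expNeg (∫⁻ y, (1 - expNeg (g y)) ∂m)) := by
  have hgm : ∀ i, Measurable fun ω => ∑' j, if j = i then 0 else g (Y j ω) := fun i =>
    measurable_tsum_ite hY (f := fun _ => g) (hg.comp measurable_snd) i
  obtain ⟨s, hmono, hsup, htop, hfin⟩ := exists_simpleFunc_iSup m hu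
  have hs : ∀ n, ∫⁻ ω, ∑' i, s n (Y i ω) *
      (1 - expNeg (∑' j, if j = i then 0 else g (Y j ω))) ∂P =
      (∫⁻ y, s n y ∂m) * (1 - expNeg (∫⁻ y, (1 - expNeg (g y)) ∂m)) := by
    intro n
    have hsY : ∀ i, Measurable fun ω => s n (Y i ω) := fun i => (s n).measurable.comp (hY i)
    have hI : ∫⁻ y, s n y ∂m ≠ ⊤ := by
      rw [SimpleFunc.lintegral_eq_lintegral]
      exact (SimpleFunc.FinMeasSupp.lintegral_lt_top
        (SimpleFunc.finMeasSupp_iff_support.2 (hfin n)) (ae_of_all _ (htop n))).ne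
    have h1 := hL.lintegral_tsum hY (s n).measurable
    have h2 := hL.lintegral_tsum_mul_expNeg hY (s n).measurable hg hgt
    have h3 : ∫⁻ ω, ∑' i, s n (Y i ω) ∂P =
        ∫⁻ ω, ∑' i, s n (Y i ω) * (1 - expNeg (∑' j, if j = i then 0 else g (Y j ω))) ∂P +
        ∫⁻ ω, ∑' i, s n (Y i ω) * expNeg (∑' j, if j = i then 0 else g (Y j ω)) ∂P := by
      rw [← lintegral_add_right _ (Measurable.tsum fun i => by
        have := hsY i; have := hgm i; fun_prop)]
      refine lintegral_congr fun ω => ?_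
      rw [← ENNReal.tsum_add]
      refine tsum_congr fun i => ?_
      rw [← mul_add, tsub_add_cancel_of_le (expNeg_le_one _), mul_one]
    rw [h1, h2] at h3
    rw [ENNReal.mul_sub (fun _ _ => hI), mul_one]
    refine (ENNReal.sub_eq_of_eq_add ?_ h3).symm
    exact ENNReal.mul_ne_top hI (expNeg_ne_top _)
  have hl : ∫⁻ ω, ∑' i, u (Y i ω) * (1 - expNeg (∑' j, if j = i then 0 else g (Y j ω))) ∂P =
      ⨆ n, ∫⁻ ω, ∑' i, s n (Y i ω) *
        (1 - expNeg (∑' j, if j = i then 0 else g (Y j ω))) ∂P := by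
    rw [← lintegral_iSup]
    · refine lintegral_congr fun ω => ?_
      rw [← tsum_iSup_of_monotone (f := fun n i => s n (Y i ω) *
        (1 - expNeg (∑' j, if j = i then 0 else g (Y j ω))))
        fun n k h i => mul_le_mul_left (hmono h _) _]
      simp_rw [← ENNReal.iSup_mul, hsup]
    · exact fun n => Measurable.tsum fun i => by
        have : Measurable fun ω => s n (Y i ω) := (s n).measurable.comp (hY i)
        have := hgm i; fun_prop
    · exact fun n k h ω => ENNReal.tsum_le_tsum fun i => mul_le_mul_left (hmono h _) _
  have hr : ∫⁻ y, u y ∂m = ⨆ n, ∫⁻ y, s n y ∂m := by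
    rw [← lintegral_iSup (fun n => (s n).measurable) hmono]
    simp_rw [hsup]
  rw [hl, hr, ENNReal.iSup_mul]
  simp_rw [hs]

/-- On each fibre of `q` the kernel is a fixed function of its second variable, so the formula for a
fixed `g` applies with `u` cut off to the fibre; then the finitely many fibres are summed. -/
theorem HasPoissonLaplace.lintegral_tsum_one_sub_expNeg_simple [IsProbabilityMeasure P]
    [SigmaFinite m] (hL : HasPoissonLaplace Y m P) (hY : ∀ i, Measurable (Y i))
    {u : E → ℝ≥0∞} {f : E → E → ℝ≥0∞} (hu : Measurable u) (hf : Measurable (Function.uncurry f))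
    (hft : ∀ y z, f y z ≠ ⊤) {Z : Type*} (q : SimpleFunc E Z)
    (hq : ∀ y z, q y = q z → f y = f z) :
    ∫⁻ ω, ∑' i, u (Y i ω) * (1 - expNeg (∑' j, if j = i then 0 else f (Y i ω) (Y j ω))) ∂P =
      ∫⁻ y, u y * (1 - expNeg (∫⁻ z, (1 - expNeg (f y z)) ∂m)) ∂m := by
  classical
  have hrep : ∀ z : q.range, ∃ y, q y = z := fun z => SimpleFunc.mem_range.1 z.2
  choose r hr using hrep
  have hqm : ∀ z : Z, MeasurableSet (q ⁻¹' {z}) := fun z => q.measurableSet_fiber z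
  -- Stated for a general functional `φ` of the frozen kernel because it is applied to the sum over
  -- the points and to the integral against `m`.
  have hdecomp : ∀ (φ : E → (E → ℝ≥0∞) → ℝ≥0∞) (y : E),
      φ y (f y) = ∑ z : q.range, (q ⁻¹' {z.1}).indicator (fun _ => 1) y * φ y (f (r z)) := by
    intro φ y
    rw [Finset.sum_eq_single ⟨q y, q.mem_range_self y⟩]
    · rw [Set.indicator_of_mem (show y ∈ q ⁻¹' {q y} from rfl), one_mul,
        hq y (r ⟨q y, q.mem_range_self y⟩) (hr ⟨q y, q.mem_range_self y⟩).symm]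
    · intro z _ hz
      rw [Set.indicator_of_notMem, zero_mul]
      exact fun h => hz (Subtype.ext (show q y = z.1 from h).symm)
    · simp
  have hconst := fun z : q.range => hL.lintegral_tsum_one_sub_expNeg_const hY
    (u := fun y => (q ⁻¹' {z.1}).indicator (fun _ => 1) y * u y) (g := f (r z))
    ((measurable_const.indicator (hqm _)).mul hu) (hf.comp measurable_prodMk_left) (hft _)
  have hl : ∀ ω, ∑' i, u (Y i ω) *
      (1 - expNeg (∑' j, if j = i then 0 else f (Y i ω) (Y j ω))) =
      ∑ z : q.range, ∑' i, ((q ⁻¹' {z.1}).indicator (fun _ => 1) (Y i ω) * u (Y i ω)) *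
        (1 - expNeg (∑' j, if j = i then 0 else f (r z) (Y j ω))) := by
    intro ω
    rw [← Summable.tsum_finsetSum fun _ _ => ENNReal.summable]
    refine tsum_congr fun i => ?_
    rw [hdecomp (fun y h => u y * (1 - expNeg (∑' j, if j = i then 0 else h (Y j ω)))) (Y i ω)]
    simp_rw [mul_assoc]
  have hr' : ∀ y, u y * (1 - expNeg (∫⁻ z, (1 - expNeg (f y z)) ∂m)) =
      ∑ z : q.range, ((q ⁻¹' {z.1}).indicator (fun _ => 1) y * u y) *
        (1 - expNeg (∫⁻ z', (1 - expNeg (f (r z) z')) ∂m)) := by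
    intro y
    rw [hdecomp (fun y h => u y * (1 - expNeg (∫⁻ z', (1 - expNeg (h z')) ∂m))) y]
    simp_rw [mul_assoc]
  simp_rw [hl, hr']
  have hum : ∀ z : Z, Measurable fun y => (q ⁻¹' {z}).indicator (fun _ => (1 : ℝ≥0∞)) y * u y :=
    fun z => (measurable_const.indicator (hqm z)).mul hu
  rw [lintegral_finsetSum _ fun z _ => Measurable.tsum fun i => ?_, lintegral_finsetSum _ fun z _ =>
    (hum _).mul_const _]
  · refine Finset.sum_congr rfl fun z _ => ?_
    rw [hconst z, lintegral_mul_const _ (hum _)]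
  · have := measurable_tsum_ite hY (f := fun _ => f (r z))
      ((hf.comp measurable_prodMk_left).comp measurable_snd) i
    have h1 : Measurable fun ω => (q ⁻¹' {z.1}).indicator (fun _ => (1 : ℝ≥0∞)) (Y i ω) :=
      (measurable_const.indicator (hqm _)).comp (hY i)
    have h2 : Measurable fun ω => u (Y i ω) := hu.comp (hY i)
    fun_prop

/-- `f` is an increasing limit of functions with finite values that depend on their first variable
only through a simple function. -/
structure IsSimpleLimit (f : E → E → ℝ≥0∞) (fn : ℕ → E → E → ℝ≥0∞) : Prop where
  measurable : ∀ n, Measurable (Function.uncurry (fn n))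
  ne_top : ∀ n y z, fn n y z ≠ ⊤
  mono : Monotone fn
  iSup_eq : ∀ y z, ⨆ n, fn n y z = f y z
  simple : ∀ n, ∃ (Z : Type) (q : SimpleFunc E Z), ∀ y z, q y = q z → fn n y = fn n z

theorem IsSimpleLimit.measurable_uncurry {f : E → E → ℝ≥0∞} {fn : ℕ → E → E → ℝ≥0∞}
    (h : IsSimpleLimit f fn) : Measurable (Function.uncurry f) := by
  have : Function.uncurry f = fun z => ⨆ n, Function.uncurry (fn n) z := by
    ext ⟨y, z⟩
    exact (h.iSup_eq y z).symm
  rw [this]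
  exact Measurable.iSup h.measurable

theorem one_sub_expNeg_iSup {e : ℕ → ℝ≥0∞} :
    1 - expNeg (⨆ n, e n) = ⨆ n, (1 - expNeg (e n)) :=
  one_sub_expNeg_mono.map_iSup_of_continuousAt continuous_one_sub_expNeg.continuousAt
    (by simp [expNeg_zero])

/-- The Mecke formula for the probability that a point has a partner. -/
theorem HasPoissonLaplace.lintegral_tsum_one_sub_expNeg [IsProbabilityMeasure P]
    [SigmaFinite m] (hL : HasPoissonLaplace Y m P) (hY : ∀ i, Measurable (Y i))
    {u : E → ℝ≥0∞} {f : E → E → ℝ≥0∞} {fn : ℕ → E → E → ℝ≥0∞} (hu : Measurable u)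
    (hf : IsSimpleLimit f fn) :
    ∫⁻ ω, ∑' i, u (Y i ω) * (1 - expNeg (∑' j, if j = i then 0 else f (Y i ω) (Y j ω))) ∂P =
      ∫⁻ y, u y * (1 - expNeg (∫⁻ z, (1 - expNeg (f y z)) ∂m)) ∂m := by
  have huY : ∀ i, Measurable fun ω => u (Y i ω) := fun i => hu.comp (hY i)
  have hite : ∀ n k i ω, n ≤ k → (∑' j, if j = i then 0 else fn n (Y i ω) (Y j ω)) ≤
      ∑' j, if j = i then 0 else fn k (Y i ω) (Y j ω) := by
    intro n k i ω h
    refine ENNReal.tsum_le_tsum fun j => ?_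
    split_ifs
    · rfl
    · exact hf.mono h _ _
  have hl : ∀ ω, ∑' i, u (Y i ω) *
      (1 - expNeg (∑' j, if j = i then 0 else f (Y i ω) (Y j ω))) =
      ⨆ n, ∑' i, u (Y i ω) *
        (1 - expNeg (∑' j, if j = i then 0 else fn n (Y i ω) (Y j ω))) := by
    intro ω
    rw [← tsum_iSup_of_monotone (f := fun n i => u (Y i ω) *
      (1 - expNeg (∑' j, if j = i then 0 else fn n (Y i ω) (Y j ω)))) fun n k h i =>
      mul_le_mul_right (one_sub_expNeg_le_one_sub (hite n k i ω h)) _]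
    refine tsum_congr fun i => ?_
    rw [← ENNReal.mul_iSup, ← one_sub_expNeg_iSup, ← tsum_iSup_of_monotone]
    · congr 4
      ext j
      split_ifs
      · simp
      · exact (hf.iSup_eq _ _).symm
    · intro n k h j
      dsimp only
      split_ifs
      · rfl
      · exact hf.mono h _ _
  have hint : ∀ n, Measurable fun y => ∫⁻ z, (1 - expNeg (fn n y z)) ∂m := fun n =>
    Measurable.lintegral_prod_right' (f := fun z => 1 - expNeg (Function.uncurry (fn n) z))
      (by have := hf.measurable n; fun_prop)
  have hr : ∀ y, u y * (1 - expNeg (∫⁻ z, (1 - expNeg (f y z)) ∂m)) =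
      ⨆ n, u y * (1 - expNeg (∫⁻ z, (1 - expNeg (fn n y z)) ∂m)) := by
    intro y
    rw [← ENNReal.mul_iSup, ← one_sub_expNeg_iSup, ← lintegral_iSup]
    · simp_rw [← one_sub_expNeg_iSup, hf.iSup_eq]
    · intro n
      exact ((measurable_expNeg.comp ((hf.measurable n).comp measurable_prodMk_left)).const_sub 1)
    · exact fun n k h z => one_sub_expNeg_le_one_sub (hf.mono h _ _)
  simp_rw [hl, hr]
  rw [lintegral_iSup, lintegral_iSup]
  · refine iSup_congr fun n => ?_
    obtain ⟨Z, q, hq⟩ := hf.simple n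
    exact hL.lintegral_tsum_one_sub_expNeg_simple hY hu (hf.measurable n) (hf.ne_top n) q hq
  · intro n
    have := hint n
    fun_prop
  · exact fun n k h y => mul_le_mul_right (one_sub_expNeg_le_one_sub (lintegral_mono fun z =>
      one_sub_expNeg_le_one_sub (hf.mono h _ _))) _
  · intro n
    refine Measurable.tsum fun i => ?_
    have := measurable_tsum_ite hY (hf.measurable n) i
    have := huY i
    fun_prop
  · exact fun n k h ω => ENNReal.tsum_le_tsum fun i =>
      mul_le_mul_right (one_sub_expNeg_le_one_sub (hite n k i ω h)) _

theorem IsSimpleLimit.div {f : E → E → ℝ≥0∞} {fn : ℕ → E → E → ℝ≥0∞}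
    (h : IsSimpleLimit f fn) (c : ℝ≥0∞) (hc : c ≠ 0) :
    IsSimpleLimit (fun y z => f y z / c) (fun n y z => fn n y z / c) where
  measurable n := (h.measurable n).div_const c
  ne_top n y z := ENNReal.div_ne_top (h.ne_top n y z) hc
  mono n k hnk y z := ENNReal.div_le_div_right (h.mono hnk y z) _
  iSup_eq y z := by simp_rw [← h.iSup_eq, div_eq_mul_inv, ENNReal.iSup_mul]
  simple n := by
    obtain ⟨Z, q, hq⟩ := h.simple n
    exact ⟨Z, q, fun y z hyz => by rw [hq y z hyz]⟩

/-- The formula for the second factorial moment. -/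
theorem HasPoissonLaplace.lintegral_tsum_tsum [IsProbabilityMeasure P]
    [SigmaFinite m] (hL : HasPoissonLaplace Y m P) (hY : ∀ i, Measurable (Y i))
    {u : E → ℝ≥0∞} {f : E → E → ℝ≥0∞} {fn : ℕ → E → E → ℝ≥0∞} (hu : Measurable u)
    (hf : IsSimpleLimit f fn) :
    ∫⁻ ω, ∑' i, u (Y i ω) * (∑' j, if j = i then 0 else f (Y i ω) (Y j ω)) ∂P =
      ∫⁻ y, u y * ∫⁻ z, f y z ∂m ∂m := by
  have hfm := hf.measurable_uncurry
  have huY : ∀ i, Measurable fun ω => u (Y i ω) := fun i => hu.comp (hY i)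
  have hfY := measurable_tsum_ite hY hfm
  have hstep : ∀ n : ℕ, ∫⁻ ω, ∑' i, u (Y i ω) *
      expQuot n (∑' j, if j = i then 0 else f (Y i ω) (Y j ω)) ∂P =
      ∫⁻ y, u y * expQuot n (∫⁻ z, expQuot n (f y z) ∂m) ∂m := by
    intro n
    have h2 : (2 : ℝ≥0∞) ^ n ≠ 0 := by simp
    have h2' : (2 : ℝ≥0∞) ^ n ≠ ⊤ := by simp
    -- The partner formula at the kernel `f / 2 ^ n`, multiplied by `2 ^ n`, is a difference
    -- quotient whose limit is the second factorial moment.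
    have h := hL.lintegral_tsum_one_sub_expNeg hY (u := fun y => 2 ^ n * u y) (by fun_prop)
      (hf.div (2 ^ n) h2)
    convert! h using 1
    · refine lintegral_congr fun ω => tsum_congr fun i => ?_
      have : (∑' j, if j = i then 0 else f (Y i ω) (Y j ω) / 2 ^ n) =
          (∑' j, if j = i then 0 else f (Y i ω) (Y j ω)) / 2 ^ n := by
        rw [div_eq_mul_inv, ← ENNReal.tsum_mul_right]
        refine tsum_congr fun j => ?_
        split_ifs <;> simp [div_eq_mul_inv]
      rw [this, expQuot, mul_left_comm, mul_assoc]
    · refine lintegral_congr fun y => ?_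
      have hmy : Measurable fun z => 1 - expNeg (f y z / 2 ^ n) := by
        have : Measurable (f y) := hfm.comp measurable_prodMk_left
        fun_prop
      simp_rw [expQuot]
      rw [lintegral_const_mul _ hmy, mul_comm (2 ^ n) (∫⁻ z, _ ∂m),
        ENNReal.mul_div_cancel_right h2 h2', mul_left_comm, mul_assoc]
  have hl : ∫⁻ ω, ∑' i, u (Y i ω) * (∑' j, if j = i then 0 else f (Y i ω) (Y j ω)) ∂P =
      ⨆ n, ∫⁻ ω, ∑' i, u (Y i ω) *
        expQuot n (∑' j, if j = i then 0 else f (Y i ω) (Y j ω)) ∂P := by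
    rw [← lintegral_iSup]
    · refine lintegral_congr fun ω => ?_
      rw [← tsum_iSup_of_monotone (f := fun n i => u (Y i ω) *
        expQuot n (∑' j, if j = i then 0 else f (Y i ω) (Y j ω)))
        fun n k h i => mul_le_mul_right (expQuot_le_expQuot h _) _]
      simp_rw [← ENNReal.mul_iSup, expQuot_iSup]
    · exact fun n => Measurable.tsum fun i => by
        have := hfY i; have := huY i; fun_prop
    · exact fun n k h ω => ENNReal.tsum_le_tsum fun i =>
        mul_le_mul_right (expQuot_le_expQuot h _) _
  have hm1 : ∀ n, Measurable fun y => ∫⁻ z, expQuot n (f y z) ∂m := fun n =>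
    Measurable.lintegral_prod_right' (f := fun z => expQuot n (Function.uncurry f z))
      (by fun_prop)
  have hmono : ∀ y, Monotone fun n => ∫⁻ z, expQuot n (f y z) ∂m := fun y n k h =>
    lintegral_mono fun z => expQuot_le_expQuot h _
  rw [hl]
  simp_rw [hstep]
  rw [← lintegral_iSup (f := fun n y => u y * expQuot n (∫⁻ z, expQuot n (f y z) ∂m))
    (fun n => by have := hm1 n; fun_prop)
    (fun n k h y => mul_le_mul_right
      ((expQuot_le_expQuot h _).trans (expQuot_monotone_right _ (hmono y h))) _)]
  refine lintegral_congr fun y => ?_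
  rw [← ENNReal.mul_iSup, iSup_expQuot_of_monotone (hmono y), ← lintegral_iSup]
  · simp_rw [expQuot_iSup]
  · intro n
    have : Measurable (f y) := hfm.comp measurable_prodMk_left
    fun_prop
  · exact fun n k h z => expQuot_le_expQuot h _

/-- Functions of the inner product of two weight vectors are limits of simple kernels. -/
theorem exists_isSimpleLimit {p : ℕ} {W : E → Fin p → ℝ≥0∞} (hW : ∀ k, Measurable fun y => W y k)
    (hWt : ∀ y k, W y k ≠ ⊤) {v : E → ℝ≥0∞} (hv : Measurable v) (hvt : ∀ y, v y ≠ ⊤)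
    {φ : ℝ≥0∞ → ℝ≥0∞} (hφ : Monotone φ) (hφc : Continuous φ) (hφt : ∀ x, x ≠ ⊤ → φ x ≠ ⊤) :
    ∃ fn, IsSimpleLimit (fun y z => v z * φ (∑ k, W y k * W z k)) fn := by
  -- Only the weights of the first variable are discretized; the kernel then depends on that
  -- variable through a vector with finitely many values, and stays exact in the second.
  set w : ℕ → Fin p → SimpleFunc E ℝ≥0∞ := fun n k => SimpleFunc.eapprox (fun y => W y k) n
    with hw
  have hmono : ∀ y z, Monotone fun n => ∑ k, w n k y * W z k := fun y z n k h =>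
    Finset.sum_le_sum fun i _ => mul_le_mul_left (SimpleFunc.monotone_eapprox _ h y) _
  refine ⟨fun n y z => v z * φ (∑ k, w n k y * W z k), ?_, ?_, ?_, ?_, ?_⟩
  · intro n
    have h1 : Measurable fun x : E × E => ∑ k, w n k x.1 * W x.2 k :=
      Finset.measurable_sum _ fun k _ => ((w n k).measurable.comp measurable_fst).mul
        ((hW k).comp measurable_snd)
    exact (hv.comp measurable_snd).mul (hφc.measurable.comp h1)
  · intro n y z
    refine ENNReal.mul_ne_top (hvt z) (hφt _ (ENNReal.sum_ne_top.2 fun k _ => ?_))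
    exact ENNReal.mul_ne_top (SimpleFunc.eapprox_lt_top _ _ _).ne (hWt _ _)
  · exact fun n k h y z => mul_le_mul_right (hφ (hmono y z h)) _
  · intro y z
    rw [← ENNReal.mul_iSup]
    congr 1
    have hs : ∑ k, W y k * W z k = ⨆ n, ∑ k, w n k y * W z k := by
      rw [← ENNReal.finsetSum_iSup_of_monotone (f := fun k n => w n k y * W z k) fun k n n' h =>
        mul_le_mul_left (SimpleFunc.monotone_eapprox _ h y) _]
      simp_rw [← ENNReal.iSup_mul]
      refine Finset.sum_congr rfl fun k _ => ?_
      rw [SimpleFunc.iSup_eapprox_apply (hW k)]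
    rw [hs]
    exact tendsto_nhds_unique (tendsto_atTop_iSup fun n n' h => hφ (hmono y z h))
      ((hφc.tendsto _).comp (tendsto_atTop_iSup (hmono y z)))
  · intro n
    refine ⟨Fin p → ℝ≥0∞, ⟨fun y k => w n k y, fun x => ?_, ?_⟩, fun y z h => ?_⟩
    · have : (fun y k => w n k y) ⁻¹' {x} = ⋂ k, w n k ⁻¹' {x k} := by
        ext y; simp [funext_iff]
      rw [this]
      exact MeasurableSet.iInter fun k => (w n k).measurableSet_fiber _
    · refine (Set.Finite.pi fun k => (w n k).finite_range).subset ?_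
      rintro _ ⟨y, rfl⟩ k _
      exact ⟨y, rfl⟩
    · have h' : ∀ k, w n k y = w n k z := fun k => congrFun h k
      simp_rw [h']

end Mecke

-- Predictable processes.

section Predictable

variable {Ω : Type*} {mΩ : MeasurableSpace Ω} (F : Filtration ℝ≥0 mΩ)

theorem measurable_fst_predictable : Measurable[F.predictable] (Prod.fst : ℝ≥0 × Ω → ℝ≥0) := by
  let _ : MeasurableSpace (ℝ≥0 × Ω) := F.predictable
  refine measurable_of_Ioi fun t => ?_
  have : (Prod.fst : ℝ≥0 × Ω → ℝ≥0) ⁻¹' Set.Ioi t = Set.Ioi t ×ˢ Set.univ := by ext; simp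
  rw [this]
  exact measurableSet_predictable_Ioi_prod MeasurableSet.univ

/-- A variable known at time 0 is a predictable process constant in time. Its level sets split into
the part at time 0 and the part on `(0, ∞)`, and both pieces are generators. -/
theorem measurable_snd_predictable {β : Type*} [MeasurableSpace β] {f : Ω → β}
    (hf : Measurable[F 0] f) : Measurable[F.predictable] fun x : ℝ≥0 × Ω => f x.2 := by
  intro B hB
  have : (fun x : ℝ≥0 × Ω => f x.2) ⁻¹' B = {⊥} ×ˢ (f ⁻¹' B) ∪ Set.Ioi 0 ×ˢ (f ⁻¹' B) := by
    ext ⟨s, ω⟩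
    rcases eq_or_lt_of_le (zero_le (a := s)) with h | h
    · subst h; simp
    · simp [h, h.ne']
  rw [this]
  exact (measurableSet_predictable_singleton_bot_prod (hf hB)).union
    (measurableSet_predictable_Ioi_prod (hf hB))

theorem predictable_le_prod :
    F.predictable ≤ (inferInstance : MeasurableSpace (ℝ≥0 × Ω)) :=
  measurableSpace_le_predictable_of_measurableSet
    (fun _ hA => (measurableSet_singleton _).prod (F.le _ _ hA))
    fun i _ hA => measurableSet_Ioi.prod (F.le i _ hA)

end Predictable

-- Base rates, the history, and the time before many events.

namespace Network

variable {Ω : Type*} [mΩ : MeasurableSpace Ω] {p : ℕ} (X : Network Ω p)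

/-- The base rate of the interactions from `i` to `j`. -/
def baseRate (i j : ℕ) (ω : Ω) : ℝ≥0∞ :=
  ENNReal.ofReal (∑ k, X.weight i k ω * X.weight j k ω)

theorem baseRate_comm (i j : ℕ) (ω : Ω) : X.baseRate i j ω = X.baseRate j i ω := by
  simp_rw [baseRate, mul_comm]

theorem measurable_history_w₀ (i : ℕ) : Measurable[X.history 0] (X.w₀ i) := by
  rw [measurable_iff_comap_le]
  exact le_sup_of_le_left (le_sup_of_le_left (le_sup_of_le_left
    (le_iSup (fun i => MeasurableSpace.comap (X.w₀ i) inferInstance) i)))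

theorem measurable_history_θ (i : ℕ) : Measurable[X.history 0] (X.θ i) := by
  rw [measurable_iff_comap_le]
  exact le_sup_of_le_left (le_sup_of_le_left (le_sup_of_le_right
    (le_iSup (fun i => MeasurableSpace.comap (X.θ i) inferInstance) i)))

theorem measurable_history_β (i : ℕ) (k : Fin p) : Measurable[X.history 0] (X.β i k) := by
  rw [measurable_iff_comap_le]
  exact le_sup_of_le_left (le_sup_of_le_right
    (le_iSup₂ (f := fun i k => MeasurableSpace.comap (X.β i k) inferInstance) i k))

theorem measurable_history_N {i j : ℕ} (hij : i ≠ j) (t : ℝ≥0) :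
    Measurable[X.history t] (X.N i j t) := by
  rw [measurable_iff_comap_le]
  refine le_sup_of_le_right ?_
  exact le_iSup_of_le i (le_iSup_of_le j (le_iSup_of_le hij (le_iSup_of_le t
    (le_iSup_of_le le_rfl le_rfl))))

theorem measurable_history_baseRate (i j : ℕ) : Measurable[X.history 0] (X.baseRate i j) := by
  have h := fun i k => (X.measurable_history_w₀ i).mul (X.measurable_history_β i k)
  exact (Finset.measurable_sum _ fun k _ => (h i k).mul (h j k)).ennreal_ofReal

theorem measurable_baseRate (i j : ℕ) : Measurable (X.baseRate i j) :=
  (X.measurable_history_baseRate i j).mono (X.history.le 0) le_rfl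

theorem N_mono (i j : ℕ) (ω : Ω) : Monotone fun t => X.N i j t ω := fun _ _ h =>
  ENNReal.tsum_le_tsum fun _ => Set.indicator_le_indicator_of_subset
    (Set.Iic_subset_Iic.2 (ENNReal.coe_le_coe.2 h)) (fun _ => zero_le) _

theorem one_le_N {i j : ℕ} {t : ℝ≥0} {ω : Ω} {n : ℕ} (h : X.time i j n ω ≤ t) :
    1 ≤ X.N i j t ω := by
  refine le_trans ?_ (ENNReal.le_tsum n)
  rw [Set.indicator_of_mem (Set.mem_Iic.2 h)]

theorem N_eq_zero_iff {i j : ℕ} {t : ℝ≥0} {ω : Ω} :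
    X.N i j t ω = 0 ↔ ∀ n, (t : ℝ≥0∞) < X.time i j n ω := by
  constructor
  · intro h n
    by_contra hn
    have := X.one_le_N (not_lt.1 hn)
    rw [h] at this
    simp at this
  · intro h
    refine ENNReal.tsum_eq_zero.2 fun n => Set.indicator_of_notMem ?_ _
    simpa using h n

/-- At most `n` events of each of the processes in `J` strictly before the given time. -/
def fewEvents (J : Finset (ℕ × ℕ)) (n : ℕ) : Set (ℝ≥0 × Ω) :=
  {x | ∀ r < x.1, ∀ e ∈ J, X.N e.1 e.2 r x.2 ≤ n}

/-- Because only times strictly before `s` are inspected, the complement is a union over rationals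
`q` of sets `(q, ∞) × {N q > n}`, with the second factor known at time `q`. -/
theorem measurableSet_fewEvents {J : Finset (ℕ × ℕ)} (hJ : ∀ e ∈ J, e.1 ≠ e.2) (n : ℕ) :
    MeasurableSet[X.history.predictable] (X.fewEvents J n) := by
  have : X.fewEvents J n = (⋃ q : ℚ, Set.Ioi (Real.toNNReal q) ×ˢ
      ⋃ e ∈ J, {ω | (n : ℝ≥0∞) < X.N e.1 e.2 (Real.toNNReal q) ω})ᶜ := by
    ext ⟨s, ω⟩
    simp only [fewEvents, Set.mem_ofPred_eq, Set.mem_compl_iff, Set.mem_iUnion, Set.mem_prod,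
      Set.mem_Ioi, not_exists, not_and, not_lt, exists_prop]
    constructor
    · exact fun h q hq e he => h _ hq e he
    · intro h r hr e he
      obtain ⟨q, -, hrq, hqs⟩ := NNReal.lt_iff_exists_rat_btwn r s |>.1 hr
      exact (X.N_mono _ _ ω hrq.le).trans (h q hqs e he)
  rw [this]
  refine MeasurableSet.compl (MeasurableSet.iUnion fun q => ?_)
  refine measurableSet_predictable_Ioi_prod (Finset.measurableSet_biUnion _ fun e he => ?_)
  exact X.measurable_history_N (hJ e he) _ measurableSet_Ioi

/-- As long as the reverse direction has had no event before `s`, the excitation sum is empty. This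
is why `J` has to be closed under reversal. -/
theorem intensity_of_mem_fewEvents {J : Finset (ℕ × ℕ)} {e : ℕ × ℕ} (he : e.swap ∈ J)
    (η δ : ℝ) {s : ℝ≥0} {ω : Ω} (h : (s, ω) ∈ X.fewEvents J 0) :
    X.intensity η δ e.1 e.2 s ω = X.baseRate e.1 e.2 ω := by
  rw [intensity, baseRate]
  rw [ENNReal.tsum_eq_zero.2, add_zero]
  refine fun n => Set.indicator_of_notMem (fun hn => ?_) _
  rw [Set.mem_Iio] at hn
  have hu : X.time e.2 e.1 n ω ≠ ⊤ := (hn.trans ENNReal.coe_lt_top).ne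
  have h1 := h (X.time e.2 e.1 n ω).toNNReal
    (by rwa [← ENNReal.coe_lt_coe, ENNReal.coe_toNNReal hu]) _ he
  have h2 := X.one_le_N (i := e.2) (j := e.1) (n := n) (ω := ω)
    (t := (X.time e.2 e.1 n ω).toNNReal) (by rw [ENNReal.coe_toNNReal hu])
  have := h2.trans h1
  simp at this

end Network

/-- The fundamental theorem of calculus for `s ↦ exp (-l (t - s))`, stated additively to avoid
truncated subtraction. -/
theorem lintegral_rate_mul_expNeg (l : ℝ≥0∞) (hl : l ≠ ⊤) {t m : ℝ≥0} (hm : m ≤ t) :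
    (∫⁻ s in Set.Ioc (0 : ℝ) m, expNeg (l * ((t - s.toNNReal : ℝ≥0) : ℝ≥0∞)) * l) +
      expNeg (l * t) = expNeg (l * ((t - m : ℝ≥0) : ℝ≥0∞)) := by
  lift l to ℝ≥0 using hl
  have hr : ∀ s : ℝ≥0, s ≤ t → expNeg (l * ((t - s : ℝ≥0) : ℝ≥0∞)) =
      ENNReal.ofReal (Real.exp (-(l * (t - s)))) := by
    intro s hs
    rw [← ENNReal.coe_mul, ← ENNReal.ofReal_coe_nnreal, expNeg_ofReal (NNReal.coe_nonneg _),
      NNReal.coe_mul, NNReal.coe_sub hs]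
  have h1 : ∫⁻ s in Set.Ioc (0 : ℝ) m, expNeg (l * ((t - s.toNNReal : ℝ≥0) : ℝ≥0∞)) * l =
      ∫⁻ s in Set.Ioc (0 : ℝ) m, ENNReal.ofReal (Real.exp (-(l * (t - s))) * l) := by
    refine setLIntegral_congr_fun measurableSet_Ioc fun s hs => ?_
    have hs' : s.toNNReal ≤ t := (Real.toNNReal_le_iff_le_coe.2 hs.2).trans hm
    rw [hr _ hs', Real.coe_toNNReal _ hs.1.le, ENNReal.ofReal_mul (Real.exp_nonneg _),
      ENNReal.ofReal_coe_nnreal]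
  have hcont : Continuous fun s : ℝ => Real.exp (-(l * (t - s))) * l := by fun_prop
  have h2 : ∫ s in (0 : ℝ)..m, Real.exp (-(l * (t - s))) * l =
      Real.exp (-(l * (t - m))) - Real.exp (-(l * (t - 0))) := by
    refine intervalIntegral.integral_eq_sub_of_hasDerivAt
      (f := fun s : ℝ => Real.exp (-(l * (t - s)))) (fun s _ => ?_)
      (hcont.intervalIntegrable _ _)
    have : HasDerivAt (fun s : ℝ => -((l : ℝ) * (t - s))) (l : ℝ) s := by
      convert! (((hasDerivAt_id s).const_sub (t : ℝ)).const_mul (l : ℝ)).neg using 1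
      simp
    exact this.exp
  rw [h1, ← ofReal_integral_eq_lintegral_ofReal
    ((hcont.intervalIntegrable 0 (m : ℝ)).1) (ae_of_all _ fun s => by positivity),
    ← intervalIntegral.integral_of_le (NNReal.coe_nonneg m), h2, hr m hm]
  have h0 : expNeg ((l : ℝ≥0∞) * t) = ENNReal.ofReal (Real.exp (-(l * (t - 0)))) := by
    have := hr 0 zero_le
    simpa using this
  rw [h0, ← ENNReal.ofReal_add _ (Real.exp_nonneg _), sub_add_cancel]
  rw [sub_nonneg]
  apply Real.exp_le_exp.2
  have : (0 : ℝ) ≤ l * m := by positivity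
  nlinarith

-- The first event, and the probability of no event.

section Events

theorem measurable_tsum_events {Ω : Type*} [MeasurableSpace Ω] {C : ℝ≥0 × Ω → ℝ≥0∞}
    (hC : Measurable C) {t : ℕ → Ω → ℝ≥0∞} (ht : ∀ n, Measurable (t n)) :
    Measurable fun ω => ∑' n, (Set.Iio ⊤).indicator (fun u : ℝ≥0∞ => C (u.toNNReal, ω))
      (t n ω) := by
  refine Measurable.tsum fun n => ?_
  have h1 : Measurable fun ω => C ((t n ω).toNNReal, ω) :=
    hC.comp ((ht n).ennreal_toNNReal.prodMk measurable_id)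
  exact h1.indicator (ht n measurableSet_Iio)

variable {Ω : Type*} [mΩ : MeasurableSpace Ω] {p : ℕ} {X : Network Ω p} {P : Measure Ω}
  {a b : Fin p → ℝ} {σ τ η δ : ℝ}

/-- The regularity of the paths of the interaction processes. -/
structure Network.RegularPath (X : Network Ω p) (ω : Ω) : Prop where
  mono : ∀ i j, i ≠ j → Monotone (fun n => X.time i j n ω)
  lt : ∀ i j, i ≠ j → ∀ n, X.time i j n ω < ⊤ → X.time i j n ω < X.time i j (n + 1) ω
  tendsto : ∀ i j, i ≠ j → Tendsto (fun n => X.time i j n ω) atTop (𝓝 ⊤)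
  ne : ∀ i j k l, i ≠ j → k ≠ l → (i, j) ≠ (k, l) → ∀ m n,
    X.time i j m ω < ⊤ → X.time i j m ω ≠ X.time k l n ω

theorem IsHawkesCCRM.ae_regularPath (hX : IsHawkesCCRM X P a b σ τ η δ) :
    ∀ᵐ ω ∂P, X.RegularPath ω := by
  have h2 : ∀ᵐ ω ∂P, ∀ i j, i ≠ j → Monotone (fun n => X.time i j n ω) := by
    simpa only [ae_all_iff] using hX.time_mono
  have h3 : ∀ᵐ ω ∂P, ∀ i j, i ≠ j → ∀ n, X.time i j n ω < ⊤ →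
      X.time i j n ω < X.time i j (n + 1) ω := by
    simpa only [ae_all_iff] using hX.time_lt
  have h4 : ∀ᵐ ω ∂P, ∀ i j, i ≠ j → Tendsto (fun n => X.time i j n ω) atTop (𝓝 ⊤) := by
    simpa only [ae_all_iff] using hX.time_tendsto
  have h5 : ∀ᵐ ω ∂P, ∀ i j k l, i ≠ j → k ≠ l → (i, j) ≠ (k, l) → ∀ m n,
      X.time i j m ω < ⊤ → X.time i j m ω ≠ X.time k l n ω := by
    simpa only [ae_all_iff] using hX.time_ne
  filter_upwards [h2, h3, h4, h5] with ω h2 h3 h4 h5 using ⟨h2, h3, h4, h5⟩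

/-- The first event of the processes in `J`. -/
def Network.firstEvent (X : Network Ω p) (J : Finset (ℕ × ℕ)) (ω : Ω) : ℝ≥0∞ :=
  J.inf fun e => X.time e.1 e.2 0 ω

theorem Network.RegularPath.lt_firstEvent_iff {ω : Ω} (h : X.RegularPath ω)
    {J : Finset (ℕ × ℕ)} (hJ : ∀ e ∈ J, e.1 ≠ e.2) (t : ℝ≥0) :
    (t : ℝ≥0∞) < X.firstEvent J ω ↔ ∀ e ∈ J, X.N e.1 e.2 t ω = 0 := by
  rw [Network.firstEvent, Finset.lt_inf_iff ENNReal.coe_lt_top]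
  refine forall₂_congr fun e he => ?_
  rw [X.N_eq_zero_iff]
  exact ⟨fun h0 n => h0.trans_le (h.mono _ _ (hJ e he) (Nat.zero_le n)), fun h0 => h0 0⟩

/-- The inequality is weak since the set inspects only times before `s`. A test process supported on
it is therefore still switched on at the first event, and counts that event. -/
theorem Network.RegularPath.mem_fewEvents_zero_iff {ω : Ω} (h : X.RegularPath ω)
    {J : Finset (ℕ × ℕ)} (hJ : ∀ e ∈ J, e.1 ≠ e.2) (s : ℝ≥0) :
    (s, ω) ∈ X.fewEvents J 0 ↔ (s : ℝ≥0∞) ≤ X.firstEvent J ω := by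
  have : (s, ω) ∈ X.fewEvents J 0 ↔ ∀ r < s, (r : ℝ≥0∞) < X.firstEvent J ω := by
    simp [Network.fewEvents, h.lt_firstEvent_iff hJ]
  rw [this]
  constructor
  · intro h1
    by_contra h2
    rw [not_le] at h2
    have hne := (h2.trans ENNReal.coe_lt_top).ne
    have := h1 (X.firstEvent J ω).toNNReal
      (by rwa [← ENNReal.coe_lt_coe, ENNReal.coe_toNNReal hne])
    rw [ENNReal.coe_toNNReal hne] at this
    exact this.false
  · exact fun h1 r hr => (ENNReal.coe_lt_coe.2 hr).trans_le h1

/-- Only the first event contributes to a sum over the events up to the first event. -/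
theorem Network.RegularPath.sum_events {ω : Ω} (h : X.RegularPath ω)
    {J : Finset (ℕ × ℕ)} (hJ : ∀ e ∈ J, e.1 ≠ e.2) (T : ℝ≥0) (c : ℝ≥0 → ℝ≥0∞)
    (hc : ∀ s, ¬(s ≤ T ∧ (s : ℝ≥0∞) ≤ X.firstEvent J ω) → c s = 0) :
    ∑ e ∈ J, ∑' n, (Set.Iio ⊤).indicator (fun u : ℝ≥0∞ => c u.toNNReal) (X.time e.1 e.2 n ω) =
      if X.firstEvent J ω ≤ T then c (X.firstEvent J ω).toNNReal else 0 := by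
  have hle : ∀ e ∈ J, ∀ n, X.firstEvent J ω ≤ X.time e.1 e.2 n ω := fun e he n =>
    (Finset.inf_le he).trans (h.mono _ _ (hJ e he) (Nat.zero_le n))
  have hzero : ∀ e ∈ J, ∀ n, (X.time e.1 e.2 n ω ≠ X.firstEvent J ω ∨ ¬X.firstEvent J ω ≤ T) →
      (Set.Iio ⊤).indicator (fun u : ℝ≥0∞ => c u.toNNReal) (X.time e.1 e.2 n ω) = 0 := by
    intro e he n hn
    rw [Set.indicator_apply_eq_zero]
    intro hu
    have hu' : X.time e.1 e.2 n ω ≠ ⊤ := (Set.mem_Iio.1 hu).ne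
    refine hc _ fun hs => ?_
    rw [ENNReal.coe_toNNReal hu'] at hs
    have heq := le_antisymm hs.2 (hle e he n)
    rcases hn with hn | hn
    · exact hn heq
    · refine hn ?_
      rw [← heq, ← ENNReal.coe_toNNReal hu']
      exact ENNReal.coe_le_coe.2 hs.1
  split_ifs with hT
  · have htop : X.firstEvent J ω < ⊤ := hT.trans_lt ENNReal.coe_lt_top
    obtain ⟨e, he, hee⟩ : ∃ e ∈ J, X.firstEvent J ω = X.time e.1 e.2 0 ω := by
      refine Finset.exists_mem_eq_inf J ?_ _
      by_contra hne
      rw [Finset.not_nonempty_iff_eq_empty] at hne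
      rw [Network.firstEvent, hne] at htop
      simp at htop
    -- Later events of the same process are strictly later, and another process cannot have an event
    -- at the same time; so exactly one term survives.
    rw [Finset.sum_eq_single_of_mem e he, tsum_eq_single 0]
    · rw [← hee, Set.indicator_of_mem (Set.mem_Iio.2 htop)]
    · intro n hn
      refine hzero e he n (Or.inl ?_)
      rw [hee]
      refine ((h.lt _ _ (hJ e he) 0 (hee ▸ htop)).trans_le (h.mono _ _ (hJ e he) ?_)).ne'
      omega
    · intro e' he' hne
      refine ENNReal.tsum_eq_zero.2 fun n => hzero e' he' n (Or.inl fun heq => ?_)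
      refine h.ne e'.1 e'.2 e.1 e.2 (hJ e' he') (hJ e he) hne n 0 (heq ▸ htop) ?_
      rw [heq, hee]
  · exact Finset.sum_eq_zero fun e he => ENNReal.tsum_eq_zero.2 fun n =>
      hzero e he n (Or.inr hT)

/-- Given the nodes, the probability that none of the processes in a symmetric set has an event
until time `T` is exponential in the sum of the base rates. -/
theorem IsHawkesCCRM.lintegral_no_event (hX : IsHawkesCCRM X P a b σ τ η δ)
    {J : Finset (ℕ × ℕ)} (hJ : ∀ e ∈ J, e.1 ≠ e.2) (hsymm : ∀ e ∈ J, e.swap ∈ J)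
    {G : Ω → ℝ≥0∞} (hG : Measurable[X.history 0] G) (hGfin : ∫⁻ ω, G ω ∂P ≠ ⊤) (T : ℝ≥0) :
    ∫⁻ ω, G ω * {ω | ∀ e ∈ J, X.N e.1 e.2 T ω = 0}.indicator 1 ω ∂P =
      ∫⁻ ω, G ω * expNeg ((∑ e ∈ J, X.baseRate e.1 e.2 ω) * T) ∂P := by
  set L : Ω → ℝ≥0∞ := fun ω => ∑ e ∈ J, X.baseRate e.1 e.2 ω with hL
  have hLt : ∀ ω, L ω ≠ ⊤ := fun ω => ENNReal.sum_ne_top.2 fun e _ => ENNReal.ofReal_ne_top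
  have hLm0 : Measurable[X.history 0] L :=
    Finset.measurable_sum _ fun e _ => X.measurable_history_baseRate e.1 e.2
  have hLm : Measurable L := hLm0.mono (X.history.le 0) le_rfl
  have hGm : Measurable G := hG.mono (X.history.le 0) le_rfl
  set S : Set (ℝ≥0 × Ω) := (Prod.fst ⁻¹' Set.Iic T) ∩ X.fewEvents J 0 with hS
  -- For constant rate `L`, `exp (-L (T - s))` is the conditional probability of no event in `(s,
  -- T]`. The test process is this probability, weighted by `G` and switched off after `T` and after
  -- the first event.
  set C : ℝ≥0 × Ω → ℝ≥0∞ := S.indicator fun x =>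
    G x.2 * expNeg (L x.2 * ((T - x.1 : ℝ≥0) : ℝ≥0∞)) with hC
  have hCm : Measurable[X.history.predictable] C := by
    refine Measurable.indicator ?_ ?_
    · refine Measurable.mul (measurable_snd_predictable _ hG) (measurable_expNeg.comp ?_)
      refine Measurable.mul (measurable_snd_predictable _ hLm0)
        (measurable_coe_nnreal_ennreal.comp ?_)
      exact (measurable_fst_predictable X.history).const_sub T
    · exact (measurable_fst_predictable X.history measurableSet_Iic).inter
        (X.measurableSet_fewEvents hJ 0)
  have hCm' : Measurable C := hCm.mono (predictable_le_prod _) le_rfl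
  have hCs : Measurable fun x : ℝ × Ω => C (x.1.toNNReal, x.2) :=
    hCm'.comp ((measurable_fst.real_toNNReal).prodMk measurable_snd)
  have hNm : MeasurableSet {ω | ∀ e ∈ J, X.N e.1 e.2 T ω = 0} := by
    have : {ω | ∀ e ∈ J, X.N e.1 e.2 T ω = 0} = ⋂ e ∈ J, X.N e.1 e.2 T ⁻¹' {0} := by
      ext; simp
    rw [this]
    exact Finset.measurableSet_biInter _ fun e _ => X.measurable_N _ _ _ (measurableSet_singleton 0)
  have hCzero : ∀ ω, X.RegularPath ω → ∀ s,
      ¬(s ≤ T ∧ (s : ℝ≥0∞) ≤ X.firstEvent J ω) → C (s, ω) = 0 := by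
    intro ω hω s hs
    refine Set.indicator_of_notMem (fun hmem => hs ⟨hmem.1, ?_⟩) _
    exact (hω.mem_fewEvents_zero_iff hJ s).1 hmem.2
  have hCval : ∀ ω, X.RegularPath ω → ∀ s, s ≤ T → (s : ℝ≥0∞) ≤ X.firstEvent J ω →
      C (s, ω) = G ω * expNeg (L ω * ((T - s : ℝ≥0) : ℝ≥0∞)) := fun ω hω s h1 h2 =>
    Set.indicator_of_mem (show (s, ω) ∈ S from ⟨h1, (hω.mem_fewEvents_zero_iff hJ s).2 h2⟩) _
  -- The intensity identities summed over `J`. Where `C` does not vanish each intensity is a base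
  -- rate, so the total is `L`.
  have hleft : ∫⁻ ω, (if X.firstEvent J ω ≤ T then C ((X.firstEvent J ω).toNNReal, ω) else 0) ∂P =
      ∫⁻ ω, (∫⁻ s in Set.Ioi (0 : ℝ), C (s.toNNReal, ω) * L ω) ∂P := by
    have hsum := Finset.sum_congr rfl fun e he => hX.intensity e.1 e.2 (hJ e he) C hCm
    rw [← lintegral_finsetSum, ← lintegral_finsetSum] at hsum
    · convert! hsum using 1
      · refine lintegral_congr_ae ?_
        filter_upwards [hX.ae_regularPath] with ω hω
        rw [hω.sum_events hJ T (fun s => C (s, ω)) (hCzero ω hω)]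
      · refine lintegral_congr fun ω => ?_
        rw [← lintegral_finsetSum']
        · refine lintegral_congr fun s => ?_
          rw [hL, Finset.mul_sum]
          refine Finset.sum_congr rfl fun e he => ?_
          by_cases hs : (s.toNNReal, ω) ∈ S
          · rw [X.intensity_of_mem_fewEvents (hsymm e he) η δ hs.2]
          · rw [hC, Set.indicator_of_notMem hs, zero_mul, zero_mul]
        · intro e he
          have : (fun s : ℝ => C (s.toNNReal, ω) * X.intensity η δ e.1 e.2 s.toNNReal ω) =
              fun s : ℝ => C (s.toNNReal, ω) * X.baseRate e.1 e.2 ω := by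
            ext s
            by_cases hs : (s.toNNReal, ω) ∈ S
            · rw [X.intensity_of_mem_fewEvents (hsymm e he) η δ hs.2]
            · rw [hC, Set.indicator_of_notMem hs, zero_mul, zero_mul]
          rw [this]
          exact ((hCs.comp measurable_prodMk_right).mul_const _).aemeasurable
    · intro e he
      have : (fun ω => ∫⁻ s in Set.Ioi (0 : ℝ), C (s.toNNReal, ω) *
          X.intensity η δ e.1 e.2 s.toNNReal ω) =
          fun ω => ∫⁻ s in Set.Ioi (0 : ℝ), C (s.toNNReal, ω) * X.baseRate e.1 e.2 ω := by
        ext ω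
        refine lintegral_congr fun s => ?_
        by_cases hs : (s.toNNReal, ω) ∈ S
        · rw [X.intensity_of_mem_fewEvents (hsymm e he) η δ hs.2]
        · rw [hC, Set.indicator_of_notMem hs, zero_mul, zero_mul]
      rw [this]
      refine Measurable.lintegral_prod_left'
        (f := fun x : ℝ × Ω => C (x.1.toNNReal, x.2) * X.baseRate e.1 e.2 x.2) ?_
      exact hCs.mul ((X.measurable_baseRate _ _).comp measurable_snd)
    · intro e he
      exact measurable_tsum_events hCm' (X.measurable_time e.1 e.2)
  -- Pathwise, both sides equal `G * exp (-L (T - m))`, where `m` is the smaller of `T` and the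
  -- first event time. By `hleft` the first summands have equal expectations, so the second ones do
  -- once the common part is known to be finite.
  have hpt : ∀ᵐ ω ∂P, (if X.firstEvent J ω ≤ T then C ((X.firstEvent J ω).toNNReal, ω) else 0) +
      G ω * {ω | ∀ e ∈ J, X.N e.1 e.2 T ω = 0}.indicator 1 ω =
      (∫⁻ s in Set.Ioi (0 : ℝ), C (s.toNNReal, ω) * L ω) + G ω * expNeg (L ω * T) := by
    filter_upwards [hX.ae_regularPath] with ω hω
    have hint : ∀ m : ℝ≥0, (∀ s : ℝ≥0, s ≤ m ↔ s ≤ T ∧ (s : ℝ≥0∞) ≤ X.firstEvent J ω) → m ≤ T →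
        (∫⁻ s in Set.Ioi (0 : ℝ), C (s.toNNReal, ω) * L ω) + G ω * expNeg (L ω * T) =
          G ω * expNeg (L ω * ((T - m : ℝ≥0) : ℝ≥0∞)) := by
      intro m hm hmT
      rw [← lintegral_rate_mul_expNeg (L ω) (hLt ω) hmT, mul_add,
        ← lintegral_const_mul _ (by fun_prop)]
      congr 1
      rw [← Set.Ioc_union_Ioi_eq_Ioi (NNReal.coe_nonneg m),
        lintegral_union measurableSet_Ioi (Set.Ioc_disjoint_Ioi le_rfl)]
      rw [setLIntegral_congr_fun (g := fun _ => 0) measurableSet_Ioi, lintegral_zero, add_zero]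
      · refine setLIntegral_congr_fun measurableSet_Ioc fun s hs => ?_
        have := (hm s.toNNReal).1 (Real.toNNReal_le_iff_le_coe.2 hs.2)
        rw [hCval ω hω _ this.1 this.2, mul_assoc]
      · intro s hs
        simp only
        rw [hCzero ω hω, zero_mul]
        rw [← hm, not_le]
        exact (Real.lt_toNNReal_iff_coe_lt).2 hs
    split_ifs with hT
    · have htop : X.firstEvent J ω ≠ ⊤ := (hT.trans_lt ENNReal.coe_lt_top).ne
      have hT' : (X.firstEvent J ω).toNNReal ≤ T := by
        rwa [← ENNReal.coe_le_coe, ENNReal.coe_toNNReal htop]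
      rw [hint (X.firstEvent J ω).toNNReal ?_ hT', hCval ω hω _ hT' (ENNReal.coe_toNNReal htop).le,
        Set.indicator_of_notMem, mul_zero, add_zero]
      · intro hmem
        exact absurd hT (not_le.2 ((hω.lt_firstEvent_iff hJ T).2 hmem))
      · intro s
        rw [← ENNReal.coe_le_coe (r := s) (q := (X.firstEvent J ω).toNNReal),
          ENNReal.coe_toNNReal htop]
        exact ⟨fun h => ⟨ENNReal.coe_le_coe.1 (h.trans hT), h⟩, fun h => h.2⟩
    · rw [not_le] at hT
      rw [hint T (fun s => ⟨fun h => ⟨h, (ENNReal.coe_le_coe.2 h).trans hT.le⟩, fun h => h.1⟩)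
        le_rfl,
        Set.indicator_of_mem (show ω ∈ {ω | ∀ e ∈ J, X.N e.1 e.2 T ω = 0} from
          (hω.lt_firstEvent_iff hJ T).1 hT)]
      simp [expNeg_zero]
  have hfin : ∫⁻ ω, (if X.firstEvent J ω ≤ T then C ((X.firstEvent J ω).toNNReal, ω) else 0) ∂P
      ≠ ⊤ := by
    refine ne_top_of_le_ne_top hGfin (lintegral_mono fun ω => ?_)
    split_ifs
    · refine (Set.indicator_le_self _ _ _).trans ?_
      exact mul_le_of_le_one_right' (expNeg_le_one _)
    · exact zero_le
  have htot := lintegral_congr_ae hpt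
  have hGN : Measurable fun ω => G ω * {ω | ∀ e ∈ J, X.N e.1 e.2 T ω = 0}.indicator 1 ω :=
    hGm.mul (measurable_one.indicator hNm)
  rw [lintegral_add_right _ hGN,
    lintegral_add_right _ (by fun_prop), ← hleft] at htot
  exact (ENNReal.add_right_inj hfin).1 htot

end Events

-- The Volterra equation of the mean intensity and its adjoint.

section Volterra

/-- The excitation kernel. -/
def kernel (η δ r : ℝ) : ℝ≥0∞ := ENNReal.ofReal (η * Real.exp (-(δ * r)))

/-- The solution of the adjoint Volterra equation, minus one. -/
def adjointExcess (η δ T u : ℝ) : ℝ := η * (1 - Real.exp (-((δ - η) * (T - u)))) / (δ - η)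

theorem continuous_adjointExcess (η δ T : ℝ) : Continuous (adjointExcess η δ T) := by
  unfold adjointExcess
  fun_prop

theorem continuous_kernel (η δ : ℝ) : Continuous (kernel η δ) := by
  unfold kernel
  exact ENNReal.continuous_ofReal.comp (by fun_prop)

theorem adjointExcess_nonneg {η δ T u : ℝ} (hη : 0 ≤ η) (hu : u ≤ T) :
    0 ≤ adjointExcess η δ T u := by
  unfold adjointExcess
  rcases le_or_gt (δ - η) 0 with h | h
  · have : 1 ≤ Real.exp (-((δ - η) * (T - u))) := Real.one_le_exp (by nlinarith)
    exact div_nonneg_of_nonpos (by nlinarith) h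
  · have : Real.exp (-((δ - η) * (T - u))) ≤ 1 := Real.exp_le_one_iff.2 (by nlinarith)
    exact div_nonneg (by nlinarith) h.le

/-- With `f = 1 + adjointExcess` this is the adjoint equation `f u = 1 + ∫ s in u..T, f s * k (s -
u)`. Here `f u` is the expected number of events, in a chain with kernel `k`, descending until `T`
from an event at `u`, that event included. -/
theorem integral_adjointExcess {η δ : ℝ} (h : δ ≠ η) (T u : ℝ) :
    ∫ s in u..T, (1 + adjointExcess η δ T s) * (η * Real.exp (-(δ * (s - u)))) =
      adjointExcess η δ T u := by
  have hk : δ - η ≠ 0 := sub_ne_zero.2 h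
  have hcont : Continuous fun s : ℝ =>
      (1 + adjointExcess η δ T s) * (η * Real.exp (-(δ * (s - u)))) := by
    have := continuous_adjointExcess η δ T
    fun_prop
  -- Since `1 + adjointExcess = (δ - η exp (-(δ - η) (T - s))) / (δ - η)`, the integrand is a
  -- combination of exponentials of rates `δ` and `η` in `s`, which integrates termwise.
  have hderiv : ∀ s, HasDerivAt (fun s : ℝ => η / (δ - η) *
      (Real.exp (-((δ - η) * T) + δ * u - η * s) - Real.exp (-(δ * (s - u)))))
      ((1 + adjointExcess η δ T s) * (η * Real.exp (-(δ * (s - u))))) s := by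
    intro s
    have h1 : HasDerivAt (fun s : ℝ => -(δ * (s - u))) (-δ) s := by
      convert! (((hasDerivAt_id s).sub_const u).const_mul δ).neg using 1
      simp
    have h2 : HasDerivAt (fun s : ℝ => -((δ - η) * T) + δ * u - η * s) (-η) s := by
      convert! ((hasDerivAt_id s).const_mul η).const_sub (-((δ - η) * T) + δ * u) using 1
      simp
    convert! (h2.exp.sub h1.exp).const_mul (η / (δ - η)) using 1
    have h3 : Real.exp (-((δ - η) * (T - s))) * Real.exp (-(δ * (s - u))) =
        Real.exp (-((δ - η) * T) + δ * u - η * s) := by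
      rw [← Real.exp_add]; congr 1; ring
    rw [← h3, adjointExcess]
    field_simp
    ring
  rw [intervalIntegral.integral_eq_sub_of_hasDerivAt (fun s _ => hderiv s)
    (hcont.intervalIntegrable _ _), adjointExcess]
  have e1 : -((δ - η) * T) + δ * u - η * T = -(δ * (T - u)) := by ring
  have e2 : -((δ - η) * T) + δ * u - η * u = -((δ - η) * (T - u)) := by ring
  rw [e1, e2]
  simp
  ring

theorem lintegral_adjoint_mul_kernel {η δ T u : ℝ} (h : δ ≠ η) (hη : 0 ≤ η) (hu : u ≤ T) :
    ∫⁻ s in Set.Ioc u T, ENNReal.ofReal (1 + adjointExcess η δ T s) * kernel η δ (s - u) =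
      ENNReal.ofReal (adjointExcess η δ T u) := by
  have hcont : Continuous fun s : ℝ =>
      (1 + adjointExcess η δ T s) * (η * Real.exp (-(δ * (s - u)))) := by
    have := continuous_adjointExcess η δ T
    fun_prop
  rw [← integral_adjointExcess h, intervalIntegral.integral_of_le hu,
    ofReal_integral_eq_lintegral_ofReal (hcont.intervalIntegrable u T).1]
  · refine setLIntegral_congr_fun measurableSet_Ioc fun s hs => ?_
    have := adjointExcess_nonneg (δ := δ) hη hs.2
    rw [kernel, ← ENNReal.ofReal_mul (by positivity)]
  · refine (ae_restrict_iff' measurableSet_Ioc).2 (ae_of_all _ fun s hs => ?_)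
    have := adjointExcess_nonneg (δ := δ) hη hs.2
    exact mul_nonneg (by positivity) (by positivity)

theorem lintegral_adjoint {η δ T : ℝ} (h : δ ≠ η) (hη : 0 ≤ η) (hT : 0 ≤ T) :
    ∫⁻ s in Set.Ioc 0 T, ENNReal.ofReal (1 + adjointExcess η δ T s) =
      ENNReal.ofReal (δ / (δ - η) * T -
        η / (δ - η) ^ 2 * (1 - Real.exp (-(T * (δ - η))))) := by
  have hk : δ - η ≠ 0 := sub_ne_zero.2 h
  have hcont : Continuous fun s : ℝ => 1 + adjointExcess η δ T s :=
    continuous_const.add (continuous_adjointExcess η δ T)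
  have hint : ∫ s in (0 : ℝ)..T, (1 + adjointExcess η δ T s) = δ / (δ - η) * T -
        η / (δ - η) ^ 2 * (1 - Real.exp (-(T * (δ - η)))) := by
    have hderiv : ∀ s, HasDerivAt (fun s : ℝ => δ / (δ - η) * s -
        η / (δ - η) ^ 2 * Real.exp (-((δ - η) * (T - s)))) (1 + adjointExcess η δ T s) s := by
      intro s
      have h1 : HasDerivAt (fun s : ℝ => -((δ - η) * (T - s))) (δ - η) s := by
        convert! (((hasDerivAt_id s).const_sub T).const_mul (δ - η)).neg using 1
        simp
      convert! ((hasDerivAt_id s).const_mul (δ / (δ - η))).sub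
        (h1.exp.const_mul (η / (δ - η) ^ 2)) using 1
      rw [adjointExcess]
      field_simp
      ring
    rw [intervalIntegral.integral_eq_sub_of_hasDerivAt (fun s _ => hderiv s)
      (hcont.intervalIntegrable _ _)]
    simp
    rw [mul_comm T (δ - η)]
    ring
  rw [← hint, intervalIntegral.integral_of_le hT,
    ofReal_integral_eq_lintegral_ofReal (hcont.intervalIntegrable 0 T).1]
  refine (ae_restrict_iff' measurableSet_Ioc).2 (ae_of_all _ fun s hs => ?_)
  have := adjointExcess_nonneg (δ := δ) hη hs.2
  show (0 : ℝ) ≤ _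
  positivity

/-- Tonelli moves the kernel from `y` to `f = 1 + adjointExcess`, and the adjoint equation evaluates
the inner integral as `f - 1`. For a solution `y` of the Volterra equation this reads `∫ f y = c ∫ f
+ ∫ (f - 1) y`, which leaves `∫ y = c ∫ f` after cancellation; `y` itself is never solved for. -/
theorem lintegral_adjoint_mul_volterra {η δ T : ℝ} (h : δ ≠ η) (hη : 0 ≤ η) {y : ℝ → ℝ≥0∞}
    (hy : Measurable y) (c : ℝ≥0∞) :
    ∫⁻ s in Set.Ioc 0 T, ENNReal.ofReal (1 + adjointExcess η δ T s) *
        (c + ∫⁻ u in Set.Ioo 0 s, kernel η δ (s - u) * y u) =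
      c * (∫⁻ s in Set.Ioc 0 T, ENNReal.ofReal (1 + adjointExcess η δ T s)) +
        ∫⁻ u in Set.Ioc 0 T, ENNReal.ofReal (adjointExcess η δ T u) * y u := by
  have hfm : Measurable fun s => ENNReal.ofReal (1 + adjointExcess η δ T s) :=
    (measurable_const.add (continuous_adjointExcess η δ T).measurable).ennreal_ofReal
  have hkm : Measurable (kernel η δ) := (continuous_kernel η δ).measurable
  simp_rw [mul_add]
  rw [lintegral_add_left (hfm.mul_const c), lintegral_mul_const _ hfm, mul_comm c]
  congr 1
  -- The triangle `u < s` is encoded by an indicator, so that Tonelli can be used on the full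
  -- square.
  set H : ℝ → ℝ → ℝ≥0∞ := fun s u => (Set.Ioi u).indicator
    (fun s => ENNReal.ofReal (1 + adjointExcess η δ T s) * kernel η δ (s - u)) s * y u with hH
  have hHm : Measurable (Function.uncurry H) := by
    refine Measurable.mul ?_ (hy.comp measurable_snd)
    have : (fun x : ℝ × ℝ => (Set.Ioi x.2).indicator
        (fun s => ENNReal.ofReal (1 + adjointExcess η δ T s) * kernel η δ (s - x.2)) x.1) =
        {x : ℝ × ℝ | x.2 < x.1}.indicator fun x =>
          ENNReal.ofReal (1 + adjointExcess η δ T x.1) * kernel η δ (x.1 - x.2) := by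
      ext x; simp [Set.indicator]
    rw [this]
    refine Measurable.indicator ?_ (measurableSet_lt measurable_snd measurable_fst)
    exact (hfm.comp measurable_fst).mul (hkm.comp (measurable_fst.sub measurable_snd))
  have h1 : ∀ s ∈ Set.Ioc 0 T, ENNReal.ofReal (1 + adjointExcess η δ T s) *
      ∫⁻ u in Set.Ioo 0 s, kernel η δ (s - u) * y u = ∫⁻ u in Set.Ioc 0 T, H s u := by
    intro s hs
    have hm : Measurable fun u => kernel η δ (s - u) * y u := by fun_prop
    rw [← lintegral_const_mul _ hm, ← lintegral_indicator measurableSet_Ioo,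
      ← lintegral_indicator measurableSet_Ioc]
    refine lintegral_congr fun u => ?_
    by_cases hu : u ∈ Set.Ioo 0 s
    · have hu' : u ∈ Set.Ioc 0 T := ⟨hu.1, hu.2.le.trans hs.2⟩
      rw [Set.indicator_of_mem hu, Set.indicator_of_mem hu', hH]
      simp only
      rw [Set.indicator_of_mem (Set.mem_Ioi.2 hu.2), mul_assoc]
    · rw [Set.indicator_of_notMem hu]
      by_cases hu0 : 0 < u
      · have : s ∉ Set.Ioi u := fun hsu => hu ⟨hu0, hsu⟩
        simp [hH, Set.indicator, Set.mem_Ioi.not.1 this]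
      · rw [Set.indicator_of_notMem fun h => hu0 h.1]
  rw [setLIntegral_congr_fun measurableSet_Ioc h1, lintegral_lintegral_swap hHm.aemeasurable]
  refine setLIntegral_congr_fun measurableSet_Ioc fun u hu => ?_
  have hHu : Measurable fun s => (Set.Ioi u).indicator
    (fun s => ENNReal.ofReal (1 + adjointExcess η δ T s) * kernel η δ (s - u)) s := by
    refine Measurable.indicator ?_ measurableSet_Ioi
    fun_prop
  simp only [hH]
  rw [lintegral_mul_const _ hHu]
  congr 1
  rw [← lintegral_adjoint_mul_kernel h hη hu.2, lintegral_indicator measurableSet_Ioi,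
    Measure.restrict_restrict measurableSet_Ioi]
  congr 2
  ext s
  simp only [Set.mem_inter_iff, Set.mem_Ioi, Set.mem_Ioc]
  exact ⟨fun h => ⟨h.1, h.2.2⟩, fun h => ⟨h.1, hu.1.trans h.1, h.2⟩⟩

theorem exists_adjointExcess_le (η δ T : ℝ) :
    ∃ M : ℝ≥0, ∀ u ∈ Set.Ioc 0 T, ENNReal.ofReal (adjointExcess η δ T u) ≤ M := by
  obtain ⟨M, hM⟩ := (isCompact_Icc (a := (0 : ℝ)) (b := T)).bddAbove_image
    (continuous_adjointExcess η δ T).continuousOn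
  refine ⟨M.toNNReal, fun u hu => ?_⟩
  exact ENNReal.ofReal_le_ofReal (hM ⟨u, ⟨hu.1.le, hu.2⟩, rfl⟩)

theorem lintegral_add_excess {η δ T : ℝ} (hη : 0 ≤ η) {y : ℝ → ℝ≥0∞} (hy : Measurable y) :
    ∫⁻ s in Set.Ioc 0 T, ENNReal.ofReal (1 + adjointExcess η δ T s) * y s =
      (∫⁻ s in Set.Ioc 0 T, y s) +
        ∫⁻ s in Set.Ioc 0 T, ENNReal.ofReal (adjointExcess η δ T s) * y s := by
  rw [← lintegral_add_left hy]
  refine setLIntegral_congr_fun measurableSet_Ioc fun s hs => ?_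
  rw [ENNReal.ofReal_add zero_le_one (adjointExcess_nonneg hη hs.2), ENNReal.ofReal_one, add_mul,
    one_mul]

theorem lintegral_excess_ne_top {η δ T : ℝ} {y : ℝ → ℝ≥0∞}
    (hfin : ∫⁻ s in Set.Ioc 0 T, y s ≠ ⊤) :
    ∫⁻ s in Set.Ioc 0 T, ENNReal.ofReal (adjointExcess η δ T s) * y s ≠ ⊤ := by
  obtain ⟨M, hM⟩ := exists_adjointExcess_le η δ T
  refine ne_top_of_le_ne_top (ENNReal.mul_ne_top (ENNReal.coe_ne_top (r := M)) hfin) ?_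
  rw [← lintegral_const_mul' _ _ ENNReal.coe_ne_top]
  exact setLIntegral_mono' measurableSet_Ioc fun u hu => mul_le_mul_left (hM u hu) _

/-- For the stopped intensities, which satisfy only an inequality. The bound does not depend on
where the process is stopped, and so provides the finiteness that the corresponding equality
requires. -/
theorem lintegral_le_of_volterra_le {η δ T : ℝ} (h : δ ≠ η) (hη : 0 ≤ η) {y : ℝ → ℝ≥0∞}
    (hy : Measurable y) (c : ℝ≥0∞) (hfin : ∫⁻ s in Set.Ioc 0 T, y s ≠ ⊤)
    (hle : ∀ s ∈ Set.Ioc 0 T, y s ≤ c + ∫⁻ u in Set.Ioo 0 s, kernel η δ (s - u) * y u) :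
    ∫⁻ s in Set.Ioc 0 T, y s ≤
      c * ∫⁻ s in Set.Ioc 0 T, ENNReal.ofReal (1 + adjointExcess η δ T s) := by
  have h1 : ∫⁻ s in Set.Ioc 0 T, ENNReal.ofReal (1 + adjointExcess η δ T s) * y s ≤ _ :=
    setLIntegral_mono' measurableSet_Ioc fun s hs => mul_le_mul_right (hle s hs) _
  rw [lintegral_adjoint_mul_volterra h hη hy, lintegral_add_excess hη hy] at h1
  exact (ENNReal.add_le_add_iff_right (lintegral_excess_ne_top hfin)).1 h1

theorem lintegral_eq_of_volterra_eq {η δ T : ℝ} (h : δ ≠ η) (hη : 0 ≤ η) {y : ℝ → ℝ≥0∞}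
    (hy : Measurable y) (c : ℝ≥0∞) (hfin : ∫⁻ s in Set.Ioc 0 T, y s ≠ ⊤)
    (heq : ∀ s ∈ Set.Ioc 0 T, y s = c + ∫⁻ u in Set.Ioo 0 s, kernel η δ (s - u) * y u) :
    ∫⁻ s in Set.Ioc 0 T, y s =
      c * ∫⁻ s in Set.Ioc 0 T, ENNReal.ofReal (1 + adjointExcess η δ T s) := by
  have h1 : ∫⁻ s in Set.Ioc 0 T, ENNReal.ofReal (1 + adjointExcess η δ T s) * y s = _ :=
    setLIntegral_congr_fun measurableSet_Ioc fun s hs => congrArg _ (heq s hs)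
  rw [lintegral_adjoint_mul_volterra h hη hy, lintegral_add_excess hη hy] at h1
  exact (ENNReal.add_left_inj (lintegral_excess_ne_top hfin)).1 h1

end Volterra

-- Sums over events, and the total intensity of a pair.

namespace Network

variable {Ω : Type*} [mΩ : MeasurableSpace Ω] {p : ℕ} (X : Network Ω p)

/-- The sum of `C` over the times of the interactions from `i` to `j`. -/
def eventSum (i j : ℕ) (C : ℝ≥0 × Ω → ℝ≥0∞) (ω : Ω) : ℝ≥0∞ :=
  ∑' n, (Set.Iio ⊤).indicator (fun u : ℝ≥0∞ => C (u.toNNReal, ω)) (X.time i j n ω)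

theorem measurable_eventSum (i j : ℕ) {C : ℝ≥0 × Ω → ℝ≥0∞} (hC : Measurable C) :
    Measurable (X.eventSum i j C) :=
  measurable_tsum_events hC (X.measurable_time i j)

theorem eventSum_mono {i j : ℕ} {C D : ℝ≥0 × Ω → ℝ≥0∞} {ω : Ω} (h : ∀ s, C (s, ω) ≤ D (s, ω)) :
    X.eventSum i j C ω ≤ X.eventSum i j D ω :=
  ENNReal.tsum_le_tsum fun _ => Set.indicator_le_indicator (h _)

theorem eventSum_indicator_Iic (i j : ℕ) (T : ℝ≥0) (ω : Ω) :
    X.eventSum i j ((Prod.fst ⁻¹' Set.Iic T).indicator 1) ω = X.N i j T ω := by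
  refine tsum_congr fun n => ?_
  by_cases h : X.time i j n ω = ⊤
  · simp [h]
  · have h' : ((X.time i j n ω).toNNReal ≤ T) ↔ X.time i j n ω ≤ T := by
      rw [← ENNReal.coe_le_coe, ENNReal.coe_toNNReal h]
    simp [Set.indicator, h', lt_top_iff_ne_top, h]

/-- The excitation of the interactions at time `s` by an interaction at time `u`. -/
def excitation (η δ : ℝ) (s : ℝ≥0) (x : ℝ≥0 × Ω) : ℝ≥0∞ :=
  (Set.Iio s).indicator (fun u : ℝ≥0 => kernel η δ (s - u)) x.1

theorem intensity_eq (η δ : ℝ) (i j : ℕ) (s : ℝ≥0) (ω : Ω) :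
    X.intensity η δ i j s ω = X.baseRate i j ω + X.eventSum j i (excitation η δ s) ω := by
  rw [intensity, baseRate, eventSum]
  congr 1
  refine tsum_congr fun n => ?_
  by_cases h : X.time j i n ω = ⊤
  · simp [h]
  · have h' : ((X.time j i n ω).toNNReal < s) ↔ X.time j i n ω < s := by
      rw [← ENNReal.coe_lt_coe, ENNReal.coe_toNNReal h]
    simp only [Set.indicator, Set.mem_Iio, excitation, h', lt_top_iff_ne_top, ne_eq, h,
      not_false_eq_true, if_true]
    rfl

theorem measurable_intensity (η δ : ℝ) (i j : ℕ) :
    Measurable fun x : ℝ≥0 × Ω => X.intensity η δ i j x.1 x.2 := by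
  refine ((X.measurable_baseRate i j).comp measurable_snd).add (Measurable.tsum fun n => ?_)
  have ht : Measurable fun x : ℝ≥0 × Ω => X.time j i n x.2 :=
    (X.measurable_time j i n).comp measurable_snd
  have hs : MeasurableSet {x : ℝ≥0 × Ω | X.time j i n x.2 < x.1} :=
    measurableSet_lt ht (by fun_prop)
  have hm : Measurable fun x : ℝ≥0 × Ω => ENNReal.ofReal
      (η * Real.exp (-(δ * (x.1 - (X.time j i n x.2).toReal)))) := by fun_prop
  exact hm.indicator hs

/-- The total intensity of the interactions between `i` and `j`. -/
def pairIntensity (η δ : ℝ) (i j : ℕ) (x : ℝ≥0 × Ω) : ℝ≥0∞ :=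
  X.intensity η δ i j x.1 x.2 + X.intensity η δ j i x.1 x.2

theorem measurable_pairIntensity (η δ : ℝ) (i j : ℕ) : Measurable (X.pairIntensity η δ i j) :=
  (X.measurable_intensity η δ i j).add (X.measurable_intensity η δ j i)

/-- The sum of `C` over the times of the interactions between `i` and `j`. -/
def pairSum (i j : ℕ) (C : ℝ≥0 × Ω → ℝ≥0∞) (ω : Ω) : ℝ≥0∞ :=
  X.eventSum i j C ω + X.eventSum j i C ω

/-- Each direction is excited by the other with the same kernel and base rate, so their sum behaves
like a single self-exciting process with base rate `2 * baseRate`; this makes the Volterra equation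
scalar. -/
theorem pairIntensity_eq (η δ : ℝ) (i j : ℕ) (s : ℝ≥0) (ω : Ω) :
    X.pairIntensity η δ i j (s, ω) =
      2 * X.baseRate i j ω + X.pairSum i j (excitation η δ s) ω := by
  rw [pairIntensity, X.intensity_eq, X.intensity_eq, X.baseRate_comm j i, pairSum]
  ring

end Network

-- The expected number of interactions of a pair.

section Mean

variable {Ω : Type*} [mΩ : MeasurableSpace Ω] {p : ℕ} {X : Network Ω p} {P : Measure Ω}
  {a b : Fin p → ℝ} {σ τ η δ : ℝ}

theorem IsHawkesCCRM.lintegral_pairSum [SFinite P] (hX : IsHawkesCCRM X P a b σ τ η δ)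
    {i j : ℕ} (hij : i ≠ j) {C : ℝ≥0 × Ω → ℝ≥0∞} (hC : Measurable[X.history.predictable] C) :
    ∫⁻ ω, X.pairSum i j C ω ∂P = ∫⁻ s in Set.Ioi (0 : ℝ),
      ∫⁻ ω, C (s.toNNReal, ω) * X.pairIntensity η δ i j (s.toNNReal, ω) ∂P := by
  have hC' : Measurable C := hC.mono (predictable_le_prod _) le_rfl
  have hr : Measurable fun x : Ω × ℝ => (x.2.toNNReal, x.1) :=
    (measurable_snd.real_toNNReal).prodMk measurable_fst
  have hCr : Measurable fun x : Ω × ℝ => C (x.2.toNNReal, x.1) := hC'.comp hr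
  have hI : ∀ i j, Measurable fun x : Ω × ℝ =>
      C (x.2.toNNReal, x.1) * X.intensity η δ i j x.2.toNNReal x.1 := fun i j => by
    have h := (X.measurable_intensity η δ i j).comp hr
    exact hCr.mul h
  have hprod : Measurable fun x : Ω × ℝ =>
      C (x.2.toNNReal, x.1) * X.pairIntensity η δ i j (x.2.toNNReal, x.1) := by
    have h := (X.measurable_pairIntensity η δ i j).comp hr
    exact hCr.mul h
  rw [← lintegral_lintegral_swap (f := fun (ω : Ω) (s : ℝ) =>
    C (s.toNNReal, ω) * X.pairIntensity η δ i j (s.toNNReal, ω)) hprod.aemeasurable]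
  simp only [Network.pairSum]
  rw [lintegral_add_left (X.measurable_eventSum i j hC')]
  have h1 := hX.intensity i j hij C hC
  have h2 := hX.intensity j i hij.symm C hC
  simp only [Network.eventSum]
  have hI1 : Measurable fun ω => ∫⁻ s in Set.Ioi (0 : ℝ),
      C (s.toNNReal, ω) * X.intensity η δ i j s.toNNReal ω := (hI i j).lintegral_prod_right'
  rw [h1, h2, ← lintegral_add_left hI1]
  refine lintegral_congr fun ω => ?_
  have hI2 : Measurable fun s : ℝ => C (s.toNNReal, ω) * X.intensity η δ i j s.toNNReal ω :=
    (hI i j).comp measurable_prodMk_left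
  rw [← lintegral_add_left hI2]
  refine lintegral_congr fun s => ?_
  rw [Network.pairIntensity, mul_add]

/-- The expected total intensity on a set. -/
def Network.meanIntensity (X : Network Ω p) (P : Measure Ω) (η δ : ℝ) (i j : ℕ)
    (D : Set (ℝ≥0 × Ω)) (s : ℝ) : ℝ≥0∞ :=
  ∫⁻ ω, D.indicator 1 (s.toNNReal, ω) * X.pairIntensity η δ i j (s.toNNReal, ω) ∂P

theorem Network.measurable_meanIntensity [SFinite P] (i j : ℕ) {D : Set (ℝ≥0 × Ω)}
    (hD : MeasurableSet D) : Measurable (X.meanIntensity P η δ i j D) := by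
  have hr : Measurable fun x : ℝ × Ω => (x.1.toNNReal, x.2) :=
    (measurable_fst.real_toNNReal).prodMk measurable_snd
  exact Measurable.lintegral_prod_right' (f := fun x : ℝ × Ω =>
    D.indicator 1 (x.1.toNNReal, x.2) * X.pairIntensity η δ i j (x.1.toNNReal, x.2))
    (((measurable_one.indicator hD).comp hr).mul ((X.measurable_pairIntensity η δ i j).comp hr))

theorem IsHawkesCCRM.lintegral_pairSum_indicator [SFinite P] (hX : IsHawkesCCRM X P a b σ τ η δ)
    {i j : ℕ} (hij : i ≠ j) {D : Set (ℝ≥0 × Ω)} (hD : MeasurableSet[X.history.predictable] D)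
    {φ : ℝ≥0 → ℝ≥0∞} (hφ : Measurable φ) :
    ∫⁻ ω, X.pairSum i j (fun x => φ x.1 * D.indicator 1 x) ω ∂P =
      ∫⁻ s in Set.Ioi (0 : ℝ), φ s.toNNReal * X.meanIntensity P η δ i j D s := by
  have hC : Measurable[X.history.predictable] fun x : ℝ≥0 × Ω => φ x.1 * D.indicator 1 x :=
    Measurable.mul (hφ.comp (measurable_fst_predictable _))
      (Measurable.indicator measurable_const hD)
  have hD' : MeasurableSet D := predictable_le_prod _ _ hD
  rw [hX.lintegral_pairSum hij hC]
  refine lintegral_congr fun s => ?_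
  rw [Network.meanIntensity, ← lintegral_const_mul]
  · simp_rw [mul_assoc]
  · exact ((measurable_one.indicator hD').comp measurable_prodMk_left).mul
      ((X.measurable_pairIntensity η δ i j).comp measurable_prodMk_left)

/-- For fixed `s` the excitation is a deterministic function of the event time, so its product with
the indicator of a predictable set is an admissible test process; this produces the convolution term
of the Volterra equation. -/
theorem IsHawkesCCRM.lintegral_pairSum_excitation [SFinite P]
    (hX : IsHawkesCCRM X P a b σ τ η δ)
    {i j : ℕ} (hij : i ≠ j) {D : Set (ℝ≥0 × Ω)} (hD : MeasurableSet[X.history.predictable] D)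
    {s : ℝ} (hs : 0 < s) :
    ∫⁻ ω, X.pairSum i j
        (fun x => Network.excitation η δ s.toNNReal x * D.indicator 1 x) ω ∂P =
      ∫⁻ u in Set.Ioo 0 s, kernel η δ (s - u) * X.meanIntensity P η δ i j D u := by
  have hφ : Measurable fun u : ℝ≥0 => (Set.Iio s.toNNReal).indicator
      (fun u : ℝ≥0 => kernel η δ (s.toNNReal - u)) u :=
    Measurable.indicator ((continuous_kernel η δ).measurable.comp (by fun_prop)) measurableSet_Iio
  have := hX.lintegral_pairSum_indicator hij hD hφ
  simp only [Network.excitation]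
  rw [this, ← lintegral_indicator measurableSet_Ioi, ← lintegral_indicator measurableSet_Ioo]
  refine lintegral_congr fun u => ?_
  by_cases hu : 0 < u
  · rw [Set.indicator_of_mem (Set.mem_Ioi.2 hu)]
    by_cases hus : u < s
    · rw [Set.indicator_of_mem (Set.mem_Ioo.2 ⟨hu, hus⟩), Set.indicator_of_mem
        (Set.mem_Iio.2 ((Real.toNNReal_lt_toNNReal_iff hs).2 hus)),
        Real.coe_toNNReal _ hu.le, Real.coe_toNNReal _ hs.le]
    · rw [Set.indicator_of_notMem (s := Set.Ioo 0 s) fun h => hus h.2, Set.indicator_of_notMem,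
        zero_mul]
      rw [Set.mem_Iio, Real.toNNReal_lt_toNNReal_iff hs]
      exact hus
  · rw [Set.indicator_of_notMem (s := Set.Ioi 0) hu,
      Set.indicator_of_notMem (s := Set.Ioo 0 s) fun h => hu h.1]

/-- A set of times and outcomes that contains with `(s, ω)` also `(u, ω)` for `u < s`. -/
theorem IsHawkesCCRM.meanIntensity_le [SFinite P] (hX : IsHawkesCCRM X P a b σ τ η δ)
    {i j : ℕ} (hij : i ≠ j) {D : Set (ℝ≥0 × Ω)} (hD : MeasurableSet[X.history.predictable] D)
    (hdown : ∀ s u ω, u < s → (s, ω) ∈ D → (u, ω) ∈ D)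
    {A : Set Ω} (hA : MeasurableSet A) (hDA : ∀ s ω, (s, ω) ∈ D → ω ∈ A) {s : ℝ} (hs : 0 < s) :
    X.meanIntensity P η δ i j D s ≤ 2 * (∫⁻ ω in A, X.baseRate i j ω ∂P) +
      ∫⁻ u in Set.Ioo 0 s, kernel η δ (s - u) * X.meanIntensity P η δ i j D u := by
  rw [← hX.lintegral_pairSum_excitation hij hD hs, ← lintegral_indicator hA,
    ← lintegral_const_mul _ ((X.measurable_baseRate i j).indicator hA),
    ← lintegral_add_left (((X.measurable_baseRate i j).indicator hA).const_mul _)]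
  refine lintegral_mono fun ω => ?_
  by_cases hω : (s.toNNReal, ω) ∈ D
  · rw [Set.indicator_of_mem hω, Pi.one_apply, one_mul, X.pairIntensity_eq,
      Set.indicator_of_mem (hDA _ _ hω)]
    -- Only events before `s` excite at `s`, and `D` contains all earlier times of an outcome that
    -- is in `D` at `s`.
    have : ∀ u : ℝ≥0, Network.excitation η δ s.toNNReal (u, ω) ≤
        Network.excitation η δ s.toNNReal (u, ω) * D.indicator 1 (u, ω) := by
      intro u
      by_cases hu : u < s.toNNReal
      · rw [Set.indicator_of_mem (hdown _ _ _ hu hω), Pi.one_apply, mul_one]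
      · rw [Network.excitation, Set.indicator_of_notMem (by simpa using hu)]
        exact zero_le
    exact add_le_add_right (add_le_add (X.eventSum_mono this) (X.eventSum_mono this)) _
  · rw [Set.indicator_of_notMem hω, zero_mul]
    exact zero_le

/-- Without stopping, membership does not depend on time, so nothing is lost in the excitation sum
and the Volterra inequality becomes an equality. -/
theorem IsHawkesCCRM.meanIntensity_eq [SFinite P] (hX : IsHawkesCCRM X P a b σ τ η δ)
    {i j : ℕ} (hij : i ≠ j) {A : Set Ω} (hA : MeasurableSet[X.history 0] A) {s : ℝ} (hs : 0 < s) :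
    X.meanIntensity P η δ i j (Prod.snd ⁻¹' A) s = 2 * (∫⁻ ω in A, X.baseRate i j ω ∂P) +
      ∫⁻ u in Set.Ioo 0 s, kernel η δ (s - u) *
        X.meanIntensity P η δ i j (Prod.snd ⁻¹' A) u := by
  have hA' : MeasurableSet A := X.history.le 0 _ hA
  have hD : MeasurableSet[X.history.predictable] (Prod.snd ⁻¹' A : Set (ℝ≥0 × Ω)) := by
    have := measurable_snd_predictable X.history
      (f := A.indicator (1 : Ω → ℝ≥0∞)) (Measurable.indicator measurable_const hA)
    convert this (measurableSet_singleton 1) using 1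
    ext x
    by_cases h : x.2 ∈ A <;> simp [h]
  rw [← hX.lintegral_pairSum_excitation hij hD hs, ← lintegral_indicator hA',
    ← lintegral_const_mul _ ((X.measurable_baseRate i j).indicator hA'),
    ← lintegral_add_left (((X.measurable_baseRate i j).indicator hA').const_mul _)]
  refine lintegral_congr fun ω => ?_
  by_cases hω : ω ∈ A
  · have h1 : ∀ u : ℝ≥0, (Prod.snd ⁻¹' A : Set (ℝ≥0 × Ω)).indicator (1 : ℝ≥0 × Ω → ℝ≥0∞) (u, ω)
        = 1 := fun u => Set.indicator_of_mem (show (u, ω) ∈ Prod.snd ⁻¹' A from hω) _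
    simp only [Network.pairSum, Network.eventSum, h1, one_mul, mul_one, X.pairIntensity_eq,
      Set.indicator_of_mem hω]
  · have h1 : ∀ u : ℝ≥0, (Prod.snd ⁻¹' A : Set (ℝ≥0 × Ω)).indicator (1 : ℝ≥0 × Ω → ℝ≥0∞) (u, ω)
        = 0 := fun u => Set.indicator_of_notMem (show (u, ω) ∉ Prod.snd ⁻¹' A from hω) _
    simp [Network.pairSum, Network.eventSum, h1, Set.indicator_of_notMem hω]

/-- Each event before `s` contributes at most `η`, as `δ ≥ 0`, and there are at most `n` of them. -/
theorem Network.eventSum_excitation_le (hη : 0 ≤ η) (hδ : 0 ≤ δ) {J : Finset (ℕ × ℕ)} {n : ℕ}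
    {e : ℕ × ℕ} (he : e ∈ J) {s : ℝ≥0} {ω : Ω} (h : (s, ω) ∈ X.fewEvents J n) :
    X.eventSum e.1 e.2 (Network.excitation η δ s) ω ≤ ENNReal.ofReal η * n := by
  classical
  have h1 : X.eventSum e.1 e.2 (Network.excitation η δ s) ω ≤ ENNReal.ofReal η *
      ∑' m, (Set.Iio (s : ℝ≥0∞)).indicator (fun _ => 1) (X.time e.1 e.2 m ω) := by
    rw [← ENNReal.tsum_mul_left]
    refine ENNReal.tsum_le_tsum fun m => ?_
    by_cases ht : X.time e.1 e.2 m ω = ⊤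
    · simp [ht]
    · have h' : ((X.time e.1 e.2 m ω).toNNReal < s) ↔ X.time e.1 e.2 m ω < s := by
        rw [← ENNReal.coe_lt_coe, ENNReal.coe_toNNReal ht]
      rw [Set.indicator_of_mem (Set.mem_Iio.2 (lt_top_iff_ne_top.2 ht)), Network.excitation]
      by_cases hs : X.time e.1 e.2 m ω < s
      · rw [Set.indicator_of_mem (Set.mem_Iio.2 (h'.2 hs)), Set.indicator_of_mem (Set.mem_Iio.2 hs),
          mul_one]
        refine ENNReal.ofReal_le_ofReal (mul_le_of_le_one_right hη (Real.exp_le_one_iff.2 ?_))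
        have : ((X.time e.1 e.2 m ω).toNNReal : ℝ) ≤ s := NNReal.coe_le_coe.2 (h'.2 hs).le
        have := mul_nonneg hδ (sub_nonneg.2 this)
        linarith
      · rw [Set.indicator_of_notMem (s := Set.Iio s) fun hm => hs (h'.1 hm)]
        exact zero_le
  refine h1.trans (mul_le_mul_right ?_ _)
  rw [ENNReal.tsum_eq_iSup_sum]
  refine iSup_le fun F => ?_
  rcases eq_or_lt_of_le (zero_le (a := s)) with hs | hs
  · simp [← hs]
  · set F' := F.filter fun m => X.time e.1 e.2 m ω < s with hF'
    -- The hypothesis bounds the counts only at times strictly before `s`. Finitely many events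
    -- before `s` all occur by their latest time `r < s`; the case `s = 0` is separate because an
    -- empty supremum is `0`.
    set r : ℝ≥0 := F'.sup fun m => (X.time e.1 e.2 m ω).toNNReal with hr
    have hmem : ∀ m ∈ F', X.time e.1 e.2 m ω < s := fun m hm => (Finset.mem_filter.1 hm).2
    have hrs : r < s := by
      rw [hr, Finset.sup_lt_iff (by simpa using hs)]
      intro m hm
      rw [← ENNReal.coe_lt_coe, ENNReal.coe_toNNReal ((hmem m hm).trans ENNReal.coe_lt_top).ne]
      exact hmem m hm
    refine le_trans ?_ (h r hrs e he)
    refine le_trans ?_ (ENNReal.sum_le_tsum F)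
    refine Finset.sum_le_sum fun m hm => ?_
    by_cases hms : X.time e.1 e.2 m ω < s
    · rw [Set.indicator_of_mem (Set.mem_Iio.2 hms), Set.indicator_of_mem]
      rw [Set.mem_Iic, ← ENNReal.coe_toNNReal (hms.trans ENNReal.coe_lt_top).ne]
      exact ENNReal.coe_le_coe.2 (Finset.le_sup (f := fun m => (X.time e.1 e.2 m ω).toNNReal)
        (Finset.mem_filter.2 ⟨hm, hms⟩))
    · rw [Set.indicator_of_notMem (s := Set.Iio (s : ℝ≥0∞)) hms]
      exact zero_le

theorem Network.RegularPath.N_ne_top {ω : Ω} (h : X.RegularPath ω) {i j : ℕ} (hij : i ≠ j)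
    (t : ℝ≥0) : X.N i j t ω ≠ ⊤ := by
  have hev := (h.tendsto i j hij).eventually (lt_mem_nhds (ENNReal.coe_lt_top (r := t)))
  obtain ⟨n, hn⟩ := Filter.eventually_atTop.1 hev
  rw [Network.N, count, tsum_eq_sum (s := Finset.range n)]
  · refine ENNReal.sum_ne_top.2 fun m _ => ?_
    exact ((Set.indicator_le_self _ (fun _ => (1 : ℝ≥0∞)) _).trans_lt ENNReal.one_lt_top).ne
  · intro m hm
    refine Set.indicator_of_notMem ?_ _
    simpa using hn m (by simpa using hm)

theorem Network.RegularPath.exists_mem_fewEvents {ω : Ω} (h : X.RegularPath ω)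
    {J : Finset (ℕ × ℕ)} (hJ : ∀ e ∈ J, e.1 ≠ e.2) (s : ℝ≥0) :
    ∃ n, (s, ω) ∈ X.fewEvents J n := by
  have hfin : ∑ e ∈ J, X.N e.1 e.2 s ω ≠ ⊤ :=
    ENNReal.sum_ne_top.2 fun e he => h.N_ne_top (hJ e he) s
  obtain ⟨n, hn⟩ := ENNReal.exists_nat_gt hfin
  refine ⟨n, fun r hr e he => ?_⟩
  refine ((X.N_mono _ _ ω hr.le).trans ?_).trans hn.le
  exact Finset.single_le_sum (f := fun e : ℕ × ℕ => X.N e.1 e.2 s ω) (fun _ _ => zero_le) he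

/-- Localization: stopped after about `n` events, the mean intensity is bounded and the Volterra
inequality gives an estimate uniform in `n`. Monotone convergence makes the unstopped integral
finite, and the Volterra equality then evaluates it. -/
theorem IsHawkesCCRM.lintegral_interactions_of_bounded [IsProbabilityMeasure P]
    (hX : IsHawkesCCRM X P a b σ τ η δ) (hη : 0 ≤ η) (hδ : 0 ≤ δ) (hne : δ ≠ η)
    {i j : ℕ} (hij : i ≠ j) {A : Set Ω} (hA : MeasurableSet[X.history 0] A) (T : ℝ≥0)
    (hfin : ∫⁻ ω in A, X.baseRate i j ω ∂P ≠ ⊤) :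
    ∫⁻ ω in A, (X.N i j T ω + X.N j i T ω) ∂P = 2 * (∫⁻ ω in A, X.baseRate i j ω ∂P) *
      ENNReal.ofReal (δ / (δ - η) * T -
        η / (δ - η) ^ 2 * (1 - Real.exp (-(T * (δ - η))))) := by
  classical
  have hA' : MeasurableSet A := X.history.le 0 _ hA
  have hAD : MeasurableSet[X.history.predictable] (Prod.snd ⁻¹' A : Set (ℝ≥0 × Ω)) := by
    have := measurable_snd_predictable X.history
      (f := A.indicator (1 : Ω → ℝ≥0∞)) (Measurable.indicator measurable_const hA)
    convert this (measurableSet_singleton 1) using 1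
    ext x
    by_cases h : x.2 ∈ A <;> simp [h]
  set J : Finset (ℕ × ℕ) := {(i, j), (j, i)} with hJdef
  have hJ : ∀ e ∈ J, e.1 ≠ e.2 := by
    intro e he
    rcases Finset.mem_insert.1 he with rfl | he
    · exact hij
    · rw [Finset.mem_singleton.1 he]; exact hij.symm
  have hJi : (i, j) ∈ J := by simp [hJdef]
  have hJj : (j, i) ∈ J := by simp [hJdef]
  set D : ℕ → Set (ℝ≥0 × Ω) := fun n => Prod.snd ⁻¹' A ∩ X.fewEvents J n with hDdef
  have hD : ∀ n, MeasurableSet[X.history.predictable] (D n) := fun n =>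
    MeasurableSet.inter hAD (X.measurableSet_fewEvents hJ n)
  have hD' : ∀ n, MeasurableSet (D n) := fun n => predictable_le_prod _ _ (hD n)
  have hAD' : MeasurableSet (Prod.snd ⁻¹' A : Set (ℝ≥0 × Ω)) := predictable_le_prod _ _ hAD
  set c := 2 * ∫⁻ ω in A, X.baseRate i j ω ∂P with hc
  have hcfin : c ≠ ⊤ := ENNReal.mul_ne_top (by simp) hfin
  set h : ℝ≥0∞ := ∫⁻ s in Set.Ioc 0 (T : ℝ), ENNReal.ofReal (1 + adjointExcess η δ T s) with hh
  have hhfin : h ≠ ⊤ := by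
    rw [hh, lintegral_adjoint hne hη (NNReal.coe_nonneg T)]
    exact ENNReal.ofReal_ne_top
  have hyn_bound : ∀ n s, X.meanIntensity P η δ i j (D n) s ≤ c + 2 * (ENNReal.ofReal η * n) := by
    intro n s
    rw [hc, ← lintegral_indicator hA',
      ← lintegral_const_mul _ ((X.measurable_baseRate i j).indicator hA')]
    calc X.meanIntensity P η δ i j (D n) s
        ≤ ∫⁻ ω, (2 * A.indicator (X.baseRate i j) ω + 2 * (ENNReal.ofReal η * n)) ∂P := by
          refine lintegral_mono fun ω => ?_
          by_cases hω : (s.toNNReal, ω) ∈ D n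
          · rw [Set.indicator_of_mem hω, Pi.one_apply, one_mul, X.pairIntensity_eq,
              Set.indicator_of_mem (show ω ∈ A from hω.1), two_mul (ENNReal.ofReal η * n)]
            exact add_le_add_right (add_le_add
              (Network.eventSum_excitation_le hη hδ hJi hω.2)
              (Network.eventSum_excitation_le hη hδ hJj hω.2)) _
          · rw [Set.indicator_of_notMem hω, zero_mul]
            exact zero_le
      _ = _ := by
          rw [lintegral_add_right _ measurable_const, lintegral_const, measure_univ, mul_one]
  have hyn : ∀ n, ∫⁻ s in Set.Ioc 0 (T : ℝ), X.meanIntensity P η δ i j (D n) s ≤ c * h := by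
    intro n
    refine lintegral_le_of_volterra_le hne hη (X.measurable_meanIntensity i j (hD' n)) c ?_ ?_
    · refine ne_top_of_le_ne_top ?_ (lintegral_mono fun s => hyn_bound n s)
      rw [lintegral_const]
      refine ENNReal.mul_ne_top (ENNReal.add_ne_top.2 ⟨hcfin, ?_⟩) (by simp)
      exact ENNReal.mul_ne_top (by simp) (ENNReal.mul_ne_top ENNReal.ofReal_ne_top (by simp))
    · intro s hs
      refine hX.meanIntensity_le hij (hD n) ?_ hA' (fun s ω h => h.1) hs.1
      exact fun s u ω hus hs => ⟨hs.1, fun r hr => hs.2 r (hr.trans hus)⟩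
  have hDmono : Monotone D := fun n k hnk x hx =>
    ⟨hx.1, fun r hr e he => (hx.2 r hr e he).trans (by exact_mod_cast hnk)⟩
  -- Event times tend to infinity, so almost surely each time lies in some stopped set.
  have hsup : ∀ s, X.meanIntensity P η δ i j (Prod.snd ⁻¹' A) s =
      ⨆ n, X.meanIntensity P η δ i j (D n) s := by
    intro s
    simp only [Network.meanIntensity]
    rw [← lintegral_iSup]
    · refine lintegral_congr_ae ?_
      filter_upwards [hX.ae_regularPath] with ω hω
      obtain ⟨n, hn⟩ := hω.exists_mem_fewEvents hJ s.toNNReal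
      by_cases hωA : ω ∈ A
      · refine le_antisymm (le_iSup_of_le n ?_) (iSup_le fun k => mul_le_mul_left
          (Set.indicator_le_indicator_of_subset Set.inter_subset_left (fun _ => zero_le) _) _)
        rw [Set.indicator_of_mem (show (s.toNNReal, ω) ∈ D n from ⟨hωA, hn⟩)]
        exact mul_le_mul_left (Set.indicator_le_self _ _ _) _
      · refine le_antisymm ?_ (iSup_le fun k => mul_le_mul_left
          (Set.indicator_le_indicator_of_subset Set.inter_subset_left (fun _ => zero_le) _) _)
        rw [Set.indicator_of_notMem (show (s.toNNReal, ω) ∉ Prod.snd ⁻¹' A from hωA), zero_mul]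
        exact zero_le
    · exact fun n => ((measurable_one.indicator (hD' n)).comp measurable_prodMk_left).mul
        ((X.measurable_pairIntensity η δ i j).comp measurable_prodMk_left)
    · exact fun n k hnk ω => mul_le_mul_left
        (Set.indicator_le_indicator_of_subset (hDmono hnk) (fun _ => zero_le) _) _
  have hy : ∫⁻ s in Set.Ioc 0 (T : ℝ), X.meanIntensity P η δ i j (Prod.snd ⁻¹' A) s ≤ c * h := by
    simp_rw [hsup]
    rw [lintegral_iSup (fun n => X.measurable_meanIntensity i j (hD' n))]
    · exact iSup_le hyn
    · exact fun n k hnk s => lintegral_mono fun ω => mul_le_mul_left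
        (Set.indicator_le_indicator_of_subset (hDmono hnk) (fun _ => zero_le) _) _
  have hyeq := lintegral_eq_of_volterra_eq hne hη (X.measurable_meanIntensity (P := P) i j hAD') c
    (ne_top_of_le_ne_top (ENNReal.mul_ne_top hcfin hhfin) hy)
    (fun s hs => hX.meanIntensity_eq hij hA hs.1)
  rw [← lintegral_adjoint hne hη (NNReal.coe_nonneg T), ← hh]
  rw [← hh] at hyeq
  rw [← hyeq, ← lintegral_indicator hA']
  -- With the indicator of `[0, T]` as test function, the expected number of events is the integral
  -- of the mean intensity.
  have hfinal := hX.lintegral_pairSum_indicator hij hAD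
    (φ := (Set.Iic T).indicator 1) (measurable_one.indicator measurableSet_Iic)
  convert! hfinal using 1
  · refine lintegral_congr fun ω => ?_
    by_cases hω : ω ∈ A
    · have h1 : ∀ u : ℝ≥0, (Prod.snd ⁻¹' A : Set (ℝ≥0 × Ω)).indicator (1 : ℝ≥0 × Ω → ℝ≥0∞) (u, ω)
          = 1 := fun u => Set.indicator_of_mem (show (u, ω) ∈ Prod.snd ⁻¹' A from hω) _
      rw [Set.indicator_of_mem hω, ← X.eventSum_indicator_Iic, ← X.eventSum_indicator_Iic]
      simp only [Network.pairSum, Network.eventSum, h1, mul_one]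
      rfl
    · have h1 : ∀ u : ℝ≥0, (Prod.snd ⁻¹' A : Set (ℝ≥0 × Ω)).indicator (1 : ℝ≥0 × Ω → ℝ≥0∞) (u, ω)
          = 0 := fun u => Set.indicator_of_notMem (show (u, ω) ∉ Prod.snd ⁻¹' A from hω) _
      simp [Network.pairSum, Network.eventSum, h1, Set.indicator_of_notMem hω]
  · rw [← lintegral_indicator measurableSet_Ioc, ← lintegral_indicator measurableSet_Ioi]
    refine lintegral_congr fun s => ?_
    by_cases hs : 0 < s
    · rw [Set.indicator_of_mem (Set.mem_Ioi.2 hs)]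
      by_cases hsT : s ≤ T
      · rw [Set.indicator_of_mem (Set.mem_Ioc.2 ⟨hs, hsT⟩),
          Set.indicator_of_mem (Set.mem_Iic.2 (Real.toNNReal_le_iff_le_coe.2 hsT)), Pi.one_apply,
          one_mul]
      · rw [Set.indicator_of_notMem (s := Set.Ioc 0 (T : ℝ)) fun h => hsT h.2,
          Set.indicator_of_notMem, zero_mul]
        rw [Set.mem_Iic, Real.toNNReal_le_iff_le_coe]
        exact hsT
    · rw [Set.indicator_of_notMem (s := Set.Ioi 0) hs,
        Set.indicator_of_notMem (s := Set.Ioc 0 (T : ℝ)) fun h => hs h.1]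

/-- The expected number of interactions between two nodes, given the nodes. -/
theorem IsHawkesCCRM.lintegral_interactions [IsProbabilityMeasure P]
    (hX : IsHawkesCCRM X P a b σ τ η δ) (hη : 0 ≤ η) (hδ : 0 ≤ δ) (hne : δ ≠ η)
    {i j : ℕ} (hij : i ≠ j) {A : Set Ω} (hA : MeasurableSet[X.history 0] A) (T : ℝ≥0) :
    ∫⁻ ω in A, (X.N i j T ω + X.N j i T ω) ∂P = 2 * (∫⁻ ω in A, X.baseRate i j ω ∂P) *
      ENNReal.ofReal (δ / (δ - η) * T -
        η / (δ - η) ^ 2 * (1 - Real.exp (-(T * (δ - η))))) := by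
  -- The base rate is finite and known at time 0; cutting `A` by its integer part makes its integral
  -- finite on each piece, and the pieces add up.
  set B : ℕ → Set Ω := fun n => A ∩ X.baseRate i j ⁻¹' Set.Ico n (n + 1 : ℕ) with hB
  have hBm : ∀ n, MeasurableSet[X.history 0] (B n) := fun n =>
    MeasurableSet.inter hA (X.measurable_history_baseRate i j measurableSet_Ico)
  have hBm' : ∀ n, MeasurableSet (B n) := fun n => X.history.le 0 _ (hBm n)
  have hdisj : Pairwise (Function.onFun Disjoint B) := by
    intro n k hnk
    refine Set.disjoint_left.2 fun ω hn hk => hnk ?_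
    have h1 := hn.2.1.trans_lt hk.2.2
    have h2 := hk.2.1.trans_lt hn.2.2
    rw [Nat.cast_lt] at h1 h2
    omega
  have hU : ⋃ n, B n = A := by
    rw [hB, ← Set.inter_iUnion, Set.inter_eq_left]
    intro ω _
    refine Set.mem_iUnion.2 ⟨⌊(X.baseRate i j ω).toReal⌋₊, ?_⟩
    have htop : X.baseRate i j ω ≠ ⊤ := ENNReal.ofReal_ne_top
    constructor
    · rw [← ENNReal.ofReal_natCast]
      exact ENNReal.ofReal_le_of_le_toReal (Nat.floor_le ENNReal.toReal_nonneg)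
    · rw [← ENNReal.ofReal_natCast, ENNReal.lt_ofReal_iff_toReal_lt htop]
      exact_mod_cast Nat.lt_floor_add_one _
  rw [← hU, lintegral_iUnion hBm' hdisj, lintegral_iUnion hBm' hdisj, ← ENNReal.tsum_mul_left,
    ← ENNReal.tsum_mul_right]
  refine tsum_congr fun n => hX.lintegral_interactions_of_bounded hη hδ hne hij (hBm n) T ?_
  refine ne_top_of_le_ne_top ?_ (setLIntegral_mono' (hBm' n) fun ω hω => hω.2.2.le)
  rw [setLIntegral_const]
  exact ENNReal.mul_ne_top (by simp) (measure_ne_top _ _)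

end Mean

-- First moments of the Lévy measure.

section Levy

theorem measurable_ggpDensity (σ τ : ℝ) : Measurable fun w : ℝ =>
    w ^ (-1 - σ) * Real.exp (-(τ * w)) / Real.Gamma (1 - σ) := by
  fun_prop

instance sigmaFinite_ggpLevy (σ τ : ℝ) : SigmaFinite (ggpLevy σ τ) :=
  SigmaFinite.withDensity_ofReal _

theorem ae_pos_ggpLevy (σ τ : ℝ) : ∀ᵐ w ∂ggpLevy σ τ, 0 < w :=
  (withDensity_absolutelyContinuous _ _).ae_le (ae_restrict_mem measurableSet_Ioi)

theorem ae_nonneg_gammaMeasure (a b : ℝ) : ∀ᵐ x ∂gammaMeasure a b, 0 ≤ x := by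
  rw [ae_iff]
  simp only [not_le]
  change gammaMeasure a b (Set.Iio 0) = 0
  rw [gammaMeasure, withDensity_apply _ measurableSet_Iio]
  exact lintegral_gammaPDF_of_nonpos le_rfl

theorem lintegral_rpow_mul_exp_ne_top {s c C : ℝ} (hs : -1 < s) (hc : 0 < c) :
    ∫⁻ x in Set.Ioi 0, ENNReal.ofReal (C * (x ^ s * Real.exp (-(c * x)))) ≠ ⊤ := by
  have h := (integrableOn_rpow_mul_exp_neg_mul_rpow hs zero_lt_one hc).const_mul C
  refine ne_top_of_le_ne_top h.hasFiniteIntegral.ne (lintegral_mono fun x => ?_)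
  simp only [Real.rpow_one, neg_mul]
  exact Real.ofReal_le_enorm _

/-- The factor `w` turns the singularity `w ^ (-1 - σ)` at `0` into `w ^ (-σ)`, integrable because
`σ < 1`; the tail is controlled by `τ > 0`. -/
theorem lintegral_ggpLevy_ne_top {σ τ : ℝ} (hσ : σ < 1) (hτ : 0 < τ) :
    ∫⁻ w, ENNReal.ofReal w ∂ggpLevy σ τ ≠ ⊤ := by
  rw [ggpLevy, lintegral_withDensity_eq_lintegral_mul _ (measurable_ggpDensity σ τ).ennreal_ofReal
    ENNReal.measurable_ofReal]
  refine ne_top_of_le_ne_top (lintegral_rpow_mul_exp_ne_top (s := -σ) (c := τ)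
    (C := (Real.Gamma (1 - σ))⁻¹) (by linarith) hτ) (setLIntegral_mono' measurableSet_Ioi ?_)
  intro x hx
  have hx0 : 0 < x := hx
  have hG : 0 < Real.Gamma (1 - σ) := Real.Gamma_pos_of_pos (by linarith)
  rw [Pi.mul_apply, ← ENNReal.ofReal_mul (by positivity)]
  apply ENNReal.ofReal_le_ofReal
  have : x ^ (-σ) = x ^ (-1 - σ) * x := by
    rw [← Real.rpow_add_one hx0.ne']; congr 1; ring
  rw [this]
  apply le_of_eq
  field_simp

theorem lintegral_gammaMeasure_ne_top {a b : ℝ} (ha : 0 < a) (hb : 0 < b) :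
    ∫⁻ x, ENNReal.ofReal x ∂gammaMeasure a b ≠ ⊤ := by
  have hm : Measurable (gammaPDF a b) := (measurable_gammaPDFReal a b).ennreal_ofReal
  rw [gammaMeasure, lintegral_withDensity_eq_lintegral_mul _ hm ENNReal.measurable_ofReal]
  refine ne_top_of_le_ne_top (lintegral_rpow_mul_exp_ne_top (s := a) (c := b)
    (C := b ^ a / Real.Gamma a) (by linarith) hb) ?_
  rw [← lintegral_indicator measurableSet_Ioi]
  refine lintegral_mono fun x => ?_
  rcases le_or_gt x 0 with hx | hx
  · simp [ENNReal.ofReal_of_nonpos hx]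
  · rw [Set.indicator_of_mem (Set.mem_Ioi.2 hx), Pi.mul_apply, gammaPDF_of_nonneg hx.le,
      ← ENNReal.ofReal_mul (by positivity)]
    apply ENNReal.ofReal_le_ofReal
    have : x ^ a = x ^ (a - 1) * x := by
      rw [← Real.rpow_add_one hx.ne']; congr 1; ring
    rw [this]
    apply le_of_eq
    ring

variable {p : ℕ} {a b : Fin p → ℝ} {σ τ : ℝ}

theorem ae_weights_nonneg (ha : ∀ k, 0 < a k) (hb : ∀ k, 0 < b k) :
    ∀ᵐ x ∂(ggpLevy σ τ).prod (Measure.pi fun k => gammaMeasure (a k) (b k)),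
      ∀ k, 0 ≤ x.1 * x.2 k ∧ 0 ≤ x.1 := by
  have := fun k => isProbabilityMeasure_gammaMeasure (ha k) (hb k)
  have h1 : ∀ᵐ x ∂(ggpLevy σ τ).prod (Measure.pi fun k => gammaMeasure (a k) (b k)),
      0 < x.1 := Measure.quasiMeasurePreserving_fst.ae (ae_pos_ggpLevy σ τ)
  have h2 : ∀ᵐ x ∂(ggpLevy σ τ).prod (Measure.pi fun k => gammaMeasure (a k) (b k)),
      ∀ k, 0 ≤ x.2 k := by
    refine ae_all_iff.2 fun k => ?_
    exact Measure.quasiMeasurePreserving_snd.ae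
      ((measurePreserving_eval (fun k => gammaMeasure (a k) (b k)) k).quasiMeasurePreserving.ae
        (ae_nonneg_gammaMeasure (a k) (b k)))
  filter_upwards [h1, h2] with x h1 h2 k using ⟨mul_nonneg h1.le (h2 k), h1.le⟩

theorem measurable_smul_pi : Measurable fun x : ℝ × (Fin p → ℝ) => x.1 • x.2 := by
  fun_prop

theorem ae_levy_nonneg (ha : ∀ k, 0 < a k) (hb : ∀ k, 0 < b k) :
    ∀ᵐ w ∂levy a b σ τ, ∀ k, 0 ≤ w k := by
  rw [levy, ae_map_iff measurable_smul_pi.aemeasurable]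
  · filter_upwards [ae_weights_nonneg ha hb] with x hx k using (hx k).1
  · simp only [Set.ofPred_forall]
    exact MeasurableSet.iInter fun k => measurableSet_le measurable_const (measurable_pi_apply k)

/-- A weight is the product of a base weight and a score under a product measure, so its mean
factors into two finite first moments. -/
theorem lintegral_levy_ne_top (ha : ∀ k, 0 < a k) (hb : ∀ k, 0 < b k) (hσ : σ < 1) (hτ : 0 < τ)
    (k : Fin p) : ∫⁻ w, ENNReal.ofReal (w k) ∂levy a b σ τ ≠ ⊤ := by
  have := fun k => isProbabilityMeasure_gammaMeasure (ha k) (hb k)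
  rw [levy, lintegral_map (by fun_prop) measurable_smul_pi]
  have h1 : ∫⁻ x, ENNReal.ofReal ((x.1 • x.2) k)
      ∂(ggpLevy σ τ).prod (Measure.pi fun k => gammaMeasure (a k) (b k)) =
      ∫⁻ x, ENNReal.ofReal x.1 * ENNReal.ofReal (x.2 k)
      ∂(ggpLevy σ τ).prod (Measure.pi fun k => gammaMeasure (a k) (b k)) := by
    refine lintegral_congr_ae ?_
    filter_upwards [ae_weights_nonneg ha hb] with x hx
    rw [Pi.smul_apply, smul_eq_mul, ENNReal.ofReal_mul (hx k).2]
  rw [h1, lintegral_prod_mul (f := fun x : ℝ => ENNReal.ofReal x)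
    (g := fun x : Fin p → ℝ => ENNReal.ofReal (x k)) (by fun_prop)
    (ENNReal.measurable_ofReal.comp (measurable_pi_apply k)).aemeasurable]
  refine ENNReal.mul_ne_top (lintegral_ggpLevy_ne_top hσ hτ) ?_
  rw [(measurePreserving_eval (fun k => gammaMeasure (a k) (b k)) k).lintegral_comp
    ENNReal.measurable_ofReal]
  exact lintegral_gammaMeasure_ne_top (ha k) (hb k)

end Levy

-- Convergence of the integrals, and passage from `ℝ≥0∞` to `ℝ`.

section LaplaceExponent

variable {p : ℕ} {ρ : Measure (Fin p → ℝ)}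

theorem integrable_weight (h0 : ∀ᵐ w ∂ρ, ∀ k, 0 ≤ w k)
    (h1 : ∀ k, ∫⁻ w, ENNReal.ofReal (w k) ∂ρ ≠ ⊤) (k : Fin p) :
    Integrable (fun w : Fin p → ℝ => w k) ρ := by
  refine ⟨(measurable_pi_apply k).aestronglyMeasurable, ?_⟩
  rw [hasFiniteIntegral_iff_ofReal (h0.mono fun w hw => hw k)]
  exact (h1 k).lt_top

/-- Dominated by `∑ k, t k * w k`, because `1 - exp (-x) ≤ x`. -/
theorem integrable_one_sub_exp (h0 : ∀ᵐ w ∂ρ, ∀ k, 0 ≤ w k)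
    (h1 : ∀ k, ∫⁻ w, ENNReal.ofReal (w k) ∂ρ ≠ ⊤) {t : Fin p → ℝ} (ht : ∀ k, 0 ≤ t k) :
    Integrable (fun w : Fin p → ℝ => 1 - Real.exp (-∑ k, t k * w k)) ρ := by
  have hi : Integrable (fun w : Fin p → ℝ => ∑ k, t k * w k) ρ :=
    integrable_finsetSum _ fun k _ => (integrable_weight h0 h1 k).const_mul (t k)
  have hm : Measurable fun w : Fin p → ℝ => 1 - Real.exp (-∑ k, t k * w k) := by fun_prop
  refine hi.mono' hm.aestronglyMeasurable ?_
  filter_upwards [h0] with w hw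
  have hs : 0 ≤ ∑ k, t k * w k := Finset.sum_nonneg fun k _ => mul_nonneg (ht k) (hw k)
  rw [Real.norm_of_nonneg (sub_nonneg.2 (Real.exp_le_one_iff.2 (by linarith)))]
  linarith [Real.add_one_le_exp (-∑ k, t k * w k)]

theorem laplaceExponent_nonneg (h0 : ∀ᵐ w ∂ρ, ∀ k, 0 ≤ w k) {t : Fin p → ℝ}
    (ht : ∀ k, 0 ≤ t k) : 0 ≤ laplaceExponent ρ t := by
  refine integral_nonneg_of_ae ?_
  filter_upwards [h0] with w hw
  have hs : 0 ≤ ∑ k, t k * w k := Finset.sum_nonneg fun k _ => mul_nonneg (ht k) (hw k)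
  exact sub_nonneg.2 (Real.exp_le_one_iff.2 (by linarith))

theorem one_sub_expNeg_ofReal {x : ℝ} (hx : 0 ≤ x) :
    1 - expNeg (ENNReal.ofReal x) = ENNReal.ofReal (1 - Real.exp (-x)) := by
  rw [expNeg_ofReal hx, ENNReal.ofReal_sub _ (Real.exp_nonneg _), ENNReal.ofReal_one]

theorem ofReal_laplaceExponent (h0 : ∀ᵐ w ∂ρ, ∀ k, 0 ≤ w k)
    (h1 : ∀ k, ∫⁻ w, ENNReal.ofReal (w k) ∂ρ ≠ ⊤) (T : ℝ≥0) {w : Fin p → ℝ}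
    (hw : ∀ k, 0 ≤ w k) :
    ENNReal.ofReal (laplaceExponent ρ fun k => 2 * T * w k) =
      ∫⁻ z, (1 - expNeg (2 * (∑ k, ENNReal.ofReal (w k) * ENNReal.ofReal (z k)) * T)) ∂ρ := by
  have ht : ∀ k, 0 ≤ 2 * (T : ℝ) * w k := fun k => mul_nonneg (by positivity) (hw k)
  rw [laplaceExponent, ofReal_integral_eq_lintegral_ofReal (integrable_one_sub_exp h0 h1 ht)]
  · refine lintegral_congr_ae ?_
    filter_upwards [h0] with z hz
    have hs : 0 ≤ ∑ k, 2 * (T : ℝ) * w k * z k :=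
      Finset.sum_nonneg fun k _ => mul_nonneg (ht k) (hz k)
    rw [← one_sub_expNeg_ofReal hs]
    congr 2
    have h2 : ∑ k, 2 * (T : ℝ) * w k * z k = 2 * (∑ k, w k * z k) * T := by
      rw [Finset.mul_sum, Finset.sum_mul]
      exact Finset.sum_congr rfl fun k _ => by ring
    have h3 : 0 ≤ ∑ k, w k * z k := Finset.sum_nonneg fun k _ => mul_nonneg (hw k) (hz k)
    rw [h2, ENNReal.ofReal_mul (by positivity), ENNReal.ofReal_mul (by positivity),
      ENNReal.ofReal_sum_of_nonneg fun k _ => mul_nonneg (hw k) (hz k)]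
    simp [ENNReal.ofReal_mul (hw _)]
  · filter_upwards [h0] with z hz
    have hs : 0 ≤ ∑ k, 2 * (T : ℝ) * w k * z k :=
      Finset.sum_nonneg fun k _ => mul_nonneg (ht k) (hz k)
    exact sub_nonneg.2 (Real.exp_le_one_iff.2 (by linarith))

theorem aestronglyMeasurable_laplaceExponent [SFinite ρ] (T : ℝ≥0) :
    AEStronglyMeasurable (fun w : Fin p → ℝ => laplaceExponent ρ fun k => 2 * T * w k) ρ := by
  have h : StronglyMeasurable fun x : (Fin p → ℝ) × (Fin p → ℝ) =>
      1 - Real.exp (-∑ k, 2 * (T : ℝ) * x.1 k * x.2 k) := by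
    apply Measurable.stronglyMeasurable
    fun_prop
  exact (h.integral_prod_right' (ν := ρ)).aestronglyMeasurable

theorem integrable_laplaceExponent [SFinite ρ] (h0 : ∀ᵐ w ∂ρ, ∀ k, 0 ≤ w k)
    (h1 : ∀ k, ∫⁻ w, ENNReal.ofReal (w k) ∂ρ ≠ ⊤) (T : ℝ≥0) :
    Integrable (fun w : Fin p → ℝ => laplaceExponent ρ fun k => 2 * T * w k) ρ := by
  -- The same inequality under the inner integral bounds the Laplace exponent by a linear function
  -- of `w`.
  have hi : Integrable (fun w : Fin p → ℝ => ∑ k, 2 * T * w k * meanWeight ρ k) ρ :=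
    integrable_finsetSum _ fun k _ => ((integrable_weight h0 h1 k).const_mul _).mul_const _
  refine hi.mono' (aestronglyMeasurable_laplaceExponent T) ?_
  filter_upwards [h0] with w hw
  have ht : ∀ k, 0 ≤ 2 * (T : ℝ) * w k := fun k => mul_nonneg (by positivity) (hw k)
  rw [Real.norm_of_nonneg (laplaceExponent_nonneg h0 ht), laplaceExponent]
  simp_rw [meanWeight, ← integral_const_mul]
  rw [← integral_finsetSum _ fun k _ => (integrable_weight h0 h1 k).const_mul _]
  refine integral_mono (integrable_one_sub_exp h0 h1 ht)
    (integrable_finsetSum _ fun k _ => (integrable_weight h0 h1 k).const_mul _) fun z => ?_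
  simp only
  linarith [Real.add_one_le_exp (-∑ k, 2 * (T : ℝ) * w k * z k)]

theorem integrable_one_sub_exp_laplaceExponent [SFinite ρ] (h0 : ∀ᵐ w ∂ρ, ∀ k, 0 ≤ w k)
    (h1 : ∀ k, ∫⁻ w, ENNReal.ofReal (w k) ∂ρ ≠ ⊤) (α T : ℝ≥0) :
    Integrable (fun w : Fin p → ℝ =>
      1 - Real.exp (-(α * laplaceExponent ρ fun k => 2 * T * w k))) ρ := by
  refine ((integrable_laplaceExponent h0 h1 T).const_mul (α : ℝ)).mono' ?_ ?_
  · have := aestronglyMeasurable_laplaceExponent (ρ := ρ) T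
    exact aestronglyMeasurable_const.sub
      (Real.continuous_exp.comp_aestronglyMeasurable (this.const_mul (α : ℝ)).neg)
  · filter_upwards [h0] with w hw
    have ht : ∀ k, 0 ≤ 2 * (T : ℝ) * w k := fun k => mul_nonneg (by positivity) (hw k)
    have hs := mul_nonneg (NNReal.coe_nonneg α) (laplaceExponent_nonneg h0 ht)
    rw [Real.norm_of_nonneg (sub_nonneg.2 (Real.exp_le_one_iff.2 (by linarith)))]
    linarith [Real.add_one_le_exp (-(α * laplaceExponent ρ fun k => 2 * T * w k))]

theorem lintegral_laplaceExponent [SFinite ρ] (h0 : ∀ᵐ w ∂ρ, ∀ k, 0 ≤ w k)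
    (h1 : ∀ k, ∫⁻ w, ENNReal.ofReal (w k) ∂ρ ≠ ⊤) (T : ℝ≥0) :
    ∫⁻ w, (∫⁻ z, (1 - expNeg (2 * (∑ k, ENNReal.ofReal (w k) * ENNReal.ofReal (z k)) * T)) ∂ρ) ∂ρ =
      ENNReal.ofReal (∫ w, (laplaceExponent ρ fun k => 2 * T * w k) ∂ρ) := by
  rw [ofReal_integral_eq_lintegral_ofReal (integrable_laplaceExponent h0 h1 T)]
  · refine lintegral_congr_ae ?_
    filter_upwards [h0] with w hw using (ofReal_laplaceExponent h0 h1 T hw).symm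
  · filter_upwards [h0] with w hw
    exact laplaceExponent_nonneg h0 fun k => mul_nonneg (by positivity) (hw k)

theorem lintegral_one_sub_expNeg_laplaceExponent [SFinite ρ] (h0 : ∀ᵐ w ∂ρ, ∀ k, 0 ≤ w k)
    (h1 : ∀ k, ∫⁻ w, ENNReal.ofReal (w k) ∂ρ ≠ ⊤) (α T : ℝ≥0) :
    ∫⁻ w, (1 - expNeg (α * ∫⁻ z,
        (1 - expNeg (2 * (∑ k, ENNReal.ofReal (w k) * ENNReal.ofReal (z k)) * T)) ∂ρ)) ∂ρ =
      ENNReal.ofReal (∫ w, (1 - Real.exp (-(α * laplaceExponent ρ fun k => 2 * T * w k))) ∂ρ) := by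
  have hnn : ∀ w : Fin p → ℝ, (∀ k, 0 ≤ w k) →
      0 ≤ α * laplaceExponent ρ fun k => 2 * T * w k := fun w hw =>
    mul_nonneg (NNReal.coe_nonneg α)
      (laplaceExponent_nonneg h0 fun k => mul_nonneg (by positivity) (hw k))
  rw [ofReal_integral_eq_lintegral_ofReal (integrable_one_sub_exp_laplaceExponent h0 h1 α T)]
  · refine lintegral_congr_ae ?_
    filter_upwards [h0] with w hw
    rw [← ofReal_laplaceExponent h0 h1 T hw, ← one_sub_expNeg_ofReal (hnn w hw),
      ENNReal.ofReal_mul (NNReal.coe_nonneg α), ENNReal.ofReal_coe_nnreal]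
  · filter_upwards [h0] with w hw
    exact sub_nonneg.2 (Real.exp_le_one_iff.2 (by linarith [hnn w hw]))

end LaplaceExponent

-- The nodes as a marked Poisson process.

section MarkedPoints

variable {Ω : Type*} [mΩ : MeasurableSpace Ω] {P : Measure Ω} {p : ℕ}
  {a b : Fin p → ℝ} {σ τ η δ : ℝ}

/-- The base weight, the label and the scores of a node. -/
def Network.point (X : Network Ω p) (i : ℕ) (ω : Ω) : (ℝ × ℝ) × (Fin p → ℝ) :=
  ((X.w₀ i ω, X.θ i ω), fun k => X.β i k ω)

/-- The mean measure of the base weights, labels and scores of the nodes. -/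
def pointIntensity (a b : Fin p → ℝ) (σ τ : ℝ) : Measure ((ℝ × ℝ) × (Fin p → ℝ)) :=
  ((ggpLevy σ τ).prod (volume.restrict (Set.Ici 0))).prod
    (Measure.pi fun k => gammaMeasure (a k) (b k))

theorem sigmaFinite_pointIntensity (ha : ∀ k, 0 < a k) (hb : ∀ k, 0 < b k) :
    SigmaFinite (pointIntensity a b σ τ) := by
  have := fun k => isProbabilityMeasure_gammaMeasure (ha k) (hb k)
  unfold pointIntensity
  infer_instance

theorem sfinite_levy (ha : ∀ k, 0 < a k) (hb : ∀ k, 0 < b k) : SFinite (levy a b σ τ) := by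
  have := fun k => isProbabilityMeasure_gammaMeasure (ha k) (hb k)
  unfold levy
  infer_instance

/-- The weight of the node with the given base weight, label and scores. -/
def pointWeight (y : (ℝ × ℝ) × (Fin p → ℝ)) (k : Fin p) : ℝ≥0∞ := ENNReal.ofReal (y.1.1 * y.2 k)

/-- The indicator that a label is at most `α`. -/
def labelLE (α : ℝ≥0) (y : (ℝ × ℝ) × (Fin p → ℝ)) : ℝ≥0∞ := (Set.Iic (α : ℝ)).indicator 1 y.1.2

theorem measurable_pointWeight (k : Fin p) :
    Measurable fun y : (ℝ × ℝ) × (Fin p → ℝ) => pointWeight y k := by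
  unfold pointWeight
  fun_prop

theorem measurable_labelLE (α : ℝ≥0) : Measurable (labelLE (p := p) α) :=
  (measurable_one.indicator measurableSet_Iic).comp (measurable_snd.comp measurable_fst)

theorem labelLE_eq_zero_or_one (α : ℝ≥0) (y : (ℝ × ℝ) × (Fin p → ℝ)) :
    labelLE α y = 0 ∨ labelLE α y = 1 := by
  unfold labelLE
  by_cases h : y.1.2 ∈ Set.Iic (α : ℝ)
  · exact Or.inr (Set.indicator_of_mem h _)
  · exact Or.inl (Set.indicator_of_notMem h _)

theorem labelLE_ne_top (α : ℝ≥0) (y : (ℝ × ℝ) × (Fin p → ℝ)) : labelLE α y ≠ ⊤ := by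
  rcases labelLE_eq_zero_or_one α y with h | h <;> simp [h]

theorem Network.measurable_point (X : Network Ω p) (i : ℕ) : Measurable (X.point i) :=
  ((X.measurable_w₀ i).prodMk (X.measurable_θ i)).prodMk (measurable_pi_iff.2 (X.measurable_β i))

/-- Joint independence over `(i, k)` makes the law an infinite product; currying groups it into
i.i.d. score vectors, one per node, as marking requires. -/
theorem IsHawkesCCRM.map_scores [IsProbabilityMeasure P] {X : Network Ω p}
    (hX : IsHawkesCCRM X P a b σ τ η δ) (ha : ∀ k, 0 < a k) (hb : ∀ k, 0 < b k) :
    P.map (fun ω i k => X.β i k ω) =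
      Measure.infinitePi fun _ : ℕ => Measure.pi fun k => gammaMeasure (a k) (b k) := by
  have := fun k => isProbabilityMeasure_gammaMeasure (ha k) (hb k)
  have h := iIndepFun.hasLaw_infinitePi (X := fun q : ℕ × Fin p => X.β q.1 q.2)
    (μ := fun q => gammaMeasure (a q.2) (b q.2)) (fun q => hX.score_law q.1 q.2) hX.score_indep
    (measurable_pi_iff.2 fun q : ℕ × Fin p => X.measurable_β q.1 q.2).aemeasurable
  have h2 := Measure.infinitePi_map_curry (fun (_ : ℕ) (k : Fin p) => gammaMeasure (a k) (b k))
  simp_rw [Measure.infinitePi_eq_pi] at h2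
  rw [← h2, ← h.map_eq, Measure.map_map (MeasurableEquiv.measurable _)
    (measurable_pi_iff.2 fun q : ℕ × Fin p => X.measurable_β q.1 q.2)]
  rfl

theorem IsHawkesCCRM.hasPoissonLaplace [IsProbabilityMeasure P] {X : Network Ω p}
    (hX : IsHawkesCCRM X P a b σ τ η δ) (ha : ∀ k, 0 < a k) (hb : ∀ k, 0 < b k) :
    HasPoissonLaplace X.point (pointIntensity a b σ τ) P := by
  have := fun k => isProbabilityMeasure_gammaMeasure (ha k) (hb k)
  exact hX.poisson.hasPoissonLaplace.marking (B := fun i ω k => X.β i k ω)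
    (fun i => (X.measurable_w₀ i).prodMk (X.measurable_θ i))
    (fun i => measurable_pi_iff.2 (X.measurable_β i)) (hX.map_scores ha hb) hX.indep

/-- The labels carry Lebesgue measure on `[0, ∞)`, so the condition on the label contributes the
length `α`; the image of base weights and scores under multiplication is the Lévy measure. -/
theorem lintegral_labelLE_mul (ha : ∀ k, 0 < a k) (hb : ∀ k, 0 < b k) (α : ℝ≥0)
    {φ : (Fin p → ℝ) → ℝ≥0∞} (hφ : Measurable φ) :
    ∫⁻ y, labelLE α y * φ (y.1.1 • y.2) ∂pointIntensity a b σ τ =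
      α * ∫⁻ w, φ w ∂levy a b σ τ := by
  have := fun k => isProbabilityMeasure_gammaMeasure (ha k) (hb k)
  have hs : Measurable fun x : ℝ × (Fin p → ℝ) => φ (x.1 • x.2) := hφ.comp measurable_smul_pi
  have hs1 : Measurable fun y : (ℝ × ℝ) × (Fin p → ℝ) => φ (y.1.1 • y.2) :=
    hs.comp ((measurable_fst.comp measurable_fst).prodMk measurable_snd)
  have hm : Measurable fun y : (ℝ × ℝ) × (Fin p → ℝ) => labelLE α y * φ (y.1.1 • y.2) :=
    (measurable_labelLE α).mul hs1
  rw [pointIntensity, lintegral_prod _ hm.aemeasurable, levy,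
    lintegral_map hφ measurable_smul_pi, lintegral_prod _ hs.aemeasurable]
  have h1 : ∀ x : ℝ × ℝ, ∫⁻ z, labelLE α (x, z) * φ (x.1 • z)
      ∂(Measure.pi fun k => gammaMeasure (a k) (b k)) =
      (∫⁻ z, φ (x.1 • z) ∂(Measure.pi fun k => gammaMeasure (a k) (b k))) *
        (Set.Iic (α : ℝ)).indicator 1 x.2 := by
    intro x
    have hx : Measurable fun z : Fin p → ℝ => φ (x.1 • z) := hs.comp measurable_prodMk_left
    rw [mul_comm, ← lintegral_const_mul _ hx]
    rfl
  simp_rw [h1]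
  have hg : Measurable fun x : ℝ =>
      ∫⁻ z, φ (x • z) ∂(Measure.pi fun k => gammaMeasure (a k) (b k)) := hs.lintegral_prod_right'
  have hi : Measurable ((Set.Iic (α : ℝ)).indicator (1 : ℝ → ℝ≥0∞)) :=
    measurable_one.indicator measurableSet_Iic
  rw [lintegral_prod_mul (f := fun x : ℝ =>
      ∫⁻ z, φ (x • z) ∂(Measure.pi fun k => gammaMeasure (a k) (b k)))
    (g := (Set.Iic (α : ℝ)).indicator (1 : ℝ → ℝ≥0∞)) hg.aemeasurable hi.aemeasurable,
    lintegral_indicator_one measurableSet_Iic, Measure.restrict_apply measurableSet_Iic,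
    Set.Iic_inter_Ici, Real.volume_Icc, sub_zero, ENNReal.ofReal_coe_nnreal, mul_comm]

theorem ae_pointWeight_nonneg (ha : ∀ k, 0 < a k) (hb : ∀ k, 0 < b k) :
    ∀ᵐ y ∂pointIntensity a b σ τ, ∀ k, 0 ≤ y.1.1 * y.2 k := by
  have := fun k => isProbabilityMeasure_gammaMeasure (ha k) (hb k)
  have h1 : ∀ᵐ y ∂pointIntensity a b σ τ, 0 < y.1.1 :=
    Measure.quasiMeasurePreserving_fst.ae
      (Measure.quasiMeasurePreserving_fst.ae (ae_pos_ggpLevy σ τ))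
  have h2 : ∀ᵐ y ∂pointIntensity a b σ τ, ∀ k, 0 ≤ y.2 k := by
    refine ae_all_iff.2 fun k => ?_
    exact Measure.quasiMeasurePreserving_snd.ae
      ((measurePreserving_eval (fun k => gammaMeasure (a k) (b k)) k).quasiMeasurePreserving.ae
        (ae_nonneg_gammaMeasure (a k) (b k)))
  filter_upwards [h1, h2] with y h1 h2 k using mul_nonneg h1.le (h2 k)

/-- By Campbell's formula the expected number of points violating `q` is `0`. -/
theorem HasPoissonLaplace.ae_forall [IsProbabilityMeasure P] {E : Type*} [MeasurableSpace E]
    {Y : ℕ → Ω → E} {m : Measure E} (hL : HasPoissonLaplace Y m P) (hY : ∀ i, Measurable (Y i))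
    {q : E → Prop} (hqm : MeasurableSet {y | ¬ q y}) (hq : ∀ᵐ y ∂m, q y) :
    ∀ᵐ ω ∂P, ∀ i, q (Y i ω) := by
  have hm : Measurable ({y | ¬ q y}.indicator (1 : E → ℝ≥0∞)) := measurable_one.indicator hqm
  have h := hL.lintegral_tsum hY hm
  have hs : Measurable fun ω => ∑' i, {y | ¬ q y}.indicator (1 : E → ℝ≥0∞) (Y i ω) :=
    Measurable.tsum fun i => hm.comp (hY i)
  rw [lintegral_indicator_one hqm, ae_iff.1 hq, lintegral_eq_zero_iff hs] at h
  filter_upwards [h] with ω hω i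
  by_contra hc
  have := ENNReal.tsum_eq_zero.1 hω i
  rw [Set.indicator_of_mem (s := {y | ¬ q y}) hc] at this
  exact one_ne_zero this

/-- `ENNReal.ofReal` truncates negative numbers; it commutes with the inner product because all
weights are almost surely nonnegative. -/
theorem IsHawkesCCRM.ae_baseRate_eq [IsProbabilityMeasure P] {X : Network Ω p}
    (hX : IsHawkesCCRM X P a b σ τ η δ) (ha : ∀ k, 0 < a k) (hb : ∀ k, 0 < b k) :
    ∀ᵐ ω ∂P, ∀ i j, X.baseRate i j ω =
      ∑ k, pointWeight (X.point i ω) k * pointWeight (X.point j ω) k := by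
  have h := (hX.hasPoissonLaplace ha hb).ae_forall X.measurable_point ?_
    (ae_pointWeight_nonneg ha hb)
  · filter_upwards [h] with ω hω i j
    have hk : ∀ l k, 0 ≤ X.weight l k ω := fun l k => hω l k
    rw [Network.baseRate,
      ENNReal.ofReal_sum_of_nonneg fun k _ => mul_nonneg (hk i k) (hk j k)]
    exact Finset.sum_congr rfl fun k _ => ENNReal.ofReal_mul (hk i k)
  · have : MeasurableSet {y : (ℝ × ℝ) × (Fin p → ℝ) | ∀ k, 0 ≤ y.1.1 * y.2 k} := by
      simp only [Set.ofPred_forall]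
      refine MeasurableSet.iInter fun k => measurableSet_le measurable_const ?_
      fun_prop
    exact this.compl

end MarkedPoints

-- Expected numbers of edges and interactions.

section Expectations

variable {Ω : Type*} [mΩ : MeasurableSpace Ω] {P : Measure Ω} {p : ℕ}
  {a b : Fin p → ℝ} {σ τ η δ : ℝ} {X : Network Ω p}

theorem labelLE_point (X : Network Ω p) (α : ℝ≥0) (i : ℕ) (ω : Ω) :
    labelLE α (X.point i ω) = {ω | X.θ i ω ≤ α}.indicator 1 ω := rfl

theorem measurableSet_history_label (X : Network Ω p) (α : ℝ≥0) (i : ℕ) :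
    MeasurableSet[X.history 0] {ω | X.θ i ω ≤ α} :=
  X.measurable_history_θ i measurableSet_Iic

theorem measurableSet_label (X : Network Ω p) (α : ℝ≥0) (i : ℕ) :
    MeasurableSet {ω | X.θ i ω ≤ α} :=
  X.history.le 0 _ (measurableSet_history_label X α i)

theorem setLIntegral_label (X : Network Ω p) (α : ℝ≥0) (i : ℕ) (f : Ω → ℝ≥0∞) :
    ∫⁻ ω in {ω | X.θ i ω ≤ α}, f ω ∂P = ∫⁻ ω, labelLE α (X.point i ω) * f ω ∂P := by
  rw [← lintegral_indicator (measurableSet_label X α i)]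
  refine lintegral_congr fun ω => ?_
  rw [labelLE_point]
  by_cases h : ω ∈ {ω | X.θ i ω ≤ α}
  · rw [Set.indicator_of_mem h, Set.indicator_of_mem h, Pi.one_apply, one_mul]
  · rw [Set.indicator_of_notMem h, Set.indicator_of_notMem h, zero_mul]

theorem setLIntegral_label_inter (X : Network Ω p) (α : ℝ≥0) (i j : ℕ) (f : Ω → ℝ≥0∞) :
    ∫⁻ ω in {ω | X.θ i ω ≤ α} ∩ {ω | X.θ j ω ≤ α}, f ω ∂P =
      ∫⁻ ω, labelLE α (X.point i ω) * (labelLE α (X.point j ω) * f ω) ∂P := by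
  rw [← lintegral_indicator ((measurableSet_label X α i).inter (measurableSet_label X α j))]
  refine lintegral_congr fun ω => ?_
  rw [labelLE_point, labelLE_point]
  by_cases h : ω ∈ {ω | X.θ i ω ≤ α}
  · by_cases h' : ω ∈ {ω | X.θ j ω ≤ α}
    · rw [Set.indicator_of_mem (Set.mem_inter h h'), Set.indicator_of_mem h,
        Set.indicator_of_mem h', Pi.one_apply, one_mul, one_mul]
    · rw [Set.indicator_of_notMem (fun hi => h' hi.2), Set.indicator_of_notMem h', zero_mul,
        mul_zero]
  · rw [Set.indicator_of_notMem (fun hi => h hi.1), Set.indicator_of_notMem h, zero_mul]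

/-- The expectation of a sum over pairs of different nodes with label at most `α`. -/
theorem IsHawkesCCRM.tsum_tsum_baseRate [IsProbabilityMeasure P]
    (hX : IsHawkesCCRM X P a b σ τ η δ) (ha : ∀ k, 0 < a k) (hb : ∀ k, 0 < b k) (α : ℝ≥0)
    {φ : ℝ≥0∞ → ℝ≥0∞} (hφ : Monotone φ) (hφc : Continuous φ) (hφt : ∀ x, x ≠ ⊤ → φ x ≠ ⊤) :
    ∑' i, ∑' j, (if j = i then 0 else
      ∫⁻ ω in {ω | X.θ i ω ≤ α} ∩ {ω | X.θ j ω ≤ α}, φ (X.baseRate i j ω) ∂P) =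
    α * (α * ∫⁻ w, (∫⁻ z, φ (∑ k, ENNReal.ofReal (w k) * ENNReal.ofReal (z k))
      ∂levy a b σ τ) ∂levy a b σ τ) := by
  have := sigmaFinite_pointIntensity (σ := σ) (τ := τ) ha hb
  have := sfinite_levy (σ := σ) (τ := τ) ha hb
  have hv := measurable_labelLE (p := p) α
  obtain ⟨fn, hfn⟩ := exists_isSimpleLimit (E := (ℝ × ℝ) × (Fin p → ℝ)) (W := pointWeight)
    measurable_pointWeight (fun y k => ENNReal.ofReal_ne_top) hv (labelLE_ne_top α) hφ hφc hφt
  -- One label condition is the outer weight and the other is part of the kernel, so each of the two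
  -- integrations yields a factor `α`.
  have h := (hX.hasPoissonLaplace ha hb).lintegral_tsum_tsum X.measurable_point hv hfn
  have hm := hfn.measurable_uncurry
  have hψ : Measurable fun x : (Fin p → ℝ) × (Fin p → ℝ) =>
      φ (∑ k, ENNReal.ofReal (x.1 k) * ENNReal.ofReal (x.2 k)) :=
    hφc.measurable.comp (by fun_prop)
  have hin : ∀ y : (ℝ × ℝ) × (Fin p → ℝ),
      ∫⁻ z, labelLE α z * φ (∑ k, pointWeight y k * pointWeight z k) ∂pointIntensity a b σ τ =
      α * ∫⁻ z, φ (∑ k, pointWeight y k * ENNReal.ofReal (z k)) ∂levy a b σ τ := fun y =>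
    lintegral_labelLE_mul ha hb α
      (φ := fun z => φ (∑ k, pointWeight y k * ENNReal.ofReal (z k)))
      (hφc.measurable.comp (by fun_prop))
  have hout := lintegral_labelLE_mul (σ := σ) (τ := τ) ha hb α
    (φ := fun w => α * ∫⁻ z, φ (∑ k, ENNReal.ofReal (w k) * ENNReal.ofReal (z k)) ∂levy a b σ τ)
    ((hψ.lintegral_prod_right' (ν := levy a b σ τ)).const_mul _)
  simp_rw [hin] at h
  rw [lintegral_const_mul _ (hψ.lintegral_prod_right' (ν := levy a b σ τ))] at hout
  rw [← hout]
  refine Eq.trans ?_ h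
  have hite := measurable_tsum_ite X.measurable_point hm
  have hmi : ∀ i, Measurable fun ω => labelLE α (X.point i ω) := fun i =>
    hv.comp (X.measurable_point i)
  rw [lintegral_tsum (f := fun i ω => labelLE α (X.point i ω) *
      ∑' j, if j = i then 0 else labelLE α (X.point j ω) *
        φ (∑ k, pointWeight (X.point i ω) k * pointWeight (X.point j ω) k))
    fun i => ((hmi i).mul (hite i)).aemeasurable]
  refine tsum_congr fun i => ?_
  have hij : ∀ j, Measurable fun ω => if j = i then 0 else labelLE α (X.point j ω) *
      φ (∑ k, pointWeight (X.point i ω) k * pointWeight (X.point j ω) k) := fun j => by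
    split_ifs
    · exact measurable_const
    · exact hm.comp ((X.measurable_point i).prodMk (X.measurable_point j))
  simp_rw [← ENNReal.tsum_mul_left]
  rw [lintegral_tsum (f := fun j ω => labelLE α (X.point i ω) *
      if j = i then 0 else labelLE α (X.point j ω) *
        φ (∑ k, pointWeight (X.point i ω) k * pointWeight (X.point j ω) k))
    fun j => ((hmi i).mul (hij j)).aemeasurable]
  refine tsum_congr fun j => ?_
  split_ifs with hji
  · simp
  · rw [setLIntegral_label_inter]
    refine lintegral_congr_ae ?_
    filter_upwards [hX.ae_baseRate_eq ha hb] with ω hω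
    rw [hω]

/-- The probability that a node interacts with one of finitely many other nodes, given the
nodes. -/
theorem IsHawkesCCRM.lintegral_interacts [IsProbabilityMeasure P]
    (hX : IsHawkesCCRM X P a b σ τ η δ) {i : ℕ} {S : Finset ℕ} (hi : i ∉ S) {A : Set Ω}
    (hA : MeasurableSet[X.history 0] A) (T : ℝ≥0) :
    ∫⁻ ω in A, (Set.Ioi 0).indicator 1 (∑ j ∈ S, (X.N i j T ω + X.N j i T ω)) ∂P =
      ∫⁻ ω in A, (1 - expNeg (∑ j ∈ S, 2 * X.baseRate i j ω * T)) ∂P := by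
  classical
  have hA' := X.history.le 0 _ hA
  -- The star around `i`, in both directions. As `i ∉ S`, no directed pair is counted twice, and
  -- each neighbour contributes twice its base rate.
  set J : Finset (ℕ × ℕ) := S.image (fun j => (i, j)) ∪ S.image (fun j => (j, i)) with hJ
  have hmem : ∀ e, e ∈ J ↔ (∃ j ∈ S, (i, j) = e) ∨ ∃ j ∈ S, (j, i) = e := fun e => by
    simp [hJ]
  have hsum : ∀ f : ℕ × ℕ → ℝ≥0∞, ∑ e ∈ J, f e = ∑ j ∈ S, (f (i, j) + f (j, i)) := fun f => by
    rw [hJ, Finset.sum_union, Finset.sum_image, Finset.sum_image, Finset.sum_add_distrib]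
    · intro x _ y _ h
      exact congrArg Prod.fst h
    · intro x _ y _ h
      exact congrArg Prod.snd h
    · rw [Finset.disjoint_left]
      intro e h1 h2
      obtain ⟨j, hj, rfl⟩ := Finset.mem_image.1 h1
      obtain ⟨k, hk, h⟩ := Finset.mem_image.1 h2
      exact hi ((show k = i from congrArg Prod.fst h) ▸ hk)
  have hne : ∀ e ∈ J, e.1 ≠ e.2 := by
    intro e he
    rcases (hmem e).1 he with ⟨j, hj, rfl⟩ | ⟨j, hj, rfl⟩
    · exact fun h => hi (by simpa [← show i = j from h] using hj)
    · exact fun h => hi (by simpa [show j = i from h] using hj)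
  have hsw : ∀ e ∈ J, e.swap ∈ J := by
    intro e he
    rcases (hmem e).1 he with ⟨j, hj, rfl⟩ | ⟨j, hj, rfl⟩
    · exact (hmem _).2 (Or.inr ⟨j, hj, rfl⟩)
    · exact (hmem _).2 (Or.inl ⟨j, hj, rfl⟩)
  set Z : Ω → ℝ≥0∞ := fun ω => ∑ j ∈ S, (X.N i j T ω + X.N j i T ω) with hZ
  have hZm : Measurable Z :=
    Finset.measurable_sum _ fun j _ => (X.measurable_N i j T).add (X.measurable_N j i T)
  have hZ0 : {ω | ∀ e ∈ J, X.N e.1 e.2 T ω = 0} = {ω | Z ω = 0} := by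
    ext ω
    simp only [Set.mem_ofPred_eq]
    rw [← Finset.sum_eq_zero_iff, hsum fun e => X.N e.1 e.2 T ω]
  have hZs : MeasurableSet {ω | Z ω = 0} := hZm (measurableSet_singleton 0)
  have hone : Measurable[X.history 0] (A.indicator (1 : Ω → ℝ≥0∞)) := by
    have h1 : Measurable[X.history 0] (1 : Ω → ℝ≥0∞) := @measurable_const _ _ _ (X.history 0) 1
    exact h1.indicator hA
  have hGfin : ∫⁻ ω, A.indicator (1 : Ω → ℝ≥0∞) ω ∂P ≠ ⊤ := by
    rw [lintegral_indicator_one hA']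
    exact measure_ne_top _ _
  have h := hX.lintegral_no_event hne hsw hone hGfin T
  have hG : ∀ f : Ω → ℝ≥0∞, ∫⁻ ω, A.indicator 1 ω * f ω ∂P = ∫⁻ ω in A, f ω ∂P := fun f => by
    rw [← lintegral_indicator hA']
    refine lintegral_congr fun ω => ?_
    by_cases hω : ω ∈ A <;> simp [hω]
  rw [hG, hG, hZ0] at h
  have hexp : ∀ ω, (∑ e ∈ J, X.baseRate e.1 e.2 ω) * T = ∑ j ∈ S, 2 * X.baseRate i j ω * T := by
    intro ω
    rw [hsum fun e => X.baseRate e.1 e.2 ω, Finset.sum_mul]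
    refine Finset.sum_congr rfl fun j _ => ?_
    rw [X.baseRate_comm j i, two_mul]
  simp_rw [hexp] at h
  have hLm : Measurable fun ω => expNeg (∑ j ∈ S, 2 * X.baseRate i j ω * T) := by
    have := fun j => X.measurable_baseRate i j
    fun_prop
  have hfin : ∫⁻ ω in A, expNeg (∑ j ∈ S, 2 * X.baseRate i j ω * T) ∂P ≠ ⊤ := by
    refine ne_top_of_le_ne_top (b := ∫⁻ ω in A, 1 ∂P) ?_ (lintegral_mono fun ω => expNeg_le_one _)
    rw [setLIntegral_one]
    exact measure_ne_top _ _
  rw [lintegral_sub hLm hfin (ae_of_all _ fun ω => expNeg_le_one _), ← h, ← lintegral_sub]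
  · refine lintegral_congr fun ω => ?_
    change (Set.Ioi 0).indicator 1 (Z ω) = _
    by_cases hz : Z ω = 0
    · simp [hz]
    · rw [Set.indicator_of_mem (Set.mem_Ioi.2 (pos_iff_ne_zero.2 hz)),
        Set.indicator_of_notMem (s := {ω | Z ω = 0}) hz, tsub_zero]
      rfl
  · exact measurable_one.indicator hZs
  · rwa [h]
  · refine ae_of_all _ fun ω => ?_
    exact Set.indicator_le_self' (fun _ _ => zero_le) _

theorem Network.lintegral_edges_eq_tsum (X : Network Ω p) (α T : ℝ≥0) :
    ∫⁻ ω, X.edges α T ω ∂P = ∑' i, ∑' j, if i < j then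
      ∫⁻ ω in {ω | X.θ i ω ≤ α} ∩ {ω | X.θ j ω ≤ α},
        (Set.Ioi 0).indicator 1 (X.N i j T ω + X.N j i T ω) ∂P else 0 := by
  classical
  have hZ : ∀ i j, Measurable fun ω =>
      (Set.Ioi 0).indicator (1 : ℝ≥0∞ → ℝ≥0∞) (X.N i j T ω + X.N j i T ω) := fun i j =>
    (measurable_one.indicator measurableSet_Ioi).comp
      ((X.measurable_N i j T).add (X.measurable_N j i T))
  have hm : ∀ i, Measurable fun ω => labelLE α (X.point i ω) := fun i =>
    (measurable_labelLE α).comp (X.measurable_point i)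
  have hite : ∀ i j, Measurable fun ω => if i < j then labelLE α (X.point i ω) *
      (labelLE α (X.point j ω) *
        (Set.Ioi 0).indicator 1 (X.N i j T ω + X.N j i T ω)) else 0 := fun i j => by
    split_ifs
    · exact (hm i).mul ((hm j).mul (hZ i j))
    · exact measurable_const
  have hval : ∀ ω, X.edges α T ω = ∑' i, ∑' j, if i < j then labelLE α (X.point i ω) *
      (labelLE α (X.point j ω) *
        (Set.Ioi 0).indicator 1 (X.N i j T ω + X.N j i T ω)) else 0 := by
    intro ω
    refine tsum_congr fun i => tsum_congr fun j => ?_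
    simp only [labelLE_point, Set.indicator_apply, Set.mem_ofPred_eq, Set.mem_Ioi, Pi.one_apply]
    split_ifs <;> simp_all
  simp_rw [hval]
  rw [lintegral_tsum fun i => (Measurable.tsum (hite i)).aemeasurable]
  refine tsum_congr fun i => ?_
  rw [lintegral_tsum fun j => (hite i j).aemeasurable]
  refine tsum_congr fun j => ?_
  split_ifs
  · rw [setLIntegral_label_inter]
  · simp

theorem two_mul_tsum_tsum_lt {q : ℕ → ℕ → ℝ≥0∞} (hq : ∀ i j, q i j = q j i) :
    2 * ∑' i, ∑' j, (if i < j then q i j else 0) = ∑' i, ∑' j, if j = i then 0 else q i j := by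
  have hcomm : ∑' i, ∑' j, (if i < j then q i j else 0) =
      ∑' i, ∑' j, if j < i then q i j else 0 := by
    rw [ENNReal.tsum_comm]
    refine tsum_congr fun i => tsum_congr fun j => ?_
    rw [hq]
  rw [two_mul]
  nth_rw 2 [hcomm]
  rw [← ENNReal.tsum_add]
  refine tsum_congr fun i => ?_
  rw [← ENNReal.tsum_add]
  refine tsum_congr fun j => ?_
  rcases lt_trichotomy i j with h | h | h
  · rw [if_pos h, if_neg h.not_gt, if_neg h.ne', add_zero]
  · rw [if_neg h.not_lt, if_neg h.not_gt, if_pos h.symm, add_zero]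
  · rw [if_neg h.not_gt, if_pos h, if_neg h.ne, zero_add]

theorem IsHawkesCCRM.lintegral_edges [IsProbabilityMeasure P]
    (hX : IsHawkesCCRM X P a b σ τ η δ) (ha : ∀ k, 0 < a k) (hb : ∀ k, 0 < b k)
    (hσ : σ < 1) (hτ : 0 < τ) (α T : ℝ≥0) :
    ∫⁻ ω, X.edges α T ω ∂P = ENNReal.ofReal ((α : ℝ) ^ 2 / 2 *
      ∫ w, (laplaceExponent (levy a b σ τ) fun k => 2 * T * w k) ∂levy a b σ τ) := by
  classical
  have := sfinite_levy (σ := σ) (τ := τ) ha hb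
  set q : ℕ → ℕ → ℝ≥0∞ := fun i j => ∫⁻ ω in {ω | X.θ i ω ≤ α} ∩ {ω | X.θ j ω ≤ α},
    (Set.Ioi 0).indicator 1 (X.N i j T ω + X.N j i T ω) ∂P with hq
  -- A star with a single neighbour.
  have hq' : ∀ i j, j ≠ i → q i j = ∫⁻ ω in {ω | X.θ i ω ≤ α} ∩ {ω | X.θ j ω ≤ α},
      (1 - expNeg (2 * X.baseRate i j ω * T)) ∂P := by
    intro i j hij
    have h := hX.lintegral_interacts (i := i) (S := {j}) (by simpa using hij.symm)
      ((measurableSet_history_label X α i).inter (measurableSet_history_label X α j)) T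
    simpa only [Finset.sum_singleton] using h
  have hqs : ∀ i j, q i j = q j i := fun i j => by
    simp only [hq]
    rw [Set.inter_comm]
    simp_rw [add_comm]
  have hpair := hX.tsum_tsum_baseRate ha hb α (φ := fun x => 1 - expNeg (2 * x * T))
    (fun x y h => one_sub_expNeg_le_one_sub (by gcongr))
    (continuous_one_sub_expNeg.comp ((ENNReal.continuous_mul_const ENNReal.coe_ne_top).comp
      (ENNReal.continuous_const_mul ENNReal.ofNat_ne_top)))
    (fun x _ => ((tsub_le_self).trans_lt ENNReal.one_lt_top).ne)
  rw [lintegral_laplaceExponent (ae_levy_nonneg ha hb) (lintegral_levy_ne_top ha hb hσ hτ)] at hpair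
  have hsum : ∑' i, ∑' j, (if j = i then 0 else q i j) = _ := Eq.trans
    (tsum_congr fun i => tsum_congr fun j => by
      split_ifs with h
      · rfl
      · exact hq' i j h) hpair
  have h2 := two_mul_tsum_tsum_lt hqs
  rw [← X.lintegral_edges_eq_tsum α T] at h2
  rw [hsum] at h2
  -- The Poisson formula sums over ordered pairs and so counts each edge twice; hence the factor `1
  -- / 2`.
  rw [← ENNReal.mul_right_inj (a := 2) two_ne_zero ENNReal.ofNat_ne_top, h2]
  rw [show (2 : ℝ≥0∞) = ENNReal.ofReal 2 by simp, ← ENNReal.ofReal_coe_nnreal (p := α),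
    ← ENNReal.ofReal_mul (by positivity), ← ENNReal.ofReal_mul (by positivity),
    ← ENNReal.ofReal_mul (by positivity)]
  congr 1
  ring

/-- Coordinate by coordinate, the double integral of `w k * z k` is the square of the mean weight.
-/
theorem lintegral_lintegral_mul_levy (ha : ∀ k, 0 < a k) (hb : ∀ k, 0 < b k)
    (hσ : σ < 1) (hτ : 0 < τ) :
    ∫⁻ w, (∫⁻ z, (∑ k, ENNReal.ofReal (w k) * ENNReal.ofReal (z k)) ∂levy a b σ τ) ∂levy a b σ τ =
      ENNReal.ofReal (meanWeight (levy a b σ τ) ⬝ᵥ meanWeight (levy a b σ τ)) := by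
  have h0 := ae_levy_nonneg (σ := σ) (τ := τ) ha hb
  have h1 := lintegral_levy_ne_top ha hb hσ hτ
  have hm : ∀ k, Measurable fun w : Fin p → ℝ => ENNReal.ofReal (w k) := fun k =>
    (measurable_pi_apply k).ennreal_ofReal
  have hw : ∀ k, ENNReal.ofReal (meanWeight (levy a b σ τ) k) =
      ∫⁻ w, ENNReal.ofReal (w k) ∂levy a b σ τ := fun k =>
    ofReal_integral_eq_lintegral_ofReal (integrable_weight h0 h1 k) (h0.mono fun w h => h k)
  have hnn : ∀ k, 0 ≤ meanWeight (levy a b σ τ) k := fun k =>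
    integral_nonneg_of_ae (h0.mono fun w h => h k)
  have hin : ∀ w : Fin p → ℝ,
      ∫⁻ z, (∑ k, ENNReal.ofReal (w k) * ENNReal.ofReal (z k)) ∂levy a b σ τ =
        ∑ k, ENNReal.ofReal (w k) * ENNReal.ofReal (meanWeight (levy a b σ τ) k) := fun w => by
    rw [lintegral_finsetSum _ fun k _ => (hm k).const_mul _]
    exact Finset.sum_congr rfl fun k _ => by rw [lintegral_const_mul _ (hm k), hw]
  simp_rw [hin]
  rw [lintegral_finsetSum _ fun k _ => (hm k).mul_const _, dotProduct,
    ENNReal.ofReal_sum_of_nonneg fun k _ => mul_nonneg (hnn k) (hnn k)]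
  exact Finset.sum_congr rfl fun k _ => by
    rw [lintegral_mul_const _ (hm k), ← hw, ENNReal.ofReal_mul (hnn k)]

theorem meanWeight_dotProduct_nonneg : 0 ≤ meanWeight (levy a b σ τ) ⬝ᵥ meanWeight (levy a b σ τ) :=
  Finset.sum_nonneg fun _ _ => mul_self_nonneg _

/-- The expected number of interactions. -/
theorem IsHawkesCCRM.lintegral_sum_interactions [IsProbabilityMeasure P]
    (hX : IsHawkesCCRM X P a b σ τ η δ) (ha : ∀ k, 0 < a k) (hb : ∀ k, 0 < b k)
    (hσ : σ < 1) (hτ : 0 < τ) (hη : 0 ≤ η) (hδ : 0 ≤ δ) (hne : δ ≠ η) (α T : ℝ≥0) :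
    ∫⁻ ω, X.interactions α T ω ∂P = ENNReal.ofReal
      ((α : ℝ) ^ 2 * (meanWeight (levy a b σ τ) ⬝ᵥ meanWeight (levy a b σ τ)) *
        (δ / (δ - η) * T - η / (δ - η) ^ 2 * (1 - Real.exp (-(T * (δ - η)))))) := by
  classical
  set h : ℝ≥0∞ := ENNReal.ofReal
    (δ / (δ - η) * T - η / (δ - η) ^ 2 * (1 - Real.exp (-(T * (δ - η))))) with hh
  set A : ℕ → ℕ → Set Ω := fun i j => {ω | X.θ i ω ≤ α} ∩ {ω | X.θ j ω ≤ α} with hA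
  set q : ℕ → ℕ → ℝ≥0∞ := fun i j => if j = i then 0 else ∫⁻ ω in A i j, X.N i j T ω ∂P with hq
  -- The Volterra argument gives only the sum of the two directions. This suffices, because the sum
  -- over ordered pairs is half of its symmetrization.
  have hq2 : ∀ i j, q i j + q j i =
      2 * h * if j = i then 0 else ∫⁻ ω in A i j, X.baseRate i j ω ∂P := by
    intro i j
    by_cases hji : j = i
    · simp [hq, hji]
    · have hs := hX.lintegral_interactions hη hδ hne (Ne.symm hji)
        ((measurableSet_history_label X α i).inter (measurableSet_history_label X α j)) T
      rw [lintegral_add_left (X.measurable_N i j T)] at hs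
      simp only [hq, if_neg hji, if_neg (Ne.symm hji)]
      rw [show A j i = A i j from Set.inter_comm _ _]
      exact hs.trans (by ring)
  have hpair := hX.tsum_tsum_baseRate ha hb α (φ := id) monotone_id continuous_id fun _ hx => hx
  simp only [id] at hpair
  rw [lintegral_lintegral_mul_levy ha hb hσ hτ] at hpair
  have hI : ∫⁻ ω, X.interactions α T ω ∂P = ∑' i, ∑' j, q i j := by
    have hm : ∀ i, Measurable fun ω => labelLE α (X.point i ω) := fun i =>
      (measurable_labelLE α).comp (X.measurable_point i)
    have hite : ∀ i j, Measurable fun ω => if j = i then 0 else labelLE α (X.point i ω) *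
        (labelLE α (X.point j ω) * X.N i j T ω) := fun i j => by
      split_ifs
      · exact measurable_const
      · exact (hm i).mul ((hm j).mul (X.measurable_N i j T))
    have hval : ∀ ω, X.interactions α T ω = ∑' i, ∑' j, if j = i then 0 else
        labelLE α (X.point i ω) * (labelLE α (X.point j ω) * X.N i j T ω) := by
      intro ω
      refine tsum_congr fun i => tsum_congr fun j => ?_
      simp only [labelLE_point, Set.indicator_apply, Set.mem_ofPred_eq, Pi.one_apply,
        ne_comm (a := i), ne_eq]
      split_ifs <;> simp_all
    simp_rw [hval]
    rw [lintegral_tsum fun i => (Measurable.tsum (hite i)).aemeasurable]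
    refine tsum_congr fun i => ?_
    rw [lintegral_tsum fun j => (hite i j).aemeasurable]
    refine tsum_congr fun j => ?_
    simp only [hq]
    split_ifs
    · simp
    · rw [setLIntegral_label_inter]
  have h2 : 2 * ∫⁻ ω, X.interactions α T ω ∂P = 2 * (h * (α * (α * ENNReal.ofReal
      (meanWeight (levy a b σ τ) ⬝ᵥ meanWeight (levy a b σ τ))))) := by
    rw [← hpair, ← mul_assoc, ← ENNReal.tsum_mul_left, two_mul]
    nth_rw 2 [hI]
    rw [ENNReal.tsum_comm, hI, ← ENNReal.tsum_add]
    refine tsum_congr fun i => ?_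
    rw [← ENNReal.tsum_mul_left, ← ENNReal.tsum_add]
    exact tsum_congr fun j => hq2 i j
  rw [ENNReal.mul_right_inj two_ne_zero ENNReal.ofNat_ne_top] at h2
  rw [h2, ENNReal.ofReal_mul (mul_nonneg (sq_nonneg _) meanWeight_dotProduct_nonneg),
    ENNReal.ofReal_mul (sq_nonneg _), ENNReal.ofReal_pow (NNReal.coe_nonneg α),
    ENNReal.ofReal_coe_nnreal]
  ring

end Expectations

-- Expected number of active nodes.

section ActiveNodes

variable {Ω : Type*} [mΩ : MeasurableSpace Ω] {P : Measure Ω} {p : ℕ}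
  {a b : Fin p → ℝ} {σ τ η δ : ℝ} {X : Network Ω p}

/-- The admissible partners are random, but known at time 0. Induction on the undecided nodes `R`:
splitting `A` by the label of `r` either moves `r` into the decided partners `S` or drops it, until
the formula for a deterministic set of partners applies. -/
theorem IsHawkesCCRM.lintegral_interacts_label [IsProbabilityMeasure P]
    (hX : IsHawkesCCRM X P a b σ τ η δ) {i : ℕ} (α T : ℝ≥0) (R : Finset ℕ) (hR : i ∉ R) :
    ∀ S : Finset ℕ, i ∉ S → Disjoint S R → ∀ A : Set Ω, MeasurableSet[X.history 0] A →
    ∫⁻ ω in A, (Set.Ioi 0).indicator 1 (∑ j ∈ S, (X.N i j T ω + X.N j i T ω) +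
      ∑ j ∈ R, labelLE α (X.point j ω) * (X.N i j T ω + X.N j i T ω)) ∂P =
    ∫⁻ ω in A, (1 - expNeg (∑ j ∈ S, 2 * X.baseRate i j ω * T +
      ∑ j ∈ R, labelLE α (X.point j ω) * (2 * X.baseRate i j ω * T))) ∂P := by
  classical
  induction R using Finset.induction_on with
  | empty =>
    intro S hS _ A hA
    simpa only [Finset.sum_empty, add_zero] using hX.lintegral_interacts hS hA T
  | insert r R hr ih =>
    intro S hS hSR A hA
    rw [Finset.disjoint_insert_right] at hSR
    rw [Finset.mem_insert, not_or] at hR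
    have hB0 := measurableSet_history_label X α r
    have hB := measurableSet_label X α r
    have hA' := X.history.le 0 _ hA
    have h1 := ih hR.2 (insert r S) (by simpa [hR.1] using hS)
      (Finset.disjoint_insert_left.2 ⟨hr, hSR.2⟩) _ (hA.inter hB0)
    have h0 := ih hR.2 S hS hSR.2 _ (hA.diff hB0)
    have hsum1 : ∀ g : ℕ → Ω → ℝ≥0∞, ∀ ω ∈ A ∩ {ω | X.θ r ω ≤ α},
        ∑ j ∈ S, g j ω + ∑ j ∈ insert r R, labelLE α (X.point j ω) * g j ω =
        ∑ j ∈ insert r S, g j ω + ∑ j ∈ R, labelLE α (X.point j ω) * g j ω := by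
      intro g ω hω
      rw [Finset.sum_insert hr, Finset.sum_insert hSR.1, labelLE_point,
        Set.indicator_of_mem hω.2, Pi.one_apply, one_mul, add_left_comm, add_assoc]
    have hsum0 : ∀ g : ℕ → Ω → ℝ≥0∞, ∀ ω ∈ A \ {ω | X.θ r ω ≤ α},
        ∑ j ∈ S, g j ω + ∑ j ∈ insert r R, labelLE α (X.point j ω) * g j ω =
        ∑ j ∈ S, g j ω + ∑ j ∈ R, labelLE α (X.point j ω) * g j ω := by
      intro g ω hω
      rw [Finset.sum_insert hr, labelLE_point, Set.indicator_of_notMem hω.2, zero_mul, zero_add]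
    rw [← lintegral_inter_add_sdiff _ A hB, ← lintegral_inter_add_sdiff (fun ω => 1 - _) A hB]
    congr 1
    · rw [setLIntegral_congr_fun (hA'.inter hB) fun ω hω => by
          rw [hsum1 (fun j ω => X.N i j T ω + X.N j i T ω) ω hω], h1]
      exact (setLIntegral_congr_fun (hA'.inter hB) fun ω hω => by
        rw [hsum1 (fun j ω => 2 * X.baseRate i j ω * T) ω hω]).symm
    · rw [setLIntegral_congr_fun (hA'.diff hB) fun ω hω => by
          rw [hsum0 (fun j ω => X.N i j T ω + X.N j i T ω) ω hω], h0]
      exact (setLIntegral_congr_fun (hA'.diff hB) fun ω hω => by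
        rw [hsum0 (fun j ω => 2 * X.baseRate i j ω * T) ω hω]).symm

theorem sum_range_ite_eq (g : ℕ → ℝ≥0∞) (i n : ℕ) :
    ∑ j ∈ Finset.range n, (if j = i then 0 else g j) = ∑ j ∈ (Finset.range n).erase i, g j := by
  rw [← Finset.filter_ne', Finset.sum_filter]
  simp_rw [ne_eq, ite_not]

theorem monotone_sum_range (g : ℕ → ℝ≥0∞) : Monotone fun n => ∑ j ∈ Finset.range n, g j :=
  fun _ _ h => Finset.sum_le_sum_of_subset (Finset.range_mono h)

/-- The probability that a node interacts with one of the nodes with label at most `α`, given the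
nodes. -/
theorem IsHawkesCCRM.lintegral_active [IsProbabilityMeasure P]
    (hX : IsHawkesCCRM X P a b σ τ η δ) (i : ℕ) (α T : ℝ≥0) {A : Set Ω}
    (hA : MeasurableSet[X.history 0] A) :
    ∫⁻ ω in A, (Set.Ioi 0).indicator 1 (∑' j, if j = i then 0 else
      labelLE α (X.point j ω) * (X.N i j T ω + X.N j i T ω)) ∂P =
    ∫⁻ ω in A, (1 - expNeg (∑' j, if j = i then 0 else
      labelLE α (X.point j ω) * (2 * X.baseRate i j ω * T))) ∂P := by
  have hlab : ∀ j, Measurable fun ω => labelLE α (X.point j ω) := fun j =>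
    (measurable_labelLE α).comp (X.measurable_point j)
  have hN := X.measurable_N
  have hbase := X.measurable_baseRate
  have hNm : ∀ j, Measurable fun ω => if j = i then 0 else
      labelLE α (X.point j ω) * (X.N i j T ω + X.N j i T ω) := fun j => by
    split_ifs
    · exact measurable_const
    · exact (hlab j).mul ((hN i j T).add (hN j i T))
  have hbm : ∀ j, Measurable fun ω => if j = i then 0 else
      labelLE α (X.point j ω) * (2 * X.baseRate i j ω * T) := fun j => by
    split_ifs
    · exact measurable_const
    · exact (hlab j).mul (((hbase i j).const_mul 2).mul_const _)
  have hind : Measurable ((Set.Ioi 0).indicator (1 : ℝ≥0∞ → ℝ≥0∞)) :=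
    measurable_one.indicator measurableSet_Ioi
  have hmono : Monotone ((Set.Ioi 0).indicator (1 : ℝ≥0∞ → ℝ≥0∞)) := fun x y hxy => by
    by_cases hx : x ∈ Set.Ioi 0
    · rw [Set.indicator_of_mem hx, Set.indicator_of_mem (Set.mem_Ioi.2 (hx.trans_le hxy))]
      exact le_rfl
    · rw [Set.indicator_of_notMem hx]
      exact zero_le
  -- Both sides are increasing limits over the first `n` candidate partners, and agree for each `n`.
  refine tendsto_nhds_unique (lintegral_tendsto_of_tendsto_of_monotone
    (f := fun n ω => (Set.Ioi 0).indicator 1 (∑ j ∈ Finset.range n, if j = i then 0 else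
      labelLE α (X.point j ω) * (X.N i j T ω + X.N j i T ω))) ?_ ?_ ?_) ?_
  · exact fun n => (hind.comp (Finset.measurable_sum _ fun j _ => hNm j)).aemeasurable
  · exact ae_of_all _ fun ω => hmono.comp (monotone_sum_range _)
  · refine ae_of_all _ fun ω => ?_
    have ht := ENNReal.tendsto_nat_tsum fun j => if j = i then 0 else
      labelLE α (X.point j ω) * (X.N i j T ω + X.N j i T ω)
    set s := ∑' j, if j = i then 0 else
      labelLE α (X.point j ω) * (X.N i j T ω + X.N j i T ω) with hs
    rcases eq_or_ne s 0 with h0 | h0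
    · have hz : ∀ n, (∑ j ∈ Finset.range n, if j = i then 0 else
          labelLE α (X.point j ω) * (X.N i j T ω + X.N j i T ω)) = 0 := fun n =>
        le_antisymm (((ENNReal.sum_le_tsum _).trans hs.ge).trans h0.le) zero_le
      simp only [hz, h0]
      exact tendsto_const_nhds
    · have hpos : (0 : ℝ≥0∞) < s := pos_iff_ne_zero.2 h0
      -- The indicator is discontinuous at `0`, but a positive sum has positive partial sums from
      -- some index on.
      refine tendsto_const_nhds.congr' ?_
      filter_upwards [ht.eventually (lt_mem_nhds hpos)] with n hn
      rw [Set.indicator_of_mem (Set.mem_Ioi.2 hpos), Set.indicator_of_mem (Set.mem_Ioi.2 hn)]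
      rfl
  · have hfin : ∀ n, ∫⁻ ω in A, (Set.Ioi 0).indicator 1 (∑ j ∈ Finset.range n,
          if j = i then 0 else labelLE α (X.point j ω) * (X.N i j T ω + X.N j i T ω)) ∂P =
        ∫⁻ ω in A, (1 - expNeg (∑ j ∈ Finset.range n, if j = i then 0 else
          labelLE α (X.point j ω) * (2 * X.baseRate i j ω * T))) ∂P := fun n => by
      simp_rw [sum_range_ite_eq]
      simpa only [Finset.sum_empty, zero_add] using hX.lintegral_interacts_label α T
        ((Finset.range n).erase i) (Finset.notMem_erase i _) ∅ (Finset.notMem_empty i)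
        (Finset.disjoint_empty_left _) A hA
    simp_rw [hfin]
    refine lintegral_tendsto_of_tendsto_of_monotone ?_ ?_ ?_
    · exact fun n => (continuous_one_sub_expNeg.measurable.comp
        (Finset.measurable_sum _ fun j _ => hbm j)).aemeasurable
    · exact ae_of_all _ fun ω => one_sub_expNeg_mono.comp (monotone_sum_range _)
    · exact ae_of_all _ fun ω =>
        (continuous_one_sub_expNeg.tendsto _).comp (ENNReal.tendsto_nat_tsum _)

theorem one_sub_expNeg_labelLE_mul (α : ℝ≥0) (y : (ℝ × ℝ) × (Fin p → ℝ)) (x : ℝ≥0∞) :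
    1 - expNeg (labelLE α y * x) = labelLE α y * (1 - expNeg x) := by
  rcases labelLE_eq_zero_or_one α y with h | h <;> simp [h, expNeg_zero]

/-- Given the nodes, node `i` is inactive with probability `exp (-∑ j, 2 T w i · w j)` over partners
with label at most `α`. The Mecke formula integrates the partners out to `exp (-α ψ (2 T w))` and
then the node itself, whose label contributes the outer `α`. -/
theorem IsHawkesCCRM.lintegral_activeNodes [IsProbabilityMeasure P]
    (hX : IsHawkesCCRM X P a b σ τ η δ) (ha : ∀ k, 0 < a k) (hb : ∀ k, 0 < b k)
    (hσ : σ < 1) (hτ : 0 < τ) (α T : ℝ≥0) :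
    ∫⁻ ω, X.activeNodes α T ω ∂P = ENNReal.ofReal (α * ∫ w, (1 - Real.exp
      (-(α * laplaceExponent (levy a b σ τ) fun k => 2 * T * w k))) ∂levy a b σ τ) := by
  classical
  have := sigmaFinite_pointIntensity (σ := σ) (τ := τ) ha hb
  have := sfinite_levy (σ := σ) (τ := τ) ha hb
  have hv := measurable_labelLE (p := p) α
  have hφc : Continuous fun x : ℝ≥0∞ => 2 * x * T :=
    (ENNReal.continuous_mul_const ENNReal.coe_ne_top).comp
      (ENNReal.continuous_const_mul ENNReal.ofNat_ne_top)
  obtain ⟨fn, hfn⟩ := exists_isSimpleLimit (E := (ℝ × ℝ) × (Fin p → ℝ)) (W := pointWeight)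
    (φ := fun x => 2 * x * T) measurable_pointWeight (fun y k => ENNReal.ofReal_ne_top) hv
    (labelLE_ne_top α) (fun x y h => by dsimp only; gcongr) hφc
    (fun x hx => ENNReal.mul_ne_top (ENNReal.mul_ne_top ENNReal.ofNat_ne_top hx)
      ENNReal.coe_ne_top)
  have h := (hX.hasPoissonLaplace ha hb).lintegral_tsum_one_sub_expNeg X.measurable_point hv hfn
  have hψ : Measurable fun x : (Fin p → ℝ) × (Fin p → ℝ) =>
      1 - expNeg (2 * (∑ k, ENNReal.ofReal (x.1 k) * ENNReal.ofReal (x.2 k)) * T) :=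
    (continuous_one_sub_expNeg.comp hφc).measurable.comp (by fun_prop)
  have hin : ∀ y : (ℝ × ℝ) × (Fin p → ℝ),
      ∫⁻ z, (1 - expNeg (labelLE α z * (2 * (∑ k, pointWeight y k * pointWeight z k) * T)))
        ∂pointIntensity a b σ τ =
      α * ∫⁻ z, (1 - expNeg (2 * (∑ k, pointWeight y k * ENNReal.ofReal (z k)) * T))
        ∂levy a b σ τ := fun y => by
    -- The label indicator takes the values `0` and `1`, so it can be pulled out of `1 - exp (-·)`.
    simp_rw [one_sub_expNeg_labelLE_mul]
    exact lintegral_labelLE_mul ha hb α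
      (φ := fun z => 1 - expNeg (2 * (∑ k, pointWeight y k * ENNReal.ofReal (z k)) * T))
      ((continuous_one_sub_expNeg.comp hφc).measurable.comp (by fun_prop))
  have hout := lintegral_labelLE_mul (σ := σ) (τ := τ) ha hb α
    (φ := fun w => 1 - expNeg (α * ∫⁻ z, (1 - expNeg (2 * (∑ k, ENNReal.ofReal (w k) *
      ENNReal.ofReal (z k)) * T)) ∂levy a b σ τ))
    (continuous_one_sub_expNeg.measurable.comp
      ((hψ.lintegral_prod_right' (ν := levy a b σ τ)).const_mul _))
  simp_rw [hin] at h
  rw [lintegral_one_sub_expNeg_laplaceExponent (ae_levy_nonneg ha hb)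
    (lintegral_levy_ne_top ha hb hσ hτ), ← ENNReal.ofReal_coe_nnreal (p := α),
    ← ENNReal.ofReal_mul (NNReal.coe_nonneg α)] at hout
  rw [← hout, ENNReal.ofReal_coe_nnreal]
  refine Eq.trans ?_ h
  have hZ : ∀ i, Measurable fun ω => ∑' j, if j = i then 0 else
      labelLE α (X.point j ω) * (X.N i j T ω + X.N j i T ω) := fun i => by
    refine Measurable.tsum fun j => ?_
    split_ifs
    · exact measurable_const
    · exact (hv.comp (X.measurable_point j)).mul ((X.measurable_N i j T).add (X.measurable_N j i T))
  have hZm : ∀ i, Measurable fun ω => labelLE α (X.point i ω) * (Set.Ioi 0).indicator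
      (1 : ℝ≥0∞ → ℝ≥0∞) (∑' j, if j = i then 0 else
        labelLE α (X.point j ω) * (X.N i j T ω + X.N j i T ω)) := fun i =>
    (hv.comp (X.measurable_point i)).mul ((measurable_one.indicator measurableSet_Ioi).comp (hZ i))
  have hval : ∀ ω, X.activeNodes α T ω = ∑' i, labelLE α (X.point i ω) * (Set.Ioi 0).indicator
      (1 : ℝ≥0∞ → ℝ≥0∞) (∑' j, if j = i then 0 else
        labelLE α (X.point j ω) * (X.N i j T ω + X.N j i T ω)) := by
    intro ω
    refine tsum_congr fun i => ?_
    have hj : ∀ j, (if j ≠ i ∧ X.θ j ω ≤ α then X.N i j T ω + X.N j i T ω else 0) =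
        if j = i then 0 else labelLE α (X.point j ω) * (X.N i j T ω + X.N j i T ω) := by
      intro j
      simp only [labelLE_point, Set.indicator_apply, Set.mem_ofPred_eq, Pi.one_apply, ne_eq]
      split_ifs <;> simp_all
    simp_rw [hj]
    rw [labelLE_point]
    simp only [Set.indicator_apply, Set.mem_ofPred_eq, Set.mem_Ioi, Pi.one_apply, ite_and,
      ite_mul, one_mul, zero_mul]
  simp_rw [hval]
  have hexp : ∀ i, Measurable fun ω => labelLE α (X.point i ω) * (1 - expNeg (∑' j,
      if j = i then 0 else labelLE α (X.point j ω) *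
        (2 * (∑ k, pointWeight (X.point i ω) k * pointWeight (X.point j ω) k) * T))) := fun i =>
    (hv.comp (X.measurable_point i)).mul (continuous_one_sub_expNeg.measurable.comp
      (measurable_tsum_ite X.measurable_point hfn.measurable_uncurry i))
  rw [lintegral_tsum fun i => (hZm i).aemeasurable, lintegral_tsum fun i => (hexp i).aemeasurable]
  refine tsum_congr fun i => ?_
  rw [← setLIntegral_label, hX.lintegral_active i α T (measurableSet_history_label X α i),
    setLIntegral_label]
  refine lintegral_congr_ae ?_
  filter_upwards [hX.ae_baseRate_eq ha hb] with ω hω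
  simp_rw [hω]

end ActiveNodes

end HawkesCCRM

end

-- The theorem.

theorem theorem1 {Ω : Type*} [MeasurableSpace Ω] (P : Measure Ω) [IsProbabilityMeasure P]
    {p : ℕ} (a b : Fin p → ℝ) (ha : ∀ k, 0 < a k) (hb : ∀ k, 0 < b k)
    (σ τ : ℝ) (hσ : σ < 1) (hτ : 0 < τ) (η δ : ℝ) (hη : 0 ≤ η) (hδ : 0 ≤ δ)
    (X : HawkesCCRM.Network Ω p) (hX : HawkesCCRM.IsHawkesCCRM X P a b σ τ η δ)
    (ρ : Measure (Fin p → ℝ)) (hρ : ρ = HawkesCCRM.levy a b σ τ)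
    (ψ : (Fin p → ℝ) → ℝ) (hψ : ψ = HawkesCCRM.laplaceExponent ρ) (α T : ℝ≥0) :
    -- the integrals that define the mean vector and the Laplace exponent converge
    (∀ k, Integrable (fun w : Fin p → ℝ => w k) ρ) ∧
    (∀ t : Fin p → ℝ, (∀ k, 0 ≤ t k) →
      Integrable (fun w : Fin p → ℝ => 1 - Real.exp (-∑ k, t k * w k)) ρ) ∧
    -- interactions
    (δ ≠ η →
      ∫⁻ ω, X.interactions α T ω ∂P = ENNReal.ofReal
        ((α : ℝ) ^ 2 * (HawkesCCRM.meanWeight ρ ⬝ᵥ HawkesCCRM.meanWeight ρ) *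
          (δ / (δ - η) * T - η / (δ - η) ^ 2 * (1 - Real.exp (-(T * (δ - η))))))) ∧
    -- edges
    (Integrable (fun w : Fin p → ℝ => ψ (fun k => 2 * T * w k)) ρ ∧
      ∫⁻ ω, X.edges α T ω ∂P =
        ENNReal.ofReal ((α : ℝ) ^ 2 / 2 * ∫ w, ψ (fun k => 2 * T * w k) ∂ρ)) ∧
    -- active nodes
    (Integrable (fun w : Fin p → ℝ => 1 - Real.exp (-(α * ψ (fun k => 2 * T * w k)))) ρ ∧
      ∫⁻ ω, X.activeNodes α T ω ∂P =
        ENNReal.ofReal (α * ∫ w, (1 - Real.exp (-(α * ψ (fun k => 2 * T * w k)))) ∂ρ)) := by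
  subst hψ hρ
  have := HawkesCCRM.sfinite_levy (σ := σ) (τ := τ) ha hb
  have h0 := HawkesCCRM.ae_levy_nonneg (σ := σ) (τ := τ) ha hb
  have h1 := HawkesCCRM.lintegral_levy_ne_top ha hb hσ hτ
  exact ⟨HawkesCCRM.integrable_weight h0 h1,
    fun t ht => HawkesCCRM.integrable_one_sub_exp h0 h1 ht,
    fun hne => hX.lintegral_sum_interactions ha hb hσ hτ hη hδ hne α T,
    ⟨HawkesCCRM.integrable_laplaceExponent h0 h1 T, hX.lintegral_edges ha hb hσ hτ α T⟩,
    ⟨HawkesCCRM.integrable_one_sub_exp_laplaceExponent h0 h1 α T,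
      hX.lintegral_activeNodes ha hb hσ hτ α T⟩⟩
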